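/- **Setting.** For $x\in\{\pm1\}^n$ let $\mathsf{SBM}_n(\gamma,d,x)$ be the random graph on $[n]$ in which every pair $\{i,j\}$, $i\ne j$, is an edge independently with probability $(1+\gamma x_ix_j)\frac dn$; the model is said to be defined if $\gamma\le 1$ and $(1+\gamma)d\le n$. For $\hat x,x\in\{\pm1\}^n$ let $\mathrm{err}(\hat x,x)=\frac1n\min\{\mathrm{Ham}(\hat x,x),\mathrm{Ham}(\hat x,-x)\}$. Two graphs on $[n]$ are adjacent if their edge sets differ in exactly one edge. A randomized algorithm $\mathcal M$ on graphs is $(\varepsilon,\delta)$-edge-DP if $\Pr[\mathcal M(G)\in S]\le e^{\varepsilon}\Pr[\mathcal M(G')\in S]+\delta$ for all adjacent $G,G'$ on $[n]$ and all sets $S$ of outputs. The numbers $n,\gamma,d,\varepsilon,\delta$ are public. **Algorithm $\mathcal A$.** Let $Y(G)=\frac1{\gamma d}\bigl(A(G)-\frac dn J\bigr)$, where $A(G)$ is the adjacency matrix of $G$ and $J$ the all-ones matrix, and let $\mathcal K=\{X\in\mathbb R^{n\times n}: X\succeq0,\ X_{ii}=\frac1n\ \forall i\}$. 1. $X_1=\arg\min_{X\in\mathcal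 K}\|Y(G)-X\|_F^2$. 2. $X_2=X_1+W$, where $W$ is a symmetric matrix whose entries on and above the diagonal are independent $N(0,\sigma^2)$ variables, $\sigma^2=\frac{24}{n\gamma d}\cdot\frac{\log(2/\delta)}{\varepsilon^2}$. 3. Return $\mathrm{sign}(v)$, where $v=v(X_2)$ is a leading eigenvector of $X_2$, chosen by a measurable rule $X\mapsto v(X)$; $\mathrm{sign}(0)=1$. **Computation model.** A program is a uniform program (one for all $n$ and all parameters, with only rational constants) over exact real arithmetic: integer index variables, two-dimensional real arrays, assignments, conditionals comparing two reals, bounded loops, the operations $+,-,\times,\div,\sqrt{\cdot},\log$ on reals, $+,\times$ on indices, and independent draws from $N(0,1)$. Running time is the number of operations performed; bit complexity is ignored. The input is $n$, an accuracy parameter $q\in\mathbb N$, the reals $\gamma,d,\varepsilon,\delta$ and the adjacency matrix of $G$; the output is a vector in $\{\pm1\}^n$. **Theorem.** There are absolute constants $C,c>0$ and $K\in\mathbb N$ and one program $P$ such that the following holds for all $n\in\mathbb N$ and all reals $\gamma,d>0$ with $\gamma\sqrt d\ge12800$, all $\varepsilon>0$ and all $0<\delta\le1$. Put $$B=C\left(\frac1{\gamma\sqrt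 d}+\frac1{\gamma d}\cdot\frac{\log(2/\delta)}{\varepsilon^2}\right).$$ 1. *Algorithm $\mathcal A$.* If $n\ge1$, measurable rules choosing a leading eigenvector of every symmetric matrix exist. For every such rule: - if $\varepsilon\le1$, then $\mathcal A$ is $(\varepsilon,\delta)$-edge-DP; - if the model is defined, then for every $x\in\{\pm1\}^n$ and $\mathbf G\sim\mathsf{SBM}_n(\gamma,d,x)$, the output $\hat x(\mathbf G)$ of $\mathcal A$ satisfies $\mathrm{err}(\hat x(\mathbf G),x)\le B$ with probability at least $1-e^{-cn}$. 2. *Polynomial time.* For every accuracy parameter $q\ge n$: - on every input graph and for all random draws, $P$ performs at most $K(n+q+1)^K$ operations (so polynomially many in $n$ for $q=n$), and $P$ is $(\varepsilon,\delta)$-edge-DP (for every $\varepsilon>0$); - if the model is defined, then for every $x\in\{\pm1\}^n$ and $\mathbf G\sim\mathsf{SBM}_n(\gamma,d,x)$, the output of $P$ satisfies $\mathrm{err}(\hat x(\mathbf G),x)\le B$ with probability at least $1-e^{-cn}$; - if the model is defined and $\varepsilon\le1$, then $P$ carries out $\mathcal A$ to accuracy $1/q$: for every input graph $G$ and all draws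 it returns $\mathrm{sign}(u)$ for a unit vector $u$ with $w^{\top}X_2w\le u^{\top}X_2u+\frac{1+\|X_2\|_F}{q}$ for all unit vectors $w$, where $X_2=\tilde X_1(G)+W$, the matrix $\tilde X_1(G)$ depends only on $G$ and the parameters, $\|\tilde X_1(G)-X_1(G)\|_F\le\frac1q$ with $X_1(G)$ as in step 1, and the entries of $W$ on and above the diagonal are $\sigma$ times distinct draws of $P$. -/

import Mathlib

open MeasureTheory ProbabilityTheory

noncomputable section

namespace PrivateSBM

/-! ## Labels, graphs, the stochastic block model -/

/-- Label vectors in `{±1}ⁿ`. -/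
abbrev Labels (n : ℕ) : Type := Fin n → ℤˣ

/-- `err(x̂, x) = (1/n) · min (Ham(x̂, x), Ham(x̂, -x))`. -/
def err {n : ℕ} (xhat x : Labels n) : ℝ :=
  (min (hammingDist xhat x) (hammingDist xhat (-x)) : ℕ) / (n : ℝ)

/-- The sign vector of a real vector, with the convention `sign 0 = 1`. -/
def signVec {n : ℕ} (v : Fin n → ℝ) : Labels n := fun i => if 0 ≤ v i then 1 else -1

/-- The probability `(1 + γ xᵢ xⱼ) d / n` of the edge `{i, j}`. -/
def edgeProb {n : ℕ} (γ d : ℝ) (x : Labels n) (i j : Fin n) : ℝ :=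
  (1 + γ * (((x i * x j : ℤˣ) : ℤ) : ℝ)) * d / n

open Classical in
/-- The probability mass that `SBM_n(γ, d, x)` gives to the graph `G`: every pair `i < j` is an
edge independently with probability `edgeProb γ d x i j`. -/
def sbmMass {n : ℕ} (γ d : ℝ) (x : Labels n) (G : SimpleGraph (Fin n)) : ℝ :=
  ∏ i : Fin n, ∏ j ∈ Finset.Ioi i,
    if G.Adj i j then edgeProb γ d x i j else 1 - edgeProb γ d x i j

/-- Two graphs are adjacent datasets if their edge sets differ in exactly one edge. -/
def AdjacentGraphs {n : ℕ} (G G' : SimpleGraph (Fin n)) : Prop :=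
  (symmDiff G.edgeSet G'.edgeSet).ncard = 1

/-! ## Randomized algorithms: privacy and success probability

A randomized algorithm on graphs is a function `alg` of the input graph and of an outcome `ω` of
its internal randomness, whose law is `μ`. -/

/-- `(ε, δ)`-differential privacy under change of one edge. -/
def IsEdgeDP {n : ℕ} {Ω : Type} [MeasurableSpace Ω] (μ : Measure Ω)
    (alg : SimpleGraph (Fin n) → Ω → Labels n) (ε δ : ℝ) : Prop :=
  ∀ G G' : SimpleGraph (Fin n), AdjacentGraphs G G' → ∀ S : Set (Labels n),
    μ {ω | alg G ω ∈ S} ≤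
      ENNReal.ofReal (Real.exp ε) * μ {ω | alg G' ω ∈ S} + ENNReal.ofReal δ

open Classical in
/-- The probability, over `G ∼ SBM_n(γ, d, x)` and over the independent internal randomness of the
algorithm, that the output has error at most `t`. -/
def successProb {n : ℕ} {Ω : Type} [MeasurableSpace Ω] (μ : Measure Ω)
    (alg : SimpleGraph (Fin n) → Ω → Labels n) (γ d : ℝ) (x : Labels n) (t : ℝ) : ℝ :=
  ∑ G : SimpleGraph (Fin n), sbmMass γ d x G * μ.real {ω | err (alg G ω) x ≤ t}

/-! ## The algorithm: projection, Gaussian noise, rounding -/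

open Classical in
/-- `Y(G) = (1 / (γ d)) (A(G) - (d / n) J)`. -/
def rescaledAdj {n : ℕ} (γ d : ℝ) (G : SimpleGraph (Fin n)) : Matrix (Fin n) (Fin n) ℝ :=
  Matrix.of fun i j => 1 / (γ * d) * ((if G.Adj i j then 1 else 0) - d / n)

/-- `K = {X : X ⪰ 0, Xᵢᵢ = 1 / n for all i}`. -/
def feasible (n : ℕ) : Set (Matrix (Fin n) (Fin n) ℝ) :=
  {X | X.PosSemidef ∧ ∀ i, X i i = 1 / (n : ℝ)}

/-- The squared Frobenius norm. -/
def frobSq {n : ℕ} (M : Matrix (Fin n) (Fin n) ℝ) : ℝ := ∑ i, ∑ j, M i j ^ 2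

theorem isClosed_feasible (n : ℕ) : IsClosed (feasible n) := by
  have h : feasible n =
      (⋂ i, ⋂ j, {X : Matrix (Fin n) (Fin n) ℝ | X j i = X i j}) ∩
      (⋂ x : Fin n →₀ ℝ, {X : Matrix (Fin n) (Fin n) ℝ |
        0 ≤ x.sum fun i xi => x.sum fun j xj => star xi * X i j * xj}) ∩
      (⋂ i, {X : Matrix (Fin n) (Fin n) ℝ | X i i = 1 / (n : ℝ)}) := by
    ext X
    simp only [feasible, Matrix.PosSemidef, Set.mem_ofPred_eq, Set.mem_inter_iff, Set.mem_iInter,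
      Matrix.IsHermitian.ext_iff, star_trivial]
  rw [h]
  refine ((isClosed_iInter fun i => isClosed_iInter fun j => isClosed_eq ?_ ?_).inter
    (isClosed_iInter fun x => isClosed_le continuous_const ?_)).inter
    (isClosed_iInter fun i => isClosed_eq ?_ continuous_const)
  · exact continuous_id.matrix_elem j i
  · exact continuous_id.matrix_elem i j
  · simp only [Finsupp.sum]
    refine continuous_finsetSum _ fun i _ => continuous_finsetSum _ fun j _ => ?_
    exact (continuous_const.mul (continuous_id.matrix_elem i j)).mul continuous_const
  · exact continuous_id.matrix_elem i i

/-- The projection onto `K` exists. -/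
theorem exists_projection {n : ℕ} (Y : Matrix (Fin n) (Fin n) ℝ) :
    ∃ X ∈ feasible n, ∀ Z ∈ feasible n, frobSq (Y - X) ≤ frobSq (Y - Z) := by
  let f : Matrix (Fin n) (Fin n) ℝ → ℝ := fun X => frobSq (Y - X)
  have hf : Continuous f := by
    refine continuous_finsetSum _ fun i _ => continuous_finsetSum _ fun j _ => ?_
    exact ((continuous_const.sub continuous_id).matrix_elem i j).pow 2
  let X₀ : Matrix (Fin n) (Fin n) ℝ := Matrix.diagonal fun _ => 1 / (n : ℝ)
  have hX₀ : X₀ ∈ feasible n := by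
    refine ⟨Matrix.PosSemidef.diagonal fun i => ?_, fun i => ?_⟩
    · show (0 : ℝ) ≤ 1 / (n : ℝ)
      positivity
    · simp [X₀]
  let r : ℝ := Real.sqrt (f X₀)
  let B : Set (Matrix (Fin n) (Fin n) ℝ) :=
    Set.pi Set.univ fun i => Set.pi Set.univ fun j => Set.Icc (Y i j - r) (Y i j + r)
  have hB : IsCompact B :=
    isCompact_univ_pi fun i => isCompact_univ_pi fun j => isCompact_Icc
  have hle : ∀ X, f X ≤ f X₀ → X ∈ B := by
    intro X hX i _ j _
    have h1 : (Y i j - X i j) ^ 2 ≤ f X := by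
      have h2 : ∑ j, (Y - X) i j ^ 2 ≤ f X :=
        Finset.single_le_sum (f := fun i => ∑ j, (Y - X) i j ^ 2)
          (fun i _ => Finset.sum_nonneg fun j _ => sq_nonneg _) (Finset.mem_univ i)
      have h3 : (Y - X) i j ^ 2 ≤ ∑ j, (Y - X) i j ^ 2 :=
        Finset.single_le_sum (f := fun j => (Y - X) i j ^ 2)
          (fun j _ => sq_nonneg _) (Finset.mem_univ j)
      exact h3.trans h2
    have h4 : |Y i j - X i j| ≤ r := Real.abs_le_sqrt (h1.trans hX)
    rw [abs_le] at h4
    exact ⟨by linarith [h4.2], by linarith [h4.1]⟩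
  have hS : IsCompact (feasible n ∩ {X | f X ≤ f X₀}) :=
    hB.of_isClosed_subset
      ((isClosed_feasible n).inter (isClosed_le hf continuous_const)) fun X hX => hle X hX.2
  obtain ⟨X, hX, hmin⟩ := hS.exists_isMinOn ⟨X₀, hX₀, le_refl (f X₀)⟩ hf.continuousOn
  refine ⟨X, hX.1, fun Z hZ => ?_⟩
  by_cases h : f Z ≤ f X₀
  · exact hmin ⟨hZ, h⟩
  · exact hX.2.trans (not_le.mp h).le

/-- The Frobenius projection `argmin_{X ∈ K} ‖Y - X‖_F²`. -/
def proj {n : ℕ} (Y : Matrix (Fin n) (Fin n) ℝ) : Matrix (Fin n) (Fin n) ℝ :=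
  (exists_projection Y).choose

/-- The noise variance `(24 / (n γ d)) · log(2/δ) / ε²`. -/
def noiseVar (n : ℕ) (γ d ε δ : ℝ) : ℝ :=
  24 / ((n : ℝ) * γ * d) * (Real.log (2 / δ) / ε ^ 2)

/-- The law of an `n × n` array of independent `N(0, σ²)` variables. -/
def gaussianArray (n : ℕ) (var : ℝ) : Measure (Fin n → Fin n → ℝ) :=
  Measure.pi fun _ => Measure.pi fun _ => gaussianReal 0 var.toNNReal

/-- The symmetric matrix with the entries of `g` on and above the diagonal. -/
def symmFill {n : ℕ} (g : Fin n → Fin n → ℝ) : Matrix (Fin n) (Fin n) ℝ :=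
  Matrix.of fun i j => if i ≤ j then g i j else g j i

/-- The quadratic form `uᵀ M u`. -/
def quadForm {n : ℕ} (M : Matrix (Fin n) (Fin n) ℝ) (u : Fin n → ℝ) : ℝ := u ⬝ᵥ M.mulVec u

/-- A measurable choice of a leading eigenvector of every symmetric matrix: `v X` is a nonzero
eigenvector whose eigenvalue `l` is the largest one. -/
def IsLeadingEigenvectorRule (n : ℕ) (v : (Fin n → Fin n → ℝ) → (Fin n → ℝ)) : Prop :=
  Measurable v ∧
  ∀ X : Matrix (Fin n) (Fin n) ℝ, X.IsSymm →
    v X ≠ 0 ∧ ∃ l : ℝ, X.mulVec (v X) = l • v X ∧ ∀ u, quadForm X u ≤ l * (u ⬝ᵥ u)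

/-- The algorithm: project `Y(G)` onto `K`, add the symmetric noise matrix, return the sign vector
of the leading eigenvector. The noise array `g` is to be drawn from `gaussianArray`. -/
def weakRecovery {n : ℕ} (γ d : ℝ) (v : (Fin n → Fin n → ℝ) → (Fin n → ℝ))
    (G : SimpleGraph (Fin n)) (g : Fin n → Fin n → ℝ) : Labels n :=
  signVec (v (proj (rescaledAdj γ d G) + symmFill g))

/-! ## Arithmetic programs

The running time of an algorithm is the number of basic operations on real numbers and on indices;
bit complexity is ignored. Programs are uniform: one program serves all `n` and all parameters.
They use integer variables (for indices and loop counters), two-dimensional real arrays, exact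
arithmetic and comparison of real numbers, `for` loops, and independent draws from `N(0, 1)`. -/

/-- Integer expressions. -/
inductive IdxExpr : Type
  | var (x : ℕ)
  | const (c : ℕ)
  | add (e f : IdxExpr)
  | mul (e f : IdxExpr)

/-- Real expressions; `cell a i j` is the entry `(i, j)` of the array with name `a`, and the only
constants are rational. -/
inductive RealExpr : Type
  | const (c : ℚ)
  | ofIdx (e : IdxExpr)
  | cell (a : ℕ) (i j : IdxExpr)
  | add (e f : RealExpr)
  | sub (e f : RealExpr)
  | mul (e f : RealExpr)
  | div (e f : RealExpr)
  | sqrt (e : RealExpr)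
  | log (e : RealExpr)

/-- Commands. `loop x b c` runs `c` with `x = 0, …, b - 1`, where `b` is evaluated once, on entry.
`sample a i j` stores a fresh `N(0, 1)` variable in a cell. -/
inductive Cmd : Type
  | skip
  | assign (a : ℕ) (i j : IdxExpr) (e : RealExpr)
  | setIdx (x : ℕ) (e : IdxExpr)
  | sample (a : ℕ) (i j : IdxExpr)
  | seq (c₁ c₂ : Cmd)
  | ifLe (e f : RealExpr) (c₁ c₂ : Cmd)
  | loop (x : ℕ) (b : IdxExpr) (c : Cmd)

/-- The state of a run: integer variables, real arrays, the number of Gaussian draws made so far,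
and the number of operations performed so far. -/
structure State : Type where
  idx : ℕ → ℕ
  mem : ℕ → ℕ → ℕ → ℝ
  draws : ℕ
  time : ℕ

namespace IdxExpr

def eval (s : State) : IdxExpr → ℕ
  | var x => s.idx x
  | const c => c
  | add e f => e.eval s + f.eval s
  | mul e f => e.eval s * f.eval s

/-- The number of operations in an expression; reading a variable or a constant counts as one. -/
def cost : IdxExpr → ℕ
  | var _ => 1
  | const _ => 1
  | add e f => e.cost + f.cost + 1
  | mul e f => e.cost + f.cost + 1

end IdxExpr

namespace RealExpr

def eval (s : State) : RealExpr → ℝ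
  | const c => (c : ℝ)
  | ofIdx e => (e.eval s : ℝ)
  | cell a i j => s.mem a (i.eval s) (j.eval s)
  | add e f => e.eval s + f.eval s
  | sub e f => e.eval s - f.eval s
  | mul e f => e.eval s * f.eval s
  | div e f => e.eval s / f.eval s
  | sqrt e => Real.sqrt (e.eval s)
  | log e => Real.log (e.eval s)

def cost : RealExpr → ℕ
  | const _ => 1
  | ofIdx e => e.cost + 1
  | cell _ i j => i.cost + j.cost + 1
  | add e f => e.cost + f.cost + 1
  | sub e f => e.cost + f.cost + 1
  | mul e f => e.cost + f.cost + 1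
  | div e f => e.cost + f.cost + 1
  | sqrt e => e.cost + 1
  | log e => e.cost + 1

end RealExpr

namespace State

def tick (s : State) (t : ℕ) : State := { s with time := s.time + t }

def setVar (s : State) (x k : ℕ) : State := { s with idx := Function.update s.idx x k }

def setCell (s : State) (a i j : ℕ) (r : ℝ) : State :=
  { s with mem := fun a' i' j' => if a' = a ∧ i' = i ∧ j' = j then r else s.mem a' i' j' }

end State

open Classical in
/-- Execution of a command on the random tape `ω`, whose `k`-th entry is the `k`-th Gaussian draw.
Every command, test and loop iteration is charged one operation in addition to the operations in
the expressions that it evaluates. -/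
def Cmd.run (ω : ℕ → ℝ) : Cmd → State → State
  | .skip, s => s.tick 1
  | .assign a i j e, s =>
      (s.setCell a (i.eval s) (j.eval s) (e.eval s)).tick (i.cost + j.cost + e.cost + 1)
  | .setIdx x e, s => (s.setVar x (e.eval s)).tick (e.cost + 1)
  | .sample a i j, s =>
      ({ s.setCell a (i.eval s) (j.eval s) (ω s.draws) with draws := s.draws + 1 } : State).tick
        (i.cost + j.cost + 1)
  | .seq c₁ c₂, s => c₂.run ω (c₁.run ω s)
  | .ifLe e f c₁ c₂, s =>
      if e.eval s ≤ f.eval s then c₁.run ω (s.tick (e.cost + f.cost + 1))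
      else c₂.run ω (s.tick (e.cost + f.cost + 1))
  | .loop x b c, s =>
      (List.range (b.eval s)).foldl (fun s' k => c.run ω ((s'.setVar x k).tick 1))
        (s.tick (b.cost + 1))

/-- The law of the random tape: independent standard Gaussians. -/
def tapeLaw : Measure (ℕ → ℝ) := Measure.infinitePi fun _ => gaussianReal 0 1

open Classical in
/-- The initial state: `n` and the accuracy parameter `q` in the integer variables `0` and `1`, the
adjacency matrix of `G` in array `0`, the public parameters `γ, d, ε, δ` in the first four entries
of row `0` of array `1`, zero elsewhere. -/
def initState {n : ℕ} (q : ℕ) (γ d ε δ : ℝ) (G : SimpleGraph (Fin n)) : State where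
  idx x := if x = 0 then n else if x = 1 then q else 0
  mem a i j :=
    if a = 0 then (if ∃ (hi : i < n) (hj : j < n), G.Adj ⟨i, hi⟩ ⟨j, hj⟩ then 1 else 0)
    else if a = 1 ∧ i = 0 then
      (if j = 0 then γ else if j = 1 then d else if j = 2 then ε else if j = 3 then δ else 0)
    else 0
  draws := 0
  time := 0

/-- The final state of a program. -/
def finalState {n : ℕ} (P : Cmd) (q : ℕ) (γ d ε δ : ℝ) (G : SimpleGraph (Fin n))
    (ω : ℕ → ℝ) : State :=
  P.run ω (initState q γ d ε δ G)

/-- The output of a program: the signs of the first `n` entries of column `0` of array `2`. -/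
def output {n : ℕ} (P : Cmd) (q : ℕ) (γ d ε δ : ℝ) (G : SimpleGraph (Fin n))
    (ω : ℕ → ℝ) : Labels n :=
  signVec fun i => (finalState P q γ d ε δ G ω).mem 2 i 0

/-- The program carries out the three steps of the algorithm up to accuracy `1 / q`: it uses a
matrix `X₁(G)` at Frobenius distance at most `1 / q` from the projection of `Y(G)`; it adds exact
symmetric Gaussian noise `W` of the prescribed variance, whose entries are scaled distinct draws
of the tape; and it returns the sign vector of a unit vector `u` whose Rayleigh quotient for
`X₂ = X₁ + W` is maximal up to `(1 + ‖X₂‖_F) / q`. -/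
def ExecutesWeakRecovery {n : ℕ} (P : Cmd) (q : ℕ) (γ d ε δ : ℝ) : Prop :=
  ∃ X₁ : SimpleGraph (Fin n) → Matrix (Fin n) (Fin n) ℝ,
  ∃ idx : Fin n × Fin n → ℕ, Function.Injective idx ∧
    ∀ G : SimpleGraph (Fin n),
      frobSq (X₁ G - proj (rescaledAdj γ d G)) ≤ (1 / (q : ℝ)) ^ 2 ∧
      ∀ ω : ℕ → ℝ, ∃ X₂ : Matrix (Fin n) (Fin n) ℝ, ∃ u : Fin n → ℝ,
        X₂ = X₁ G + symmFill (fun i j => Real.sqrt (noiseVar n γ d ε δ) * ω (idx (i, j))) ∧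
        u ⬝ᵥ u = 1 ∧
        (∀ w : Fin n → ℝ, w ⬝ᵥ w = 1 →
          quadForm X₂ w ≤ quadForm X₂ u + (1 + Real.sqrt (frobSq X₂)) / q) ∧
        output P q γ d ε δ G ω = signVec u

/-- The error bound `1 / (γ √d) + (1 / (γ d)) · log(2/δ) / ε²`, up to the constant factor. -/
def errBound (γ d ε δ : ℝ) : ℝ :=
  1 / (γ * Real.sqrt d) + 1 / (γ * d) * (Real.log (2 / δ) / ε ^ 2)

end PrivateSBM

end

noncomputable section

namespace PrivateSBM

/-! ## Sums over graphs and concentration of the stochastic block model -/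

/-! Accuracy of the projection. Let `X₁` be the projection of `Y` onto the convex set `K`. The
variational inequality gives `‖X₁ - xxᵀ/n‖² ≤ ⟨Y - xxᵀ/n, X₁ - xxᵀ/n⟩`. Off the diagonal, `Y -
xxᵀ/n` is `(A - 𝔼A)/(γd)`; on the diagonal all elements of `K` agree. So only the size of the linear
form `⟨A - 𝔼A, ·⟩` on `K` matters. On sign vectors it is `O(n√d)` outside an event of probability
`e^(-2n)` (`sum_sbmMass_not_cutBound_le`), and `grothendieck` carries this bound over to `K`. The
result is a squared error `O(1/(γ√d))` (`frobSq_proj_sub_truth_le`).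

Privacy. Adding two variational inequalities gives `‖ΔX₁‖² ≤ ⟨ΔY, ΔX₁⟩`. For adjacent graphs `ΔY`
has two nonzero entries, of size `1/(γd)`, while entries of `K` are at most `1/n` in absolute value.
Hence `‖ΔX₁‖² ≤ 4/(nγd)` (`frobSq_proj_rescaledAdj_sub_le`), a gain over plain nonexpansiveness. The
Gaussian mechanism (`gaussianMechanism`, through Cameron-Martin and a Chernoff bound on the privacy
loss) and post-processing finish the argument.

Rounding. The noise has operator norm `O(σ√n)` with probability `1 - e^(-5n)`
(`measureReal_not_opBound_le`). Compare the Rayleigh quotients of the leading eigenvector `u` and of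
`y = x/√n`, with `s² = 1 - ⟨u, y⟩²`. Both error terms, from the projection and from the noise, carry
a factor `s`, so `s²` is bounded by the squared errors, that is by `O(1/(γ√d) + σ²n)`
(`err_le_of_approx`). Each wrong sign costs `1/n` in `‖u - y‖²`.

Polynomial time. No spectral gap is available, but high powers of the positive definite matrix
`shiftMat Z` still give near-optimal Rayleigh quotients (`SpectralData.trace_pow_succ_ge`). The
normalised power is an approximate linear maximiser over the spectrahedron, which drives a
Frank-Wolfe iteration for the projection with a quadratic penalty on the diagonal
(`frobSq_approxProj_sub_le`); the best column of a power is the approximate eigenvector. The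
approximate projection is so precise that the sensitivity barely changes. For `ε > 1` the program
adds a little more noise, which the term `1/(γ√d)` of the bound absorbs. Time bounds come from a
syntactic condition on loop bounds (`Cmd.Tame.time_le`), and correctness from a symbolic execution
of each block (`mainProgram_spec`). -/

theorem sum_sum_eq_diag_add_sum_Ioi {n : ℕ} (f : Fin n → Fin n → ℝ) :
    ∑ i, ∑ j, f i j = ∑ i, f i i + ∑ i, ∑ j ∈ Finset.Ioi i, (f i j + f j i) := by
  have h1 : ∀ g : Fin n → Fin n → ℝ, ∑ i, ∑ j ∈ Finset.Ioi i, g i j =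
      ∑ i, ∑ j, if i < j then g i j else 0 := by
    intro g
    refine Finset.sum_congr rfl fun i _ => ?_
    rw [← Finset.sum_filter]
    refine Finset.sum_congr ?_ fun _ _ => rfl
    ext j
    simp
  have h2 : ∑ i, ∑ j, (if i < j then f j i else 0) = ∑ i, ∑ j, (if j < i then f i j else 0) :=
    Finset.sum_comm
  have h3 : ∑ i, f i i = ∑ i, ∑ j, (if i = j then f i j else 0) := by simp
  simp only [Finset.sum_add_distrib]
  rw [h1, h1, h2, h3, ← Finset.sum_add_distrib, ← Finset.sum_add_distrib]
  refine Finset.sum_congr rfl fun i _ => ?_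
  rw [← Finset.sum_add_distrib, ← Finset.sum_add_distrib]
  refine Finset.sum_congr rfl fun j _ => ?_
  rcases lt_trichotomy i j with h | h | h
  · simp [h, h.ne, h.not_gt]
  · simp [h]
  · simp [h, h.ne', h.not_gt]

/-- A graph is a choice of a truth value for every pair `i < j`. -/
def graphEquiv (n : ℕ) : SimpleGraph (Fin n) ≃ ({p : Fin n × Fin n // p.1 < p.2} → Prop) where
  toFun G p := G.Adj p.1.1 p.1.2
  invFun g :=
    { Adj i j := (∃ h : i < j, g ⟨(i, j), h⟩) ∨ (∃ h : j < i, g ⟨(j, i), h⟩)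
      symm := ⟨fun _ _ h => h.symm⟩
      loopless := ⟨fun i h => by simp at h⟩ }
  left_inv G := by
    ext i j
    rcases lt_trichotomy i j with h | h | h
    · simp [h, h.not_gt]
    · simp [h]
    · simp [h, h.not_gt, G.adj_comm]
  right_inv g := by
    funext p
    simp [p.2, p.2.not_gt]

open Classical in
-- Independence of the edges: expanding the right-hand product chooses a truth value for every pair
-- `i < j`, which is the same as choosing a graph.
theorem sum_graph_prod {n : ℕ} (f : Fin n → Fin n → Prop → ℝ) :
    ∑ G : SimpleGraph (Fin n), ∏ i, ∏ j ∈ Finset.Ioi i, f i j (G.Adj i j) =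
      ∏ i, ∏ j ∈ Finset.Ioi i, (f i j True + f i j False) := by
  have key : ∀ g : Fin n → Fin n → ℝ, ∏ i, ∏ j ∈ Finset.Ioi i, g i j =
      ∏ p : {p : Fin n × Fin n // p.1 < p.2}, g p.1.1 p.1.2 := by
    intro g
    rw [Finset.prod_sigma']
    refine Finset.prod_bij' (fun p hp => ⟨(p.1, p.2), by simpa using hp⟩)
      (fun p _ => ⟨p.1.1, p.1.2⟩) ?_ ?_ ?_ ?_ ?_
    · intro a ha; simp
    · intro a ha; simpa using a.2
    · intro a ha; rfl
    · intro a ha; rfl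
    · intro a ha; rfl
  simp only [key]
  have h2 : ∀ p : {p : Fin n × Fin n // p.1 < p.2},
      f p.1.1 p.1.2 True + f p.1.1 p.1.2 False = ∑ b : Prop, f p.1.1 p.1.2 b := by
    intro p
    rw [Fintype.univ_Prop, Finset.sum_pair (by simp)]
  simp only [h2]
  rw [Fintype.prod_sum]
  exact Fintype.sum_equiv (graphEquiv n) _ _ fun G => rfl

theorem sbmMass_nonneg {n : ℕ} {γ d : ℝ} {x : Labels n}
    (hp : ∀ i j, 0 ≤ edgeProb γ d x i j ∧ edgeProb γ d x i j ≤ 1) (G : SimpleGraph (Fin n)) :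
    0 ≤ sbmMass γ d x G := by
  refine Finset.prod_nonneg fun i _ => Finset.prod_nonneg fun j _ => ?_
  split_ifs
  · exact (hp i j).1
  · linarith [(hp i j).2]

open Classical in
theorem sum_sbmMass {n : ℕ} (γ d : ℝ) (x : Labels n) :
    ∑ G : SimpleGraph (Fin n), sbmMass γ d x G = 1 := by
  have := sum_graph_prod (n := n) fun i j b =>
    if b then edgeProb γ d x i j else 1 - edgeProb γ d x i j
  unfold sbmMass
  rw [this]
  simp

/-- After factoring out `exp(-bp)`, use `1 + p(eᵇ - 1) ≤ exp(p(eᵇ - 1))` and `eᵇ - 1 - b ≤ b²` for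
`|b| ≤ 1`. The factor `p` in the exponent is what makes the later bounds scale with `√d` and not
with `√n`. -/
theorem bernoulli_mgf_le {p b : ℝ} (hp : 0 ≤ p) (hb : |b| ≤ 1) :
    p * Real.exp (b * (1 - p)) + (1 - p) * Real.exp (b * (0 - p)) ≤ Real.exp (p * b ^ 2) := by
  have h1 : p * Real.exp (b * (1 - p)) + (1 - p) * Real.exp (b * (0 - p)) =
      Real.exp (-(b * p)) * (p * (Real.exp b - 1) + 1) := by
    rw [show b * (1 - p) = -(b * p) + b by ring, Real.exp_add,
      show b * (0 - p) = -(b * p) by ring]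
    ring
  have h2 := Real.add_one_le_exp (p * (Real.exp b - 1))
  have h3 := (abs_le.mp (Real.abs_exp_sub_one_sub_id_le hb)).2
  rw [h1]
  calc _ ≤ Real.exp (-(b * p)) * Real.exp (p * (Real.exp b - 1)) := by gcongr
    _ = Real.exp (p * (Real.exp b - 1 - b)) := by rw [← Real.exp_add]; ring_nf
    _ ≤ _ := by gcongr

open Classical in
/-- The centred adjacency matrix `A - 𝔼 A`. -/
def centredAdj {n : ℕ} (γ d : ℝ) (x : Labels n) (G : SimpleGraph (Fin n)) :
    Matrix (Fin n) (Fin n) ℝ :=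
  Matrix.of fun i j => if i = j then 0 else (if G.Adj i j then 1 else 0) - edgeProb γ d x i j

theorem edgeProb_comm {n : ℕ} (γ d : ℝ) (x : Labels n) (i j : Fin n) :
    edgeProb γ d x i j = edgeProb γ d x j i := by
  simp [edgeProb, mul_comm (x i) (x j)]

/-- The real vector of a label vector. -/
def realVec {n : ℕ} (s : Labels n) : Fin n → ℝ := fun i => ((s i : ℤ) : ℝ)

theorem realVec_sq {n : ℕ} (s : Labels n) (i : Fin n) : realVec s i ^ 2 = 1 := by
  unfold realVec
  rcases Int.units_eq_one_or (s i) with h | h <;> simp [h]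

theorem abs_realVec {n : ℕ} (s : Labels n) (i : Fin n) : |realVec s i| = 1 := by
  unfold realVec
  rcases Int.units_eq_one_or (s i) with h | h <;> simp [h]

/-- The bilinear form `∑ᵢⱼ sᵢ Mᵢⱼ tⱼ`. -/
def bilin {n : ℕ} (M : Matrix (Fin n) (Fin n) ℝ) (s t : Fin n → ℝ) : ℝ := ∑ i, ∑ j, s i * M i j * t j

open Classical in
-- The exponent is a sum over unordered pairs of independent centred variables, the pair `{i, j}`
-- having coefficient `l(sᵢtⱼ + sⱼtᵢ)` of size at most `2l ≤ 1`. Each factor is therefore at most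
-- `exp(4 l² pmax)` by `bernoulli_mgf_le`.
theorem sbm_mgf {n : ℕ} {γ d pmax l : ℝ} {x : Labels n}
    (hp : ∀ i j, 0 ≤ edgeProb γ d x i j ∧ edgeProb γ d x i j ≤ 1)
    (hp' : ∀ i j, edgeProb γ d x i j ≤ pmax) (hl : 0 ≤ l) (hl' : 2 * l ≤ 1) (s t : Labels n) :
    ∑ G : SimpleGraph (Fin n), sbmMass γ d x G *
        Real.exp (l * bilin (centredAdj γ d x G) (realVec s) (realVec t)) ≤
      Real.exp (4 * l ^ 2 * pmax * n ^ 2) := by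
  let b : Fin n → Fin n → ℝ := fun i j =>
    l * (realVec s i * realVec t j + realVec s j * realVec t i)
  have hb : ∀ i j, |b i j| ≤ 2 * l := by
    intro i j
    have : |realVec s i * realVec t j + realVec s j * realVec t i| ≤ 2 := by
      refine (abs_add_le _ _).trans ?_
      rw [abs_mul, abs_mul, abs_realVec, abs_realVec, abs_realVec, abs_realVec]
      norm_num
    show |l * _| ≤ _
    rw [abs_mul, abs_of_nonneg hl]
    nlinarith
  have h1 : ∀ G : SimpleGraph (Fin n),
      sbmMass γ d x G * Real.exp (l * bilin (centredAdj γ d x G) (realVec s) (realVec t)) =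
      ∏ i, ∏ j ∈ Finset.Ioi i,
        ((if G.Adj i j then edgeProb γ d x i j else 1 - edgeProb γ d x i j) *
          Real.exp (b i j * ((if G.Adj i j then 1 else 0) - edgeProb γ d x i j))) := by
    intro G
    simp only [Finset.prod_mul_distrib]
    congr 1
    simp only [← Real.exp_sum]
    congr 1
    rw [bilin, sum_sum_eq_diag_add_sum_Ioi, mul_add, Finset.mul_sum, Finset.mul_sum]
    rw [Finset.sum_eq_zero (f := fun i => _ * _), zero_add]
    · refine Finset.sum_congr rfl fun i _ => ?_
      rw [Finset.mul_sum]
      refine Finset.sum_congr rfl fun j hj => ?_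
      have hij : i ≠ j := (Finset.mem_Ioi.mp hj).ne
      simp only [centredAdj, Matrix.of_apply, if_neg hij, if_neg hij.symm, G.adj_comm j i,
        edgeProb_comm γ d x j i, b]
      ring
    · intro i _
      simp [centredAdj]
  have h2 := sum_graph_prod (n := n) fun i j B =>
    ((if B then edgeProb γ d x i j else 1 - edgeProb γ d x i j) *
          Real.exp (b i j * ((if B then 1 else 0) - edgeProb γ d x i j)))
  rw [Finset.sum_congr rfl fun G _ => h1 G, h2]
  -- Nonnegativity of `pmax` is read off from an edge probability, so it needs a vertex.
  have hn : (0 : ℝ) ≤ pmax ∨ n = 0 := by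
    rcases Nat.eq_zero_or_pos n with h | h
    · exact Or.inr h
    · exact Or.inl ((hp ⟨0, h⟩ ⟨0, h⟩).1.trans (hp' _ _))
  rcases hn with hn | rfl
  swap
  · simp
  calc _ ≤ ∏ i : Fin n, ∏ j ∈ Finset.Ioi i, Real.exp (4 * l ^ 2 * pmax) := by
        refine Finset.prod_le_prod (fun i _ => Finset.prod_nonneg fun j _ => ?_) fun i _ =>
          Finset.prod_le_prod (fun j _ => ?_) fun j _ => ?_
        · simp only [if_true, if_false]
          have := hp i j
          have : 0 ≤ 1 - edgeProb γ d x i j := by linarith [this.2]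
          have := (hp i j).1
          positivity
        · simp only [if_true, if_false]
          have := hp i j
          have : 0 ≤ 1 - edgeProb γ d x i j := by linarith [this.2]
          have := (hp i j).1
          positivity
        · simp only [if_true, if_false]
          refine (bernoulli_mgf_le (hp i j).1 ((hb i j).trans hl')).trans ?_
          refine Real.exp_le_exp.mpr ?_
          have h3 : b i j ^ 2 ≤ (2 * l) ^ 2 := sq_le_sq' (by linarith [abs_le.mp (hb i j)])
            (abs_le.mp (hb i j)).2
          calc edgeProb γ d x i j * b i j ^ 2 ≤ pmax * (2 * l) ^ 2 :=
                mul_le_mul (hp' i j) h3 (sq_nonneg _) hn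
            _ = _ := by ring
    -- Passing from pairs `i < j` to all `n²` pairs loses only a factor of two in the exponent.
    _ ≤ ∏ i : Fin n, ∏ j : Fin n, Real.exp (4 * l ^ 2 * pmax) := by
        refine Finset.prod_le_prod (fun i _ => Finset.prod_nonneg fun j _ => by positivity)
          fun i _ => ?_
        refine Finset.prod_le_prod_of_subset_of_one_le (Finset.subset_univ _)
          (fun j _ => by positivity) fun j _ _ => ?_
        exact Real.one_le_exp (by positivity)
    _ = _ := by
        simp only [Finset.prod_const, Finset.card_univ, Fintype.card_fin, ← Real.exp_nat_mul]
        congr 1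
        ring

/-! ### The cut norm of `A - 𝔼A`: union bound over pairs of sign vectors -/

theorem card_labels (n : ℕ) : Fintype.card (Labels n) = 2 ^ n := by
  simp [Labels]

/-- The cut norm bound for the centred adjacency matrix. -/
def CutBound {n : ℕ} (γ d : ℝ) (x : Labels n) (G : SimpleGraph (Fin n)) : Prop :=
  ∀ s t : Labels n,
    bilin (centredAdj γ d x G) (realVec s) (realVec t) ≤ 12 * n * Real.sqrt d

open Classical in
-- Markov's inequality for the exponential moment of `sbm_mgf` and a union bound over the `4ⁿ` pairs
-- of sign vectors. The exponents add up to `2n` (moment) `- 6n` (threshold) `+ 2n` (from `4ⁿ ≤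
-- e^(2n)`).
theorem sum_sbmMass_not_cutBound_le {n : ℕ} {γ d : ℝ} {x : Labels n} (hd : 1 ≤ d)
    (hp : ∀ i j, 0 ≤ edgeProb γ d x i j ∧ edgeProb γ d x i j ≤ 1)
    (hp' : ∀ i j, edgeProb γ d x i j ≤ 2 * d / n) :
    ∑ G : SimpleGraph (Fin n), (if CutBound γ d x G then 0 else sbmMass γ d x G) ≤
      Real.exp (-(2 * n)) := by
  rcases Nat.eq_zero_or_pos n with rfl | hn
  · have : ∀ G : SimpleGraph (Fin 0), CutBound γ d x G := by
      intro G s t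
      simp [bilin]
    simp [this]
  have hn' : (0 : ℝ) < n := by exact_mod_cast hn
  have hsd : 1 ≤ Real.sqrt d := Real.one_le_sqrt.mpr hd
  -- With this `l` the threshold `12 n √d` contributes `6n` and the moment bound with `pmax = 2d/n`
  -- is `e^(2n)`; `d ≥ 1` ensures `2l ≤ 1`.
  set l : ℝ := 1 / (2 * Real.sqrt d) with hl
  have hl0 : 0 ≤ l := by positivity
  have hl1 : 2 * l ≤ 1 := by
    rw [hl]
    rw [show 2 * (1 / (2 * Real.sqrt d)) = 1 / Real.sqrt d by field_simp]
    rw [div_le_one (by positivity)]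
    exact hsd
  have hlT : l * (12 * n * Real.sqrt d) = 6 * n := by
    rw [hl]; field_simp; ring
  have hexp : 4 * l ^ 2 * (2 * d / n) * n ^ 2 = 2 * n := by
    rw [hl]
    have : Real.sqrt d ^ 2 = d := Real.sq_sqrt (by linarith)
    field_simp
    rw [this]; ring
  calc _ ≤ ∑ G : SimpleGraph (Fin n), ∑ s : Labels n, ∑ t : Labels n,
        sbmMass γ d x G * Real.exp (l * bilin (centredAdj γ d x G) (realVec s) (realVec t)) *
          Real.exp (-(6 * n)) := by
        refine Finset.sum_le_sum fun G _ => ?_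
        have hpos : ∀ s t : Labels n, 0 ≤ sbmMass γ d x G *
            Real.exp (l * bilin (centredAdj γ d x G) (realVec s) (realVec t)) *
            Real.exp (-(6 * n)) := fun s t => by
          have := sbmMass_nonneg hp G
          positivity
        split_ifs with h
        · exact Finset.sum_nonneg fun s _ => Finset.sum_nonneg fun t _ => hpos s t
        · simp only [CutBound, not_forall, not_le] at h
          obtain ⟨s, t, h⟩ := h
          refine le_trans ?_ (Finset.single_le_sum (f := fun s => ∑ t, _)
            (fun s _ => Finset.sum_nonneg fun t _ => hpos s t) (Finset.mem_univ s))
          refine le_trans ?_ (Finset.single_le_sum (fun t _ => hpos s t) (Finset.mem_univ t))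
          rw [mul_assoc, ← Real.exp_add]
          refine le_mul_of_one_le_right (sbmMass_nonneg hp G) (Real.one_le_exp ?_)
          have := mul_le_mul_of_nonneg_left h.le hl0
          linarith
    _ = ∑ s : Labels n, ∑ t : Labels n, (∑ G : SimpleGraph (Fin n),
        sbmMass γ d x G * Real.exp (l * bilin (centredAdj γ d x G) (realVec s) (realVec t))) *
          Real.exp (-(6 * n)) := by
        rw [Finset.sum_comm]
        refine Finset.sum_congr rfl fun s _ => ?_
        rw [Finset.sum_comm]
        refine Finset.sum_congr rfl fun t _ => ?_
        rw [Finset.sum_mul]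
    _ ≤ ∑ s : Labels n, ∑ t : Labels n, Real.exp (2 * n) * Real.exp (-(6 * n)) := by
        refine Finset.sum_le_sum fun s _ => Finset.sum_le_sum fun t _ => ?_
        have := sbm_mgf hp hp' hl0 hl1 s t
        rw [hexp] at this
        gcongr
    _ = (2 : ℝ) ^ n * 2 ^ n * Real.exp (-(4 * n)) := by
        rw [← Real.exp_add]
        simp only [Finset.sum_const, Finset.card_univ, card_labels, nsmul_eq_mul]
        push_cast
        ring_nf
    _ ≤ Real.exp n * Real.exp n * Real.exp (-(4 * n)) := by
        have : (2 : ℝ) ^ n ≤ Real.exp n := by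
          rw [← mul_one (n : ℝ), Real.exp_nat_mul]
          gcongr
          have := Real.add_one_le_exp (1 : ℝ)
          linarith
        gcongr
    _ = _ := by
        rw [← Real.exp_add, ← Real.exp_add]; ring_nf


/-! ## Grothendieck's inequality for positive semidefinite matrices -/

open scoped MatrixOrder Matrix.Norms.L2Operator in
theorem exists_conjTranspose_mul_self {n : ℕ} {X : Matrix (Fin n) (Fin n) ℝ} (hX : X.PosSemidef) :
    ∃ C : Matrix (Fin n) (Fin n) ℝ, X = C.conjTranspose * C :=
  CStarAlgebra.nonneg_iff_eq_star_mul_self.mp hX.nonneg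

/-- Average over all sign vectors. -/
def avg {n : ℕ} (f : Labels n → ℝ) : ℝ := (∑ w, f w) / 2 ^ n

theorem avg_add {n : ℕ} (f g : Labels n → ℝ) : avg (fun w => f w + g w) = avg f + avg g := by
  simp [avg, Finset.sum_add_distrib, add_div]

theorem avg_const_mul {n : ℕ} (c : ℝ) (f : Labels n → ℝ) : avg (fun w => c * f w) = c * avg f := by
  simp only [avg]
  rw [← Finset.mul_sum, mul_div_assoc]

theorem avg_sum {n : ℕ} {ι : Type*} (s : Finset ι) (f : ι → Labels n → ℝ) :
    avg (fun w => ∑ i ∈ s, f i w) = ∑ i ∈ s, avg (f i) := by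
  simp only [avg]
  rw [Finset.sum_comm, Finset.sum_div]

theorem avg_mono {n : ℕ} {f g : Labels n → ℝ} (h : ∀ w, f w ≤ g w) : avg f ≤ avg g := by
  unfold avg
  gcongr
  exact h _

theorem avg_const {n : ℕ} (c : ℝ) : avg (fun _ : Labels n => c) = c := by
  simp [avg]

/-- Flip the sign of one coordinate. -/
def flipAt {n : ℕ} (k : Fin n) (w : Labels n) : Labels n := Function.update w k (-w k)

theorem flipAt_involutive {n : ℕ} (k : Fin n) : Function.Involutive (flipAt k) := by
  intro w
  simp [flipAt]

/-- Pairing `w` with `flipAt k w` cancels all terms: a sign is independent of the other coordinates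
and has mean zero. -/
theorem avg_mul_eq_zero {n : ℕ} (k : Fin n) (f : Labels n → ℝ) (hf : ∀ w, f (flipAt k w) = f w) :
    avg (fun w => f w * realVec w k) = 0 := by
  have h : ∑ w, f w * realVec w k = ∑ w, -(f w * realVec w k) := by
    rw [← Equiv.sum_comp (flipAt_involutive k).toPerm]
    refine Finset.sum_congr rfl fun w _ => ?_
    have : realVec (flipAt k w) k = -realVec w k := by simp [realVec, flipAt]
    show f (flipAt k w) * realVec (flipAt k w) k = _
    rw [hf, this]; ring
  rw [Finset.sum_neg_distrib] at h
  have : ∑ w, f w * realVec w k = 0 := by linarith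
  simp [avg, this]

/-- A Rademacher sum. -/
def radSum {n : ℕ} (s : Finset (Fin n)) (a : Fin n → ℝ) (w : Labels n) : ℝ :=
  ∑ k ∈ s, a k * realVec w k

theorem radSum_flipAt {n : ℕ} {s : Finset (Fin n)} {k : Fin n} (hk : k ∉ s) (a : Fin n → ℝ)
    (w : Labels n) : radSum s a (flipAt k w) = radSum s a w := by
  refine Finset.sum_congr rfl fun i hi => ?_
  have : i ≠ k := fun h => hk (h ▸ hi)
  simp [realVec, flipAt, this]

theorem avg_radSum_mul {n : ℕ} (a b : Fin n → ℝ) :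
    avg (fun w => radSum Finset.univ a w * radSum Finset.univ b w) = ∑ k, a k * b k := by
  simp only [radSum, Finset.sum_mul_sum]
  rw [avg_sum]
  refine Finset.sum_congr rfl fun i _ => ?_
  rw [avg_sum, Finset.sum_eq_single i]
  · have : ∀ w : Labels n, a i * realVec w i * (b i * realVec w i) = a i * b i := by
      intro w
      linear_combination a i * b i * realVec_sq w i
    simp only [this, avg_const]
  · intro j _ hj
    have h := avg_mul_eq_zero j (fun w : Labels n => a i * realVec w i * b j) (by
      intro w
      simp [realVec, flipAt, hj.symm])
    rw [← h]
    congr 1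
    funext w
    ring
  · simp

theorem avg_radSum_sq {n : ℕ} (s : Finset (Fin n)) (a : Fin n → ℝ) :
    avg (fun w => radSum s a w ^ 2) = ∑ k ∈ s, a k ^ 2 := by
  have h := avg_radSum_mul (fun k => if k ∈ s then a k else 0) (fun k => if k ∈ s then a k else 0)
  have h1 : ∀ w, radSum Finset.univ (fun k => if k ∈ s then a k else 0) w = radSum s a w := by
    intro w
    simp [radSum, ite_mul, Finset.sum_ite_mem]
  simp only [h1] at h
  simp only [pow_two]
  rw [h]
  simp [Finset.sum_ite_mem]

/-- Khinchine's inequality for the fourth moment. Adding one term `a w_k` to a sum with second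
moment `S` adds exactly `6a²S + a⁴`, since odd powers of a sign average out, and `3S² + 6a²S + a⁴ ≤
3(S + a²)²`. -/
theorem avg_radSum_pow_four {n : ℕ} (s : Finset (Fin n)) (a : Fin n → ℝ) :
    avg (fun w => radSum s a w ^ 4) ≤ 3 * (∑ k ∈ s, a k ^ 2) ^ 2 := by
  induction s using Finset.induction_on with
  | empty => simp [radSum, avg]
  | insert k s hk ih =>
    have h1 : ∀ w, radSum (insert k s) a w ^ 4 =
        (radSum s a w ^ 4 + 6 * a k ^ 2 * radSum s a w ^ 2) +
        (a k ^ 4 + (4 * radSum s a w ^ 3 * a k + 4 * radSum s a w * a k ^ 3) * realVec w k) := by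
      intro w
      have h2 : radSum (insert k s) a w = a k * realVec w k + radSum s a w := by
        simp [radSum, Finset.sum_insert hk]
      have h3 := realVec_sq w k
      have h4 : realVec w k ^ 3 = realVec w k := by rw [pow_succ, h3, one_mul]
      have h5 : realVec w k ^ 4 = 1 := by
        rw [show (4 : ℕ) = 2 * 2 from rfl, pow_mul, h3, one_pow]
      rw [h2]
      linear_combination a k ^ 4 * h5 + 4 * a k ^ 3 * radSum s a w * h4 +
        6 * a k ^ 2 * radSum s a w ^ 2 * h3
    simp only [h1]
    rw [avg_add, avg_add, avg_add, avg_const_mul, avg_const, avg_radSum_sq,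
      avg_mul_eq_zero k _ (fun w => by rw [radSum_flipAt hk]), Finset.sum_insert hk]
    nlinarith [sq_nonneg (a k ^ 2)]

theorem bilin_comm {n : ℕ} (M : Matrix (Fin n) (Fin n) ℝ) (s t : Fin n → ℝ) :
    bilin M s t = bilin M.transpose t s := by
  unfold bilin
  rw [Finset.sum_comm]
  refine Finset.sum_congr rfl fun i _ => Finset.sum_congr rfl fun j _ => ?_
  simp only [Matrix.transpose_apply]
  ring

/-- A linear function on the cube is maximal at a vertex: take the sign of each coefficient. -/
theorem exists_label_bilin_ge {n : ℕ} (M : Matrix (Fin n) (Fin n) ℝ) {a : Fin n → ℝ}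
    (ha : ∀ i, |a i| ≤ 1) (b : Fin n → ℝ) :
    ∃ s : Labels n, bilin M a b ≤ bilin M (realVec s) b := by
  let c : Fin n → ℝ := fun i => ∑ j, M i j * b j
  refine ⟨fun i => if 0 ≤ c i then 1 else -1, ?_⟩
  have h : ∀ s : Fin n → ℝ, bilin M s b = ∑ i, s i * c i := by
    intro s
    simp only [bilin, c, Finset.mul_sum, mul_assoc]
  rw [h, h]
  refine Finset.sum_le_sum fun i _ => ?_
  have h1 : a i * c i ≤ |c i| := by
    calc a i * c i ≤ |a i| * |c i| := by rw [← abs_mul]; exact le_abs_self _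
      _ ≤ 1 * |c i| := by gcongr; exact ha i
      _ = _ := one_mul _
  refine h1.trans (le_of_eq ?_)
  simp only [realVec]
  split_ifs with h
  · simp [abs_of_nonneg h]
  · simp [abs_of_neg (not_le.mp h)]

theorem bilin_le_of_forall_labels {n : ℕ} {M : Matrix (Fin n) (Fin n) ℝ} {m : ℝ}
    (hm : ∀ s t : Labels n, bilin M (realVec s) (realVec t) ≤ m) {a b : Fin n → ℝ}
    (ha : ∀ i, |a i| ≤ 1) (hb : ∀ i, |b i| ≤ 1) : bilin M a b ≤ m := by
  obtain ⟨s, hs⟩ := exists_label_bilin_ge M ha b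
  obtain ⟨t, ht⟩ := exists_label_bilin_ge M.transpose hb (realVec s)
  rw [← bilin_comm, ← bilin_comm] at ht
  exact hs.trans (ht.trans (hm s t))

/-- The entrywise inner product. -/
def frobInner {n : ℕ} (M X : Matrix (Fin n) (Fin n) ℝ) : ℝ := ∑ i, ∑ j, M i j * X i j

/-- The second moment matrix of a random vector. -/
def secondMoment {n : ℕ} (Z : Labels n → Fin n → ℝ) : Matrix (Fin n) (Fin n) ℝ :=
  Matrix.of fun i j => avg fun w => Z w i * Z w j

theorem secondMoment_posSemidef {n : ℕ} (Z : Labels n → Fin n → ℝ) :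
    (secondMoment Z).PosSemidef := by
  have h : secondMoment Z = (1 / 2 ^ n : ℝ) • ((Matrix.of Z).conjTranspose * Matrix.of Z) := by
    ext i j
    simp [secondMoment, avg, Matrix.mul_apply, div_eq_inv_mul]
  rw [h]
  exact (Matrix.posSemidef_conjTranspose_mul_self _).smul (by positivity)

theorem frobInner_secondMoment {n : ℕ} (M : Matrix (Fin n) (Fin n) ℝ) (Z : Labels n → Fin n → ℝ) :
    frobInner M (secondMoment Z) = avg fun w => bilin M (Z w) (Z w) := by
  simp only [frobInner, secondMoment, Matrix.of_apply, bilin]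
  rw [avg_sum]
  refine Finset.sum_congr rfl fun i _ => ?_
  rw [avg_sum]
  refine Finset.sum_congr rfl fun j _ => ?_
  rw [← avg_const_mul]
  congr 1
  funext w
  ring

/-- One step of the iteration in the proof of Grothendieck's inequality: a bound `B` on all
positive semidefinite matrices with diagonal at most `1` improves to `48 m + (9/16) B`. -/
theorem grothendieck_step {n : ℕ} {M : Matrix (Fin n) (Fin n) ℝ} {m B : ℝ}
    (hm : ∀ s t : Labels n, bilin M (realVec s) (realVec t) ≤ m)
    (hB : ∀ X : Matrix (Fin n) (Fin n) ℝ, X.PosSemidef → (∀ i, X i i ≤ 1) → |frobInner M X| ≤ B)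
    (X : Matrix (Fin n) (Fin n) ℝ) (hX : X.PosSemidef) (hX1 : ∀ i, X i i ≤ 1) :
    |frobInner M X| ≤ 48 * m + 9 / 16 * B := by
  have hB' : ∀ (c : ℝ) (X : Matrix (Fin n) (Fin n) ℝ), 0 < c → X.PosSemidef → (∀ i, X i i ≤ c) →
      |frobInner M X| ≤ c * B := by
    intro c X hc hX hXc
    have h := hB (c⁻¹ • X) (hX.smul (by positivity)) (fun i => by
      simp only [Matrix.smul_apply, smul_eq_mul]
      rw [inv_mul_le_iff₀ hc]
      linarith [hXc i])
    have h2 : frobInner M (c⁻¹ • X) = c⁻¹ * frobInner M X := by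
      simp only [frobInner, Finset.mul_sum, Matrix.smul_apply, smul_eq_mul]
      refine Finset.sum_congr rfl fun i _ => Finset.sum_congr rfl fun j _ => by ring
    rw [h2, abs_mul, abs_of_pos (by positivity : 0 < c⁻¹), inv_mul_le_iff₀ hc] at h
    exact h
  obtain ⟨C, hC⟩ : ∃ C : Matrix (Fin n) (Fin n) ℝ, X = C.conjTranspose * C :=
    exists_conjTranspose_mul_self hX
  have hXC : ∀ i j, X i j = ∑ k, C k i * C k j := by
    intro i j
    rw [hC]
    simp [Matrix.mul_apply]
  -- `U` is a random vector with second moment matrix `X`; it is split into the truncation `V` at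
  -- `√48` and the tail `P`. On the tail `U² ≤ U⁴/48`, so its second moment is at most `3/48 =
  -- 1/16`.
  let U : Labels n → Fin n → ℝ := fun w i => radSum Finset.univ (fun k => C k i) w
  let V : Labels n → Fin n → ℝ := fun w i => if U w i ^ 2 ≤ 48 then U w i else 0
  let P : Labels n → Fin n → ℝ := fun w i => if U w i ^ 2 ≤ 48 then 0 else U w i
  have hUV : ∀ w i, U w i = V w i + P w i := by
    intro w i
    simp only [V, P]
    split_ifs <;> simp
  have hXU : X = secondMoment U := by
    ext i j
    rw [hXC]
    exact (avg_radSum_mul _ _).symm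
  have hU2 : ∀ i, avg (fun w => U w i ^ 2) ≤ 1 := by
    intro i
    show avg (fun w => radSum _ _ w ^ 2) ≤ 1
    rw [avg_radSum_sq]
    have := hX1 i
    rw [hXC] at this
    simpa [pow_two] using this
  have hU4 : ∀ i, avg (fun w => U w i ^ 4) ≤ 3 := by
    intro i
    refine (avg_radSum_pow_four _ _).trans ?_
    have h1 : ∑ k, C k i ^ 2 ≤ 1 := by
      have := hX1 i
      rw [hXC] at this
      simpa [pow_two] using this
    have h0 : 0 ≤ ∑ k, C k i ^ 2 := Finset.sum_nonneg fun k _ => sq_nonneg _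
    nlinarith
  have hV2 : ∀ i, avg (fun w => V w i ^ 2) ≤ 1 := by
    intro i
    refine (avg_mono fun w => ?_).trans (hU2 i)
    simp only [V]
    split_ifs
    · exact le_rfl
    · simpa using sq_nonneg (U w i)
  have hP2 : ∀ i, avg (fun w => P w i ^ 2) ≤ 1 / 16 := by
    intro i
    have : avg (fun w => P w i ^ 2) ≤ avg (fun w => 1 / 48 * U w i ^ 4) := by
      refine avg_mono fun w => ?_
      simp only [P]
      split_ifs with h
      · have := sq_nonneg (U w i ^ 2)
        simp only [ne_eq, OfNat.ofNat_ne_zero, not_false_eq_true, zero_pow]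
        nlinarith
      · nlinarith [sq_nonneg (U w i)]
    rw [avg_const_mul] at this
    linarith [hU4 i]
  have hVP : ∀ w i, V w i * P w i = 0 := by
    intro w i
    simp only [V, P]
    split_ifs <;> simp
  -- The weights `2` and `1/2` balance the two pieces: `4 · 1/16 + 1/4 · 1 = 1/2`. The cross term
  -- vanishes because `V` and `P` have disjoint supports.
  have hdiag : ∀ c : ℝ, c ^ 2 = 1 → ∀ i,
      secondMoment (fun w i => 2 * P w i + c * (V w i / 2)) i i ≤ 1 / 2 := by
    intro c hc i
    have h : ∀ w, (2 * P w i + c * (V w i / 2)) * (2 * P w i + c * (V w i / 2)) =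
        4 * P w i ^ 2 + 1 / 4 * V w i ^ 2 := by
      intro w
      linear_combination 2 * c * hVP w i + V w i ^ 2 / 4 * hc
    simp only [secondMoment, Matrix.of_apply, h]
    rw [avg_add, avg_const_mul, avg_const_mul]
    linarith [hP2 i, hV2 i]
  -- The mixed terms `V Pᵀ + P Vᵀ` become, by polarisation, half the difference of the second
  -- moments of `2P ± V/2`, to which the bound `B` applies again. They cost `B/2` and the tail costs
  -- `B/16`; the bounded part costs `48 m`.
  have hsplit : frobInner M X = avg (fun w => bilin M (V w) (V w)) +
      (1 / 2 * frobInner M (secondMoment fun w i => 2 * P w i + 1 * (V w i / 2)) +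
       (-1 / 2) * frobInner M (secondMoment fun w i => 2 * P w i + (-1) * (V w i / 2))) +
      frobInner M (secondMoment P) := by
    rw [hXU]
    simp only [frobInner_secondMoment]
    rw [← avg_const_mul, ← avg_const_mul, ← avg_add, ← avg_add, ← avg_add]
    congr 1
    funext w
    simp only [bilin, Finset.mul_sum, ← Finset.sum_add_distrib]
    refine Finset.sum_congr rfl fun i _ => Finset.sum_congr rfl fun j _ => ?_
    rw [hUV, hUV]
    ring
  have hVV : |avg (fun w => bilin M (V w) (V w))| ≤ 48 * m := by
    set r : ℝ := Real.sqrt 48 with hr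
    have hr2 : r ^ 2 = 48 := Real.sq_sqrt (by norm_num)
    have hr0 : 0 < r := Real.sqrt_pos.mpr (by norm_num)
    have hVr : ∀ w i, |V w i / r| ≤ 1 := by
      intro w i
      rw [abs_div, abs_of_pos hr0, div_le_one hr0]
      simp only [V]
      split_ifs with h
      · exact Real.abs_le_sqrt h
      · simpa using hr0.le
    have h1 : ∀ w, bilin M (V w) (V w) = 48 * bilin M (fun i => V w i / r) (fun i => V w i / r) := by
      intro w
      simp only [bilin, Finset.mul_sum]
      refine Finset.sum_congr rfl fun i _ => Finset.sum_congr rfl fun j _ => ?_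
      field_simp
      rw [hr2]
    have h2 : ∀ w, bilin M (V w) (V w) = -(48 * bilin M (fun i => -(V w i / r)) (fun i => V w i / r)) := by
      intro w
      rw [h1]
      simp only [bilin, neg_mul, Finset.sum_neg_distrib]
      ring
    rw [abs_le]
    constructor
    · have : avg (fun _ : Labels n => -(48 * m)) ≤ avg (fun w => bilin M (V w) (V w)) := by
        refine avg_mono fun w => ?_
        rw [h2]
        have := bilin_le_of_forall_labels hm (a := fun i => -(V w i / r)) (b := fun i => V w i / r)
          (fun i => by rw [abs_neg]; exact hVr w i) (hVr w)
        linarith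
      rwa [avg_const] at this
    · have : avg (fun w => bilin M (V w) (V w)) ≤ avg (fun _ : Labels n => 48 * m) := by
        refine avg_mono fun w => ?_
        rw [h1]
        have := bilin_le_of_forall_labels hm (a := fun i => (V w i / r)) (b := fun i => V w i / r)
          (hVr w) (hVr w)
        linarith
      rwa [avg_const] at this
  have h3 := hB' (1 / 2) _ (by norm_num) (secondMoment_posSemidef _) (hdiag 1 (by norm_num))
  have h4 := hB' (1 / 2) _ (by norm_num) (secondMoment_posSemidef _) (hdiag (-1) (by norm_num))
  have h5 := hB' (1 / 16) _ (by norm_num) (secondMoment_posSemidef P) (fun i => by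
    simpa [secondMoment, pow_two] using hP2 i)
  rw [hsplit]
  rw [abs_le] at *
  constructor <;> linarith [hVV.1, hVV.2, h3.1, h3.2, h4.1, h4.2, h5.1, h5.2]

/-- Cauchy-Schwarz for the columns of a Gram factor. -/
theorem abs_apply_le_of_posSemidef {n : ℕ} {X : Matrix (Fin n) (Fin n) ℝ} (hX : X.PosSemidef)
    (i j : Fin n) : X i j ^ 2 ≤ X i i * X j j := by
  obtain ⟨C, hC⟩ : ∃ C : Matrix (Fin n) (Fin n) ℝ, X = C.conjTranspose * C :=
    exists_conjTranspose_mul_self hX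
  have hXC : ∀ i j, X i j = ∑ k, C k i * C k j := by
    intro i j
    rw [hC]
    simp [Matrix.mul_apply]
  rw [hXC, hXC, hXC]
  simpa [pow_two] using Finset.sum_mul_sq_le_sq_mul_sq Finset.univ (fun k => C k i) (fun k => C k j)

/-- Iterating `grothendieck_step` from the trivial bound `∑ |Mᵢⱼ|` shrinks the excess over `128 m`
geometrically, because `48 + (9/16) · 128 = 120 ≤ 128`. The constant is not optimised. Nonnegativity
of `m` follows by flipping the sign of one argument. -/
theorem grothendieck {n : ℕ} {M : Matrix (Fin n) (Fin n) ℝ} {m : ℝ}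
    (hm : ∀ s t : Labels n, bilin M (realVec s) (realVec t) ≤ m)
    {X : Matrix (Fin n) (Fin n) ℝ} (hX : X.PosSemidef) (hX1 : ∀ i, X i i ≤ 1) :
    |frobInner M X| ≤ 128 * m := by
  have hm0 : 0 ≤ m := by
    have h1 := hm 1 1
    have h2 := hm (-1) 1
    have : bilin M (realVec (-1 : Labels n)) (realVec (1 : Labels n)) =
        -bilin M (realVec (1 : Labels n)) (realVec (1 : Labels n)) := by
      simp [bilin, realVec]
    linarith
  set B0 : ℝ := ∑ i, ∑ j, |M i j| with hB0
  have key : ∀ k : ℕ, ∀ X : Matrix (Fin n) (Fin n) ℝ, X.PosSemidef → (∀ i, X i i ≤ 1) →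
      |frobInner M X| ≤ 128 * m + (9 / 16) ^ k * B0 := by
    intro k
    induction k with
    | zero =>
      intro X hX hX1
      have : |frobInner M X| ≤ B0 := by
        refine (Finset.abs_sum_le_sum_abs _ _).trans (Finset.sum_le_sum fun i _ => ?_)
        refine (Finset.abs_sum_le_sum_abs _ _).trans (Finset.sum_le_sum fun j _ => ?_)
        rw [abs_mul]
        refine mul_le_of_le_one_right (abs_nonneg _) ?_
        rw [← sq_le_one_iff_abs_le_one]
        have h1 := hX.diag_nonneg (i := i)
        have h2 := hX.diag_nonneg (i := j)
        calc _ ≤ _ := abs_apply_le_of_posSemidef hX i j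
          _ ≤ 1 := mul_le_one₀ (hX1 i) h2 (hX1 j)
      simp only [pow_zero, one_mul]
      linarith
    | succ k ih =>
      intro X hX hX1
      have := grothendieck_step hm ih X hX hX1
      rw [pow_succ]
      linarith
  have hlim : Filter.Tendsto (fun k : ℕ => 128 * m + (9 / 16 : ℝ) ^ k * B0) Filter.atTop
      (nhds (128 * m + 0 * B0)) :=
    ((tendsto_pow_atTop_nhds_zero_of_lt_one (by norm_num) (by norm_num)).mul_const _).const_add _
  have := ge_of_tendsto' hlim fun k => key k X hX hX1
  simpa using this


/-! ## The Frobenius inner product and the projection -/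

theorem frobSq_eq_frobInner {n : ℕ} (M : Matrix (Fin n) (Fin n) ℝ) : frobSq M = frobInner M M := by
  simp [frobSq, frobInner, pow_two]

theorem frobSq_nonneg {n : ℕ} (M : Matrix (Fin n) (Fin n) ℝ) : 0 ≤ frobSq M :=
  Finset.sum_nonneg fun _ _ => Finset.sum_nonneg fun _ _ => sq_nonneg _

theorem frobInner_comm {n : ℕ} (A B : Matrix (Fin n) (Fin n) ℝ) :
    frobInner A B = frobInner B A := by
  simp [frobInner, mul_comm]

theorem frobInner_add_left {n : ℕ} (A B D : Matrix (Fin n) (Fin n) ℝ) :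
    frobInner (A + B) D = frobInner A D + frobInner B D := by
  simp [frobInner, add_mul, Finset.sum_add_distrib]

theorem frobInner_sub_left {n : ℕ} (A B D : Matrix (Fin n) (Fin n) ℝ) :
    frobInner (A - B) D = frobInner A D - frobInner B D := by
  simp [frobInner, sub_mul, Finset.sum_sub_distrib]

theorem frobInner_smul_left {n : ℕ} (c : ℝ) (A D : Matrix (Fin n) (Fin n) ℝ) :
    frobInner (c • A) D = c * frobInner A D := by
  simp [frobInner, Finset.mul_sum, mul_assoc]

theorem frobInner_add_right {n : ℕ} (A B D : Matrix (Fin n) (Fin n) ℝ) :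
    frobInner D (A + B) = frobInner D A + frobInner D B := by
  simp [frobInner, mul_add, Finset.sum_add_distrib]

theorem frobInner_sub_right {n : ℕ} (A B D : Matrix (Fin n) (Fin n) ℝ) :
    frobInner D (A - B) = frobInner D A - frobInner D B := by
  simp [frobInner, mul_sub, Finset.sum_sub_distrib]

theorem frobInner_smul_right {n : ℕ} (c : ℝ) (A D : Matrix (Fin n) (Fin n) ℝ) :
    frobInner D (c • A) = c * frobInner D A := by
  rw [frobInner_comm, frobInner_smul_left, frobInner_comm]

theorem frobSq_add {n : ℕ} (A B : Matrix (Fin n) (Fin n) ℝ) :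
    frobSq (A + B) = frobSq A + 2 * frobInner A B + frobSq B := by
  simp only [frobSq_eq_frobInner, frobInner_add_left, frobInner_add_right, frobInner_comm B A]
  ring

theorem frobSq_sub {n : ℕ} (A B : Matrix (Fin n) (Fin n) ℝ) :
    frobSq (A - B) = frobSq A - 2 * frobInner A B + frobSq B := by
  simp only [frobSq_eq_frobInner, frobInner_sub_left, frobInner_sub_right, frobInner_comm B A]
  ring

theorem frobSq_smul {n : ℕ} (c : ℝ) (A : Matrix (Fin n) (Fin n) ℝ) :
    frobSq (c • A) = c ^ 2 * frobSq A := by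
  simp only [frobSq_eq_frobInner, frobInner_smul_left, frobInner_smul_right]
  ring

theorem frobInner_eq_sum_prod {n : ℕ} (A B : Matrix (Fin n) (Fin n) ℝ) :
    frobInner A B = ∑ p : Fin n × Fin n, A p.1 p.2 * B p.1 p.2 := by
  rw [Fintype.sum_prod_type]
  rfl

theorem frobInner_sq_le {n : ℕ} (A B : Matrix (Fin n) (Fin n) ℝ) :
    frobInner A B ^ 2 ≤ frobSq A * frobSq B := by
  simp only [frobSq_eq_frobInner, frobInner_eq_sum_prod]
  simpa [pow_two] using Finset.sum_mul_sq_le_sq_mul_sq Finset.univ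
    (fun p : Fin n × Fin n => A p.1 p.2) (fun p => B p.1 p.2)

/-- The Frobenius norm. -/
def frobNorm {n : ℕ} (A : Matrix (Fin n) (Fin n) ℝ) : ℝ := Real.sqrt (frobSq A)

theorem frobNorm_nonneg {n : ℕ} (A : Matrix (Fin n) (Fin n) ℝ) : 0 ≤ frobNorm A :=
  Real.sqrt_nonneg _

theorem frobNorm_sq {n : ℕ} (A : Matrix (Fin n) (Fin n) ℝ) : frobNorm A ^ 2 = frobSq A :=
  Real.sq_sqrt (frobSq_nonneg A)

theorem abs_frobInner_le {n : ℕ} (A B : Matrix (Fin n) (Fin n) ℝ) :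
    |frobInner A B| ≤ frobNorm A * frobNorm B := by
  rw [frobNorm, frobNorm, ← Real.sqrt_mul (frobSq_nonneg A)]
  exact Real.abs_le_sqrt (frobInner_sq_le A B)

theorem frobInner_le {n : ℕ} (A B : Matrix (Fin n) (Fin n) ℝ) :
    frobInner A B ≤ frobNorm A * frobNorm B := (le_abs_self _).trans (abs_frobInner_le A B)

theorem frobNorm_add_le {n : ℕ} (A B : Matrix (Fin n) (Fin n) ℝ) :
    frobNorm (A + B) ≤ frobNorm A + frobNorm B := by
  refine Real.sqrt_le_iff.mpr ⟨add_nonneg (frobNorm_nonneg A) (frobNorm_nonneg B), ?_⟩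
  rw [frobSq_add, ← frobNorm_sq, ← frobNorm_sq]
  linarith [frobInner_le A B]

theorem frobNorm_smul {n : ℕ} (c : ℝ) (A : Matrix (Fin n) (Fin n) ℝ) :
    frobNorm (c • A) = |c| * frobNorm A := by
  rw [frobNorm, frobSq_smul, Real.sqrt_mul (sq_nonneg c), Real.sqrt_sq_eq_abs, frobNorm]

theorem frobNorm_neg {n : ℕ} (A : Matrix (Fin n) (Fin n) ℝ) : frobNorm (-A) = frobNorm A := by
  simp [frobNorm, frobSq]

theorem frobNorm_sub_le {n : ℕ} (A B : Matrix (Fin n) (Fin n) ℝ) :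
    frobNorm (A - B) ≤ frobNorm A + frobNorm B := by
  rw [sub_eq_add_neg, ← frobNorm_neg B]
  exact frobNorm_add_le _ _

theorem feasible_convex {n : ℕ} {X Z : Matrix (Fin n) (Fin n) ℝ} (hX : X ∈ feasible n)
    (hZ : Z ∈ feasible n) {t : ℝ} (h0 : 0 ≤ t) (h1 : t ≤ 1) : X + t • (Z - X) ∈ feasible n := by
  have h : X + t • (Z - X) = (1 - t) • X + t • Z := by
    rw [smul_sub, sub_smul, one_smul]; abel
  rw [h]
  refine ⟨(hX.1.smul (by linarith)).add (hZ.1.smul h0), fun i => ?_⟩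
  simp only [Matrix.add_apply, Matrix.smul_apply, smul_eq_mul, hX.2, hZ.2]
  ring

theorem proj_mem {n : ℕ} (Y : Matrix (Fin n) (Fin n) ℝ) : proj Y ∈ feasible n :=
  (exists_projection Y).choose_spec.1

theorem frobSq_sub_proj_le {n : ℕ} (Y : Matrix (Fin n) (Fin n) ℝ) {Z : Matrix (Fin n) (Fin n) ℝ}
    (hZ : Z ∈ feasible n) : frobSq (Y - proj Y) ≤ frobSq (Y - Z) :=
  (exists_projection Y).choose_spec.2 Z hZ

/-- First-order optimality: moving from the projection towards `Z` stays in the convex set and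
cannot decrease the distance to `Y`. -/
theorem frobInner_sub_proj_nonpos {n : ℕ} (Y : Matrix (Fin n) (Fin n) ℝ)
    {Z : Matrix (Fin n) (Fin n) ℝ} (hZ : Z ∈ feasible n) :
    frobInner (Y - proj Y) (Z - proj Y) ≤ 0 := by
  set a := frobInner (Y - proj Y) (Z - proj Y) with ha
  set b := frobSq (Z - proj Y) with hb
  have hb0 : 0 ≤ b := frobSq_nonneg _
  have key : ∀ t : ℝ, 0 ≤ t → t ≤ 1 → 0 ≤ -(2 * t * a) + t ^ 2 * b := by
    intro t h0 h1
    have h := frobSq_sub_proj_le Y (feasible_convex (proj_mem Y) hZ h0 h1)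
    rw [show Y - (proj Y + t • (Z - proj Y)) = (Y - proj Y) - t • (Z - proj Y) by abel,
      frobSq_sub (Y - proj Y), frobSq_smul, frobInner_smul_right] at h
    linarith
  by_contra hcon
  push Not at hcon
  -- For `a > 0` the step `t = a/(a+b)` lies in `(0, 1]` even when `b = 0`. It gives `2a ≤ tb ≤ a`,
  -- a contradiction.
  have ht : a / (a + b) ≤ 1 := (div_le_one (by linarith)).mpr (by linarith)
  have ht0 : 0 < a / (a + b) := by positivity
  have h := key _ ht0.le ht
  have h2 : 0 ≤ -(2 * a) + a / (a + b) * b := by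
    by_contra h3
    push Not at h3
    nlinarith
  have h3 : a / (a + b) * b ≤ a := by
    rw [div_mul_eq_mul_div, div_le_iff₀ (by linarith)]
    nlinarith
  linarith

/-! ### Sensitivity of the projection to one edge -/

theorem abs_apply_le_of_feasible {n : ℕ} {X : Matrix (Fin n) (Fin n) ℝ} (hX : X ∈ feasible n)
    (i j : Fin n) : |X i j| ≤ 1 / n := by
  have h := abs_apply_le_of_posSemidef hX.1 i j
  rw [hX.2, hX.2, ← pow_two] at h
  have := sq_le_sq.mp h
  rwa [abs_of_nonneg (by positivity : (0 : ℝ) ≤ 1 / n)] at this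

/-- The sum of the variational inequalities at `Y` and at `Y'`. Keeping the inner product, instead
of applying Cauchy-Schwarz to get nonexpansiveness, allows the entrywise bound `1/n` on feasible
matrices to be used. -/
theorem frobSq_proj_sub_proj_le {n : ℕ} (Y Y' : Matrix (Fin n) (Fin n) ℝ) :
    frobSq (proj Y - proj Y') ≤ frobInner (Y - Y') (proj Y - proj Y') := by
  have h1 := frobInner_sub_proj_nonpos Y (proj_mem Y')
  have h2 := frobInner_sub_proj_nonpos Y' (proj_mem Y)
  rw [frobSq_eq_frobInner]
  simp only [frobInner_sub_left, frobInner_sub_right] at *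
  linarith

theorem exists_edge_of_adjacent {n : ℕ} {G G' : SimpleGraph (Fin n)} (h : AdjacentGraphs G G') :
    ∃ a b : Fin n, a < b ∧ ∀ i j, ¬(i = a ∧ j = b) → ¬(i = b ∧ j = a) →
      (G.Adj i j ↔ G'.Adj i j) := by
  obtain ⟨e, he⟩ := Set.ncard_eq_one.mp h
  induction e using Sym2.ind with
  | _ a b =>
    have hmem : ∀ i j, (G.Adj i j ↔ G'.Adj i j) ∨ s(i, j) = s(a, b) := by
      intro i j
      by_cases hij : s(i, j) ∈ symmDiff G.edgeSet G'.edgeSet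
      · rw [he] at hij
        exact Or.inr hij
      · left
        rw [Set.mem_symmDiff, SimpleGraph.mem_edgeSet, SimpleGraph.mem_edgeSet] at hij
        tauto
    have hab : a ≠ b := by
      rintro rfl
      have : s(a, a) ∈ symmDiff G.edgeSet G'.edgeSet := by rw [he]; rfl
      rw [Set.mem_symmDiff, SimpleGraph.mem_edgeSet, SimpleGraph.mem_edgeSet] at this
      simp at this
    rcases lt_or_gt_of_ne hab with h | h
    · refine ⟨a, b, h, fun i j h1 h2 => ?_⟩
      rcases hmem i j with h3 | h3
      · exact h3
      · rw [Sym2.eq_iff] at h3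
        tauto
    · refine ⟨b, a, h, fun i j h1 h2 => ?_⟩
      rcases hmem i j with h3 | h3
      · exact h3
      · rw [Sym2.eq_iff] at h3
        tauto

/-- The inner product of `frobSq_proj_sub_proj_le` has only two nonzero terms, each at most `1/(γd)
· 2/n`. -/
theorem frobSq_proj_rescaledAdj_sub_le {n : ℕ} {γ d : ℝ} (hγ : 0 < γ) (hd : 0 < d)
    {G G' : SimpleGraph (Fin n)} (h : AdjacentGraphs G G') :
    frobSq (proj (rescaledAdj γ d G) - proj (rescaledAdj γ d G')) ≤ 4 / (n * γ * d) := by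
  classical
  obtain ⟨a, b, hab, hG⟩ := exists_edge_of_adjacent h
  refine (frobSq_proj_sub_proj_le _ _).trans ?_
  set D := proj (rescaledAdj γ d G) - proj (rescaledAdj γ d G') with hD
  have hDe : ∀ i j, |D i j| ≤ 2 / n := by
    intro i j
    calc |D i j| ≤ |proj (rescaledAdj γ d G) i j| + |proj (rescaledAdj γ d G') i j| := abs_sub _ _
      _ ≤ 1 / n + 1 / n := add_le_add (abs_apply_le_of_feasible (proj_mem _) i j)
          (abs_apply_le_of_feasible (proj_mem _) i j)
      _ = _ := by ring
  have hE : ∀ i j, |(rescaledAdj γ d G - rescaledAdj γ d G') i j| ≤ 1 / (γ * d) := by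
    intro i j
    have : (rescaledAdj γ d G - rescaledAdj γ d G') i j = 1 / (γ * d) *
        ((if G.Adj i j then 1 else 0) - (if G'.Adj i j then 1 else 0)) := by
      simp only [rescaledAdj, Matrix.sub_apply, Matrix.of_apply]
      ring
    rw [this, abs_mul, abs_of_pos (by positivity)]
    refine mul_le_of_le_one_right (by positivity) ?_
    split_ifs <;> simp
  have hp : ∀ i j, (rescaledAdj γ d G - rescaledAdj γ d G') i j * D i j ≤
      if (i = a ∧ j = b) ∨ (i = b ∧ j = a) then 2 / (n * γ * d) else 0 := by
    intro i j
    split_ifs with hc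
    · calc _ ≤ |(rescaledAdj γ d G - rescaledAdj γ d G') i j| * |D i j| := by
            rw [← abs_mul]; exact le_abs_self _
        _ ≤ 1 / (γ * d) * (2 / n) := by gcongr; exact hE i j; exact hDe i j
        _ = _ := by field_simp
    · rw [not_or] at hc
      simp [rescaledAdj, hG i j hc.1 hc.2]
  calc frobInner (rescaledAdj γ d G - rescaledAdj γ d G') D ≤
      ∑ i, ∑ j, if (i = a ∧ j = b) ∨ (i = b ∧ j = a) then 2 / (n * γ * d) else 0 :=
        Finset.sum_le_sum fun i _ => Finset.sum_le_sum fun j _ => hp i j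
    _ ≤ ∑ i : Fin n, ∑ j : Fin n, ((if i = a then (if j = b then 2 / (n * γ * d) else 0) else 0) +
        (if i = b then (if j = a then 2 / (n * γ * d) else 0) else 0)) := by
        refine Finset.sum_le_sum fun i _ => Finset.sum_le_sum fun j _ => ?_
        have : (0 : ℝ) ≤ 2 / (n * γ * d) := by positivity
        simp only [← ite_and]
        split_ifs <;> first | linarith | (exfalso; tauto)
    _ = _ := by
        simp only [Finset.sum_add_distrib]
        have h1 : ∀ u v : Fin n, ∑ i : Fin n, ∑ j : Fin n,
            (if i = u then (if j = v then 2 / (n * γ * d) else 0) else 0) = 2 / (n * γ * d) := by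
          intro u v
          rw [Finset.sum_eq_single u (by intro i _ hi; simp [hi]) (by simp)]
          simp
        rw [h1, h1]
        ring

/-! ### Distance from the projection to the ground truth -/

/-- The ground truth `x xᵀ / n`. -/
def truth {n : ℕ} (x : Labels n) : Matrix (Fin n) (Fin n) ℝ :=
  Matrix.of fun i j => realVec x i * realVec x j / n

theorem truth_mem {n : ℕ} (x : Labels n) : truth x ∈ feasible n := by
  constructor
  · have : truth x = (1 / n : ℝ) • Matrix.vecMulVec (realVec x) (star (realVec x)) := by
      ext i j
      simp [truth, Matrix.vecMulVec, div_eq_inv_mul]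
    rw [this]
    exact (Matrix.posSemidef_vecMulVec_self_star _).smul (by positivity)
  · intro i
    simp only [truth, Matrix.of_apply]
    rw [← pow_two, realVec_sq]

/-- Off the diagonal `𝔼Y` equals the ground truth, and on the diagonal all feasible matrices agree.
So the error is at most `1/(γd)` times a difference of two values of `⟨A - 𝔼A, ·⟩` on feasible
matrices, each controlled by `grothendieck`. -/
theorem frobSq_proj_sub_truth_le {n : ℕ} {γ d : ℝ} (hγ : 0 < γ) (hd : 0 < d) {x : Labels n}
    {G : SimpleGraph (Fin n)} (hG : CutBound γ d x G) :
    frobSq (proj (rescaledAdj γ d G) - truth x) ≤ 3072 / (γ * Real.sqrt d) := by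
  set Y := rescaledAdj γ d G with hY
  have h1 := frobInner_sub_proj_nonpos Y (truth_mem x)
  have h2 : frobSq (proj Y - truth x) ≤ frobInner (Y - truth x) (proj Y - truth x) := by
    rw [frobSq_eq_frobInner]
    simp only [frobInner_sub_left, frobInner_sub_right] at *
    linarith
  have h3 : frobInner (Y - truth x) (proj Y - truth x) =
      1 / (γ * d) * (frobInner (centredAdj γ d x G) (proj Y) -
        frobInner (centredAdj γ d x G) (truth x)) := by
    rw [← frobInner_sub_right, ← frobInner_smul_left]
    refine Finset.sum_congr rfl fun i _ => Finset.sum_congr rfl fun j _ => ?_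
    by_cases hij : i = j
    · subst hij
      simp [(proj_mem Y).2 i, (truth_mem x).2 i]
    · congr 1
      simp only [hY, rescaledAdj, truth, Matrix.sub_apply, Matrix.of_apply, Matrix.smul_apply,
        centredAdj, if_neg hij, edgeProb, smul_eq_mul, realVec]
      push_cast
      field_simp
      ring
  have h4 : ∀ Z ∈ feasible n, |frobInner (centredAdj γ d x G) Z| ≤ 1536 * Real.sqrt d := by
    intro Z hZ
    rcases Nat.eq_zero_or_pos n with rfl | hn
    · simp [frobInner]
    have hn' : (0 : ℝ) < n := by exact_mod_cast hn
    -- Rescaling by `n` makes the diagonal `1`; the constant is `128 · 12 = 1536`.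
    have := grothendieck hG (X := (n : ℝ) • Z) (hZ.1.smul (by positivity)) (fun i => by
      simp only [Matrix.smul_apply, smul_eq_mul, hZ.2 i]
      rw [mul_one_div_cancel hn'.ne'])
    rw [frobInner_smul_right, abs_mul, abs_of_pos hn'] at this
    have h5 : (n : ℝ) * |frobInner (centredAdj γ d x G) Z| ≤ n * (1536 * Real.sqrt d) := by
      linarith
    exact le_of_mul_le_mul_left h5 hn'
  have h5 := abs_le.mp (h4 _ (proj_mem Y))
  have h6 := abs_le.mp (h4 _ (truth_mem x))
  calc _ ≤ _ := h2
    _ = _ := h3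
    _ ≤ 1 / (γ * d) * (3072 * Real.sqrt d) := by
        gcongr
        linarith [h5.2, h6.1]
    _ = _ := by
        have : Real.sqrt d * Real.sqrt d = d := Real.mul_self_sqrt hd.le
        have h0 : 0 < Real.sqrt d := Real.sqrt_pos.mpr hd
        rw [div_mul_eq_mul_div, one_mul, div_eq_div_iff (by positivity) (by positivity)]
        linear_combination (3072 * γ) * this


/-! ## Gaussian families: tails, Cameron-Martin, the Gaussian mechanism -/

/-- A finite family of independent `N(0, v)` variables. -/
structure IsGaussianFamily {ι Ω : Type} [MeasurableSpace Ω] (μ : Measure Ω) (v : NNReal)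
    (ξ : ι → Ω → ℝ) : Prop where
  measurable : ∀ p, Measurable (ξ p)
  indep : iIndepFun ξ μ
  law : ∀ p, μ.map (ξ p) = gaussianReal 0 v

/-- Chernoff's bound, with the parameter `l` left free: the linear form has variance at most `vs`.
-/
theorem IsGaussianFamily.tail_le {ι Ω : Type} [Fintype ι] [MeasurableSpace Ω] {μ : Measure Ω}
    [IsProbabilityMeasure μ] {v : NNReal} {ξ : ι → Ω → ℝ} (h : IsGaussianFamily μ v ξ)
    (c : ι → ℝ) {s l : ℝ} (hs : ∑ p, c p ^ 2 ≤ s) (hl : 0 ≤ l) (T : ℝ) :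
    μ.real {ω | T ≤ ∑ p, c p * ξ p ω} ≤ Real.exp (l ^ 2 * v * s / 2 - l * T) := by
  have hm : ∀ p, Measurable fun ω => c p * ξ p ω := fun p => (h.measurable p).const_mul _
  have hind : iIndepFun (fun p ω => c p * ξ p ω) μ :=
    h.indep.comp (fun p x => c p * x) fun p => measurable_const_mul _
  have hmgf1 : ∀ p, mgf (fun ω => c p * ξ p ω) μ l = Real.exp (v * (c p * l) ^ 2 / 2) := by
    intro p
    rw [mgf_const_mul, mgf_gaussianReal (h.law p)]
    simp
  have hint1 : ∀ p, Integrable (fun ω => Real.exp (l * (c p * ξ p ω))) μ := by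
    intro p
    have h1 := integrable_exp_mul_gaussianReal (μ := 0) (v := v) (l * c p)
    rw [← h.law p] at h1
    have h2 := (integrable_map_measure h1.aestronglyMeasurable (h.measurable p).aemeasurable).mp h1
    refine h2.congr (Filter.Eventually.of_forall fun ω => ?_)
    simp [mul_assoc]
  have hint := hind.integrable_exp_mul_sum hm (s := Finset.univ) fun p _ => hint1 p
  have hmgf := hind.mgf_sum hm (t := l) Finset.univ
  have hch := measure_ge_le_exp_mul_mgf (X := ∑ p, fun ω => c p * ξ p ω) T hl hint
  rw [hmgf] at hch
  simp only [hmgf1, ← Real.exp_sum, Finset.sum_apply] at hch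
  refine hch.trans ?_
  rw [← Real.exp_add]
  refine Real.exp_le_exp.mpr ?_
  have h1 : ∑ p, (v : ℝ) * (c p * l) ^ 2 / 2 = l ^ 2 * v * (∑ p, c p ^ 2) / 2 := by
    rw [Finset.mul_sum, Finset.sum_div]
    refine Finset.sum_congr rfl fun p _ => by ring
  rw [h1]
  have : l ^ 2 * v * (∑ p, c p ^ 2) ≤ l ^ 2 * v * s := by gcongr
  linarith

theorem isGaussianFamily_pi {ι : Type} [Fintype ι] (v : NNReal) :
    IsGaussianFamily (Measure.pi fun _ : ι => gaussianReal 0 v) v fun p x => x p where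
  measurable p := measurable_pi_apply p
  indep := iIndepFun_pi (X := fun _ => id) fun _ => aemeasurable_id
  law p := (measurePreserving_eval _ p).map_eq

theorem IsGaussianFamily.map_eq_pi {ι Ω : Type} [Fintype ι] [MeasurableSpace Ω] {μ : Measure Ω}
    [IsProbabilityMeasure μ] {v : NNReal} {ξ : ι → Ω → ℝ} (h : IsGaussianFamily μ v ξ) :
    μ.map (fun ω p => ξ p ω) = Measure.pi fun _ : ι => gaussianReal 0 v := by
  rw [(iIndepFun_iff_map_fun_eq_pi_map fun p => (h.measurable p).aemeasurable).mp h.indep]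
  simp only [h.law]

/-- Completing the square; the density is the one-dimensional Cameron-Martin factor. -/
theorem gaussianReal_eq_withDensity {v : NNReal} (hv : v ≠ 0) (a : ℝ) :
    gaussianReal a v = (gaussianReal 0 v).withDensity fun x =>
      ENNReal.ofReal (Real.exp (a * x / v - a ^ 2 / (2 * v))) := by
  have hv' : (v : ℝ) ≠ 0 := by exact_mod_cast hv
  rw [gaussianReal_of_var_ne_zero _ hv, gaussianReal_of_var_ne_zero _ hv,
    ← withDensity_mul _ (measurable_gaussianPDF 0 v) (by fun_prop)]
  congr 1
  funext x
  simp only [gaussianPDF, Pi.mul_apply]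
  rw [← ENNReal.ofReal_mul (gaussianPDFReal_nonneg _ _ _)]
  congr 1
  simp only [gaussianPDFReal]
  rw [mul_assoc (Real.sqrt _)⁻¹, ← Real.exp_add]
  congr 2
  field_simp
  ring

theorem pi_gaussianReal_eq_withDensity {ι : Type} [Fintype ι] {v : NNReal} (hv : v ≠ 0)
    (a : ι → ℝ) :
    (Measure.pi fun p => gaussianReal (a p) v) =
      (Measure.pi fun _ : ι => gaussianReal 0 v).withDensity fun x =>
        ENNReal.ofReal (Real.exp (∑ p, (a p * x p / v - a p ^ 2 / (2 * v)))) := by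
  refine Measure.pi_eq fun s hs => ?_
  rw [withDensity_apply _ (MeasurableSet.univ_pi hs), ← lintegral_indicator
    (MeasurableSet.univ_pi hs)]
  let f : ι → ℝ → ENNReal := fun p => (s p).indicator fun y =>
    ENNReal.ofReal (Real.exp (a p * y / v - a p ^ 2 / (2 * v)))
  have hf : ∀ p, Measurable (f p) := fun p => Measurable.indicator (by fun_prop) (hs p)
  have h1 : ∀ x : ι → ℝ, (Set.univ.pi s).indicator (fun x =>
      ENNReal.ofReal (Real.exp (∑ p, (a p * x p / v - a p ^ 2 / (2 * v))))) x = ∏ p, f p (x p) := by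
    intro x
    by_cases hx : x ∈ Set.univ.pi s
    · rw [Set.indicator_of_mem hx, Real.exp_sum,
        ENNReal.ofReal_prod_of_nonneg fun p _ => (Real.exp_pos _).le]
      refine Finset.prod_congr rfl fun p _ => ?_
      simp only [f]
      rw [Set.indicator_of_mem (hx p trivial)]
    · rw [Set.indicator_of_notMem hx]
      simp only [Set.mem_univ_pi, not_forall] at hx
      obtain ⟨p, hp⟩ := hx
      rw [Finset.prod_eq_zero (Finset.mem_univ p)]
      simp [f, hp]
  simp only [h1]
  have hind : iIndepFun (fun p (x : ι → ℝ) => f p (x p))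
      (Measure.pi fun _ : ι => gaussianReal 0 v) := iIndepFun_pi fun p => (hf p).aemeasurable
  rw [lintegral_prod_eq_prod_lintegral_of_indepFun _ _ hind
    fun p => (hf p).comp (measurable_pi_apply p)]
  refine Finset.prod_congr rfl fun p _ => ?_
  rw [gaussianReal_eq_withDensity hv (a p), withDensity_apply _ (hs p),
    ← lintegral_indicator (hs p)]
  conv_rhs => rw [← (measurePreserving_eval (fun _ : ι => gaussianReal 0 v) p).map_eq,
    lintegral_map (hf p) (measurable_pi_apply p)]

theorem pi_gaussianReal_map_add {ι : Type} [Fintype ι] (v : NNReal) (a : ι → ℝ) :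
    (Measure.pi fun _ : ι => gaussianReal 0 v).map (fun x => x + a) =
      Measure.pi fun p => gaussianReal (a p) v := by
  have h := Measure.pi_map_pi (μ := fun _ : ι => gaussianReal 0 v)
    (f := fun p y => y + a p) (fun p => (measurable_add_const _).aemeasurable)
  have h2 : (fun x : ι → ℝ => x + a) = fun x i => x i + a i := rfl
  rw [h2, h]
  congr 1
  funext p
  rw [gaussianReal_map_add_const, zero_add]

/-- Split `A` according to whether the privacy loss `ℓ`, the logarithm of the density of the shifted
law, exceeds `ε`. Where `ℓ ≤ ε` the densities differ by at most `e^ε`; the rest has shifted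
probability at most `δ`, since under the shifted law `ℓ` is Gaussian with mean `‖a‖²/(2v)` and
variance `‖a‖²/v`. The parameter `ρ` bounds this variance. -/
theorem pi_gaussianReal_shift_le {ι : Type} [Fintype ι] {v : NNReal} (hv : v ≠ 0)
    {a : ι → ℝ} {ε δ ρ : ℝ} (hρ : 0 < ρ) (ha : ∑ p, a p ^ 2 ≤ ρ * v) (hδ : 0 < δ)
    (hερ : ρ / 2 ≤ ε) (hεδ : 2 * Real.log (1 / δ) ≤ ε ^ 2 / ρ - ε)
    {A : Set (ι → ℝ)} (hA : MeasurableSet A) :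
    (Measure.pi fun _ : ι => gaussianReal 0 v) {x | x + a ∈ A} ≤
      ENNReal.ofReal (Real.exp ε) * (Measure.pi fun _ : ι => gaussianReal 0 v) A +
        ENNReal.ofReal δ := by
  set ν := Measure.pi fun _ : ι => gaussianReal 0 v with hν
  have hv' : (0 : ℝ) < v := by exact_mod_cast pos_iff_ne_zero.mpr hv
  let ℓ : (ι → ℝ) → ℝ := fun x => ∑ p, (a p * x p / v - a p ^ 2 / (2 * v))
  have hℓ : Measurable ℓ := by fun_prop
  have hmadd : Measurable fun x : ι → ℝ => x + a := measurable_add_const a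
  have hmap := pi_gaussianReal_map_add v a
  have h1 : ν {x | x + a ∈ A} = (ν.map fun x => x + a) A := by
    rw [Measure.map_apply hmadd hA]; rfl
  have hB : MeasurableSet {x | ℓ x ≤ ε} := measurableSet_le hℓ measurable_const
  have h2 : (ν.map fun x => x + a) (A ∩ {x | ℓ x ≤ ε}) ≤ ENNReal.ofReal (Real.exp ε) * ν A := by
    rw [hmap, pi_gaussianReal_eq_withDensity hv, withDensity_apply _ (hA.inter hB)]
    calc _ ≤ ∫⁻ x in A ∩ {x | ℓ x ≤ ε}, ENNReal.ofReal (Real.exp ε) ∂ν := by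
          refine setLIntegral_mono measurable_const fun x hx => ?_
          exact ENNReal.ofReal_le_ofReal (Real.exp_le_exp.mpr hx.2)
      _ = ENNReal.ofReal (Real.exp ε) * ν (A ∩ {x | ℓ x ≤ ε}) := by
          rw [setLIntegral_const]
      _ ≤ _ := by gcongr; exact Set.inter_subset_left
  have h3 : (ν.map fun x => x + a) {x | ℓ x ≤ ε}ᶜ ≤ ENNReal.ofReal δ := by
    rw [Measure.map_apply hmadd hB.compl]
    have hsub : (fun x : ι → ℝ => x + a) ⁻¹' {x | ℓ x ≤ ε}ᶜ ⊆
        {x | ε - ρ / 2 ≤ ∑ p, a p / v * x p} := by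
      intro x hx
      simp only [Set.mem_preimage, Set.mem_compl_iff, Set.mem_ofPred_eq, not_le] at hx ⊢
      have : ℓ (x + a) = ∑ p, a p / v * x p + (∑ p, a p ^ 2) / (2 * v) := by
        simp only [ℓ, Finset.sum_div, ← Finset.sum_add_distrib, Pi.add_apply]
        refine Finset.sum_congr rfl fun p _ => ?_
        field_simp
        ring
      have h4 : (∑ p, a p ^ 2) / (2 * v) ≤ ρ / 2 := by
        rw [div_le_iff₀ (by positivity)]
        linarith
      linarith
    refine (measure_mono hsub).trans ?_
    have hs : ∑ p, (a p / v) ^ 2 ≤ ρ / v := by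
      simp only [div_pow]
      rw [← Finset.sum_div, div_le_div_iff₀ (by positivity) hv']
      calc _ ≤ ρ * v * v := by gcongr
        _ = _ := by ring
    -- `l = ε/ρ - 1/2` is the optimal Chernoff parameter: the threshold `ε - ρ/2` equals `ρl`, so
    -- the exponent is `-ρl²/2`.
    have hl : 0 ≤ ε / ρ - 1 / 2 := by
      rw [sub_nonneg, le_div_iff₀ hρ]; linarith
    have ht := (isGaussianFamily_pi (ι := ι) v).tail_le (fun p => a p / v) hs hl (ε - ρ / 2)
    have hexp : (ε / ρ - 1 / 2) ^ 2 * v * (ρ / v) / 2 - (ε / ρ - 1 / 2) * (ε - ρ / 2) ≤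
        Real.log δ := by
      have e1 : (ε / ρ - 1 / 2) ^ 2 * v * (ρ / v) / 2 - (ε / ρ - 1 / 2) * (ε - ρ / 2) =
          -(ε ^ 2 / ρ - ε + ρ / 4) / 2 := by
        field_simp
        ring
      rw [e1]
      rw [one_div, Real.log_inv] at hεδ
      linarith
    have h5 : ν.real {x | ε - ρ / 2 ≤ ∑ p, a p / v * x p} ≤ δ := by
      refine ht.trans ?_
      exact (Real.exp_le_exp.mpr hexp).trans_eq (Real.exp_log hδ)
    rw [← ofReal_measureReal]
    exact ENNReal.ofReal_le_ofReal h5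
  rw [h1]
  calc _ ≤ (ν.map fun x => x + a) (A ∩ {x | ℓ x ≤ ε}) +
        (ν.map fun x => x + a) (A ∩ {x | ℓ x ≤ ε}ᶜ) := measure_le_inter_add_sdiff _ _ _
    _ ≤ _ := add_le_add h2 ((measure_mono Set.inter_subset_right).trans h3)

theorem symmFill_apply {n : ℕ} (g : Fin n → Fin n → ℝ) (i j : Fin n) :
    symmFill g i j = if i ≤ j then g i j else g j i := rfl

theorem symmFill_add {n : ℕ} (g h : Fin n → Fin n → ℝ) :
    symmFill (g + h) = symmFill g + symmFill h := by
  ext i j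
  simp only [symmFill_apply, Matrix.add_apply, Pi.add_apply]
  split_ifs <;> rfl

theorem symmFill_isSymm {n : ℕ} (g : Fin n → Fin n → ℝ) : (symmFill g).IsSymm := by
  refine Matrix.IsSymm.ext fun i j => ?_
  simp only [symmFill_apply]
  rcases lt_trichotomy i j with h | h | h
  · simp [h.le, h.not_ge]
  · simp [h]
  · simp [h.le, h.not_ge]

theorem symmFill_of_isSymm {n : ℕ} {M : Matrix (Fin n) (Fin n) ℝ} (h : M.IsSymm) :
    symmFill (fun i j => M i j) = M := by
  ext i j
  simp only [symmFill_apply]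
  split_ifs
  · rfl
  · exact h.apply i j

theorem measurable_symmFill {n : ℕ} :
    Measurable (fun g : Fin n → Fin n → ℝ => fun i j => symmFill g i j) := by
  refine measurable_pi_lambda _ fun i => measurable_pi_lambda _ fun j => ?_
  simp only [symmFill_apply]
  split_ifs
  · fun_prop
  · fun_prop

/-- Adding symmetric Gaussian noise to two symmetric matrices at a small Frobenius distance gives
indistinguishable outputs. -/
theorem gaussianMechanism {n : ℕ} {Ω : Type} [MeasurableSpace Ω] {μ : Measure Ω}
    [IsProbabilityMeasure μ] {v : NNReal} (hv : v ≠ 0) {ξ : Fin n × Fin n → Ω → ℝ}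
    (h : IsGaussianFamily μ v ξ) {M M' : Matrix (Fin n) (Fin n) ℝ} (hM : M.IsSymm)
    (hM' : M'.IsSymm) {ε δ ρ : ℝ} (hρ : 0 < ρ) (ha : frobSq (M - M') ≤ ρ * v) (hδ : 0 < δ)
    (hερ : ρ / 2 ≤ ε) (hεδ : 2 * Real.log (1 / δ) ≤ ε ^ 2 / ρ - ε)
    {A : Set (Fin n → Fin n → ℝ)} (hA : MeasurableSet A) :
    μ {ω | (fun i j => (M + symmFill fun i j => ξ (i, j) ω) i j) ∈ A} ≤
      ENNReal.ofReal (Real.exp ε) *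
        μ {ω | (fun i j => (M' + symmFill fun i j => ξ (i, j) ω) i j) ∈ A} + ENNReal.ofReal δ := by
  let F : Matrix (Fin n) (Fin n) ℝ → (Fin n × Fin n → ℝ) → (Fin n → Fin n → ℝ) := fun M x i j =>
    (M + symmFill fun i j => x (i, j)) i j
  have hF : ∀ M, Measurable (F M) := by
    intro M
    refine measurable_pi_lambda _ fun i => measurable_pi_lambda _ fun j => ?_
    simp only [F, Matrix.add_apply, symmFill_apply]
    split_ifs
    · fun_prop
    · fun_prop
  let a : Fin n × Fin n → ℝ := fun p => (M - M') p.1 p.2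
  -- Replacing `M'` by `M` is the same as shifting the whole noise array by `M - M'`. `symmFill`
  -- discards the shift below the diagonal, so counting it in the squared norm is harmless.
  have hFa : ∀ x, F M x = F M' (x + a) := by
    intro x
    have h1 : (fun i j => (x + a) (i, j)) = (fun i j => x (i, j)) + fun i j => (M - M') i j := by
      funext i j; rfl
    simp only [F, h1, symmFill_add, symmFill_of_isSymm (hM.sub hM')]
    funext i j
    simp only [Matrix.add_apply, Matrix.sub_apply]
    ring
  have hmeas : Measurable fun ω p => ξ p ω := measurable_pi_lambda _ h.measurable
  have hmap : ∀ M, μ {ω | F M (fun p => ξ p ω) ∈ A} =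
      (Measure.pi fun _ : Fin n × Fin n => gaussianReal 0 v) {x | F M x ∈ A} := by
    intro M
    rw [← h.map_eq_pi]
    exact (Measure.map_apply hmeas (hF M hA)).symm
  have ha' : ∑ p, a p ^ 2 ≤ ρ * v := by
    rw [frobSq_eq_frobInner, frobInner_eq_sum_prod] at ha
    simpa [a, pow_two] using ha
  have := pi_gaussianReal_shift_le hv hρ ha' hδ hερ hεδ (hF M' hA)
  have e1 := hmap M
  have e2 := hmap M'
  simp only [hFa] at e1
  show μ {ω | F M (fun p => ξ p ω) ∈ A} ≤ _ * μ {ω | F M' (fun p => ξ p ω) ∈ A} + _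
  rw [e2]
  simp only [hFa]
  rw [e1]
  exact this


/-! ## The operator norm of a symmetric Gaussian matrix -/

/-- The unit ball of `ℝⁿ` has a `1/2`-net with at most `5ⁿ` points. -/
theorem exists_half_net (n : ℕ) : ∃ N : Finset (EuclideanSpace ℝ (Fin n)), N.card ≤ 5 ^ n ∧
    (∀ c ∈ N, ‖c‖ ≤ 1) ∧ ∀ u : EuclideanSpace ℝ (Fin n), ‖u‖ ≤ 1 → ∃ c ∈ N, ‖u - c‖ ≤ 1 / 2 := by
  classical
  let Sep : Finset (EuclideanSpace ℝ (Fin n)) → Prop := fun s =>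
    (∀ c ∈ s, ‖c‖ ≤ 2) ∧ ∀ c ∈ s, ∀ d ∈ s, c ≠ d → 1 ≤ ‖c - d‖
  have hcard : ∀ s, Sep s → s.card ≤ 5 ^ n := by
    intro s hs
    have := Besicovitch.card_le_of_separated s hs.1 hs.2
    simpa using this
  let Q : ℕ → Prop := fun k => ∃ s, Sep s ∧ s.card = k
  have hQ0 : Q 0 := ⟨∅, ⟨by simp, by simp⟩, rfl⟩
  obtain ⟨s, hs, hsk⟩ : Q (Nat.findGreatest Q (5 ^ n)) := Nat.findGreatest_spec (Nat.zero_le _) hQ0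
  have hmax : ∀ t, Sep t → t.card ≤ s.card := by
    intro t ht
    rw [hsk]
    exact Nat.le_findGreatest (hcard t ht) ⟨t, ht, rfl⟩
  -- A `1`-separated set of maximal size in the ball of radius `2`, scaled by `1/2`. A point of the
  -- unit ball far from the net could be doubled and added to the set.
  refine ⟨s.image fun c => (1 / 2 : ℝ) • c, Finset.card_image_le.trans (hcard s hs), ?_, ?_⟩
  · intro c hc
    obtain ⟨d, hd, rfl⟩ := Finset.mem_image.mp hc
    rw [norm_smul]
    have := hs.1 d hd
    norm_num
    linarith
  · intro u hu
    by_contra hcon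
    push Not at hcon
    have h2u : ‖(2 : ℝ) • u‖ ≤ 2 := by
      rw [norm_smul]; norm_num; exact hu
    have hfar : ∀ c ∈ s, 1 ≤ ‖(2 : ℝ) • u - c‖ := by
      intro c hc
      have h := hcon _ (Finset.mem_image_of_mem _ hc)
      have h2 : (2 : ℝ) • u - c = (2 : ℝ) • (u - (1 / 2 : ℝ) • c) := by
        rw [smul_sub, smul_smul]; norm_num
      rw [h2, norm_smul]
      norm_num
      linarith
    have hnot : (2 : ℝ) • u ∉ s := by
      intro h
      have := hfar _ h
      simp at this
      linarith
    have := hmax (insert ((2 : ℝ) • u) s) ⟨?_, ?_⟩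
    · rw [Finset.card_insert_of_notMem hnot] at this
      omega
    · intro c hc
      rcases Finset.mem_insert.mp hc with rfl | hc
      · exact h2u
      · exact hs.1 c hc
    · intro c hc d hd hcd
      rcases Finset.mem_insert.mp hc with rfl | hc <;> rcases Finset.mem_insert.mp hd with rfl | hd
      · exact absurd rfl hcd
      · exact hfar d hd
      · rw [norm_sub_rev]; exact hfar c hc
      · exact hs.2 c hc d hd hcd

/-- The direction of `z` is within `1/2` of a net point, so `‖z‖ ≤ T + ‖z‖/2`. -/
theorem norm_le_of_net {n : ℕ} {N : Finset (EuclideanSpace ℝ (Fin n))}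
    (hN : ∀ u : EuclideanSpace ℝ (Fin n), ‖u‖ ≤ 1 → ∃ c ∈ N, ‖u - c‖ ≤ 1 / 2)
    {z : EuclideanSpace ℝ (Fin n)} {T : ℝ} (hz : ∀ c ∈ N, inner ℝ c z ≤ T) : ‖z‖ ≤ 2 * T := by
  obtain ⟨c, hc, hcu⟩ := hN (‖z‖⁻¹ • z) (by
    rw [norm_smul, norm_inv, norm_norm]
    exact inv_mul_le_one)
  have h1 : inner ℝ (‖z‖⁻¹ • z) z = ‖z‖ := by
    rw [real_inner_smul_left, real_inner_self_eq_norm_sq, pow_two]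
    rcases eq_or_ne ‖z‖ 0 with h | h
    · simp [h]
    · field_simp
  have h2 : inner ℝ (‖z‖⁻¹ • z) z = inner ℝ c z + inner ℝ (‖z‖⁻¹ • z - c) z := by
    rw [← inner_add_left]; congr 1; abel
  have h3 := real_inner_le_norm (‖z‖⁻¹ • z - c) z
  have h4 : ‖‖z‖⁻¹ • z - c‖ * ‖z‖ ≤ 1 / 2 * ‖z‖ := by gcongr
  have := hz c hc
  linarith

theorem bilin_eq_inner {n : ℕ} (W : Matrix (Fin n) (Fin n) ℝ) (u v : Fin n → ℝ) :
    bilin W u v = inner ℝ (WithLp.toLp 2 u : EuclideanSpace ℝ (Fin n))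
      (WithLp.toLp 2 (W.mulVec v)) := by
  simp only [bilin, Matrix.mulVec, dotProduct, PiLp.inner_apply, RCLike.inner_apply, conj_trivial]
  refine Finset.sum_congr rfl fun i _ => ?_
  rw [Finset.sum_mul]
  exact Finset.sum_congr rfl fun j _ => by ring

theorem norm_toLp_eq {n : ℕ} (u : Fin n → ℝ) :
    ‖(WithLp.toLp 2 u : EuclideanSpace ℝ (Fin n))‖ = Real.sqrt (u ⬝ᵥ u) := by
  rw [EuclideanSpace.norm_eq]
  simp [dotProduct, pow_two]

/-- The bound `T` on the operator norm. -/
def OpBound {n : ℕ} (W : Matrix (Fin n) (Fin n) ℝ) (T : ℝ) : Prop :=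
  ∀ u v : Fin n → ℝ, bilin W u v ≤ T * (Real.sqrt (u ⬝ᵥ u) * Real.sqrt (v ⬝ᵥ v))

/-- Apply `norm_le_of_net` once in each argument of the bilinear form; each application doubles the
bound. -/
theorem opBound_of_net {n : ℕ} {N : Finset (EuclideanSpace ℝ (Fin n))}
    (hN : ∀ u : EuclideanSpace ℝ (Fin n), ‖u‖ ≤ 1 → ∃ c ∈ N, ‖u - c‖ ≤ 1 / 2)
    {W : Matrix (Fin n) (Fin n) ℝ} {T : ℝ}
    (hW : ∀ c ∈ N, ∀ d ∈ N, bilin W (WithLp.ofLp c) (WithLp.ofLp d) ≤ T) : OpBound W (4 * T) := by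
  have h1 : ∀ c ∈ N, ∀ v : Fin n → ℝ,
      bilin W (WithLp.ofLp c) v ≤ 2 * T * Real.sqrt (v ⬝ᵥ v) := by
    intro c hc v
    rw [bilin_comm, bilin_eq_inner]
    refine (real_inner_le_norm _ _).trans ?_
    rw [norm_toLp_eq v, mul_comm]
    gcongr
    refine norm_le_of_net hN fun d hd => ?_
    have := hW c hc d hd
    rw [bilin_comm, bilin_eq_inner] at this
    exact this
  intro u v
  rw [bilin_eq_inner]
  refine (real_inner_le_norm _ _).trans ?_
  have h2 : ‖(WithLp.toLp 2 (W.mulVec v) : EuclideanSpace ℝ (Fin n))‖ ≤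
      2 * (2 * T * Real.sqrt (v ⬝ᵥ v)) := by
    refine norm_le_of_net hN fun c hc => ?_
    have := h1 c hc v
    rw [bilin_eq_inner] at this
    exact this
  rw [norm_toLp_eq u]
  calc _ ≤ Real.sqrt (u ⬝ᵥ u) * (2 * (2 * T * Real.sqrt (v ⬝ᵥ v))) := by gcongr
    _ = _ := by ring

/-- Writes the form in the independent variables on and above the diagonal; the entries of `g` below
it receive coefficient `0`, so the full array can serve as the Gaussian family. -/
theorem bilin_symmFill {n : ℕ} (g : Fin n → Fin n → ℝ) (u v : Fin n → ℝ) :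
    bilin (symmFill g) u v = ∑ p : Fin n × Fin n,
      (if p.1 < p.2 then u p.1 * v p.2 + u p.2 * v p.1 else if p.1 = p.2 then u p.1 * v p.1 else 0)
        * g p.1 p.2 := by
  rw [Fintype.sum_prod_type]
  simp only
  rw [bilin, sum_sum_eq_diag_add_sum_Ioi, sum_sum_eq_diag_add_sum_Ioi]
  congr 1
  · refine Finset.sum_congr rfl fun i _ => ?_
    simp [symmFill_apply]
    ring
  · refine Finset.sum_congr rfl fun i _ => Finset.sum_congr rfl fun j hj => ?_
    have h : i < j := Finset.mem_Ioi.mp hj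
    simp only [symmFill_apply, h, h.le, h.not_gt, h.not_ge, h.ne', if_true, if_false]
    ring

theorem sum_symm_coeff_sq_le {n : ℕ} (u v : Fin n → ℝ) :
    ∑ p : Fin n × Fin n,
      (if p.1 < p.2 then u p.1 * v p.2 + u p.2 * v p.1 else if p.1 = p.2 then u p.1 * v p.1 else 0)
        ^ 2 ≤ 2 * ((u ⬝ᵥ u) * (v ⬝ᵥ v)) := by
  have h1 : (u ⬝ᵥ u) * (v ⬝ᵥ v) = ∑ i, ∑ j, u i ^ 2 * v j ^ 2 := by
    simp only [dotProduct, Finset.sum_mul_sum, pow_two]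
  rw [h1, Fintype.sum_prod_type]
  simp only
  rw [sum_sum_eq_diag_add_sum_Ioi, sum_sum_eq_diag_add_sum_Ioi, mul_add]
  refine add_le_add ?_ ?_
  · rw [Finset.mul_sum]
    refine Finset.sum_le_sum fun i _ => ?_
    simp only [lt_irrefl, if_true, if_false, mul_pow]
    have := mul_nonneg (sq_nonneg (u i)) (sq_nonneg (v i))
    linarith
  · simp only [Finset.mul_sum]
    refine Finset.sum_le_sum fun i _ => Finset.sum_le_sum fun j hj => ?_
    have h : i < j := Finset.mem_Ioi.mp hj
    simp only [h, h.not_gt, h.ne', if_true, if_false]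
    nlinarith [sq_nonneg (u i * v j - u j * v i)]

theorem measureReal_not_opBound_le {n : ℕ} {Ω : Type} [MeasurableSpace Ω] {μ : Measure Ω}
    [IsProbabilityMeasure μ] {v : NNReal} (hv : v ≠ 0) {ξ : Fin n × Fin n → Ω → ℝ}
    (h : IsGaussianFamily μ v ξ) :
    μ.real {ω | ¬ OpBound (symmFill fun i j => ξ (i, j) ω) (24 * Real.sqrt (v * n))} ≤
      Real.exp (-(5 * n)) := by
  rcases Nat.eq_zero_or_pos n with rfl | hn
  · simp only [Nat.cast_zero, mul_zero, neg_zero, Real.exp_zero]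
    exact measureReal_le_one
  have hn' : (0 : ℝ) < n := by exact_mod_cast hn
  have hv' : (0 : ℝ) < v := by exact_mod_cast pos_iff_ne_zero.mpr hv
  obtain ⟨N, hNc, hN1, hN⟩ := exists_half_net n
  -- A net bound of `6√(vn)` becomes `24√(vn)` for all vectors. The form at two net points has
  -- variance at most `2v`, so with `l = 3√(n/v)` the Chernoff exponent is `9n - 18n = -9n`. The
  -- `25ⁿ ≤ e^(4n)` pairs of net points leave `e^(-5n)`.
  set T := 6 * Real.sqrt (v * n) with hT
  have hsub : {ω | ¬ OpBound (symmFill fun i j => ξ (i, j) ω) (24 * Real.sqrt (v * n))} ⊆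
      ⋃ c ∈ N, ⋃ d ∈ N, {ω | T ≤ bilin (symmFill fun i j => ξ (i, j) ω)
        (WithLp.ofLp c) (WithLp.ofLp d)} := by
    intro ω hω
    by_contra hcon
    simp only [Set.mem_iUnion, not_exists, Set.mem_ofPred_eq, not_le] at hcon
    refine hω ?_
    have := opBound_of_net hN fun c hc d hd => (hcon c hc d hd).le
    rw [hT] at this
    convert this using 1
    ring
  have hpt : ∀ c ∈ N, ∀ d ∈ N, μ.real {ω | T ≤ bilin (symmFill fun i j => ξ (i, j) ω)
      (WithLp.ofLp c) (WithLp.ofLp d)} ≤ Real.exp (-(9 * n)) := by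
    intro c hc d hd
    simp only [bilin_symmFill]
    have hnorm : ∀ c ∈ N, WithLp.ofLp c ⬝ᵥ WithLp.ofLp c ≤ 1 := by
      intro c hc
      have h1 := hN1 c hc
      have h2 := norm_toLp_eq (WithLp.ofLp c)
      rw [WithLp.toLp_ofLp] at h2
      rw [h2] at h1
      rwa [Real.sqrt_le_one] at h1
    have hcoef := (sum_symm_coeff_sq_le (WithLp.ofLp c) (WithLp.ofLp d)).trans
      (b := _) (c := 2) (by
        have h1 := hnorm c hc
        have h2 := hnorm d hd
        have h0 : 0 ≤ WithLp.ofLp d ⬝ᵥ WithLp.ofLp d :=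
          Finset.sum_nonneg fun i _ => mul_self_nonneg _
        nlinarith)
    set l : ℝ := 3 * Real.sqrt (n / v) with hl
    have ht := h.tail_le _ hcoef (l := l) (by positivity) T
    refine ht.trans (Real.exp_le_exp.mpr (le_of_eq ?_))
    have h1 : l ^ 2 = 9 * (n / v) := by
      rw [hl, mul_pow, Real.sq_sqrt (by positivity)]; norm_num
    have h2 : l * T = 18 * n := by
      rw [hl, hT, mul_mul_mul_comm, ← Real.sqrt_mul (by positivity)]
      rw [show (n : ℝ) / v * (v * n) = n ^ 2 by field_simp, Real.sqrt_sq hn'.le]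
      norm_num
    rw [h1, h2]
    field_simp
    ring
  calc _ ≤ μ.real (⋃ c ∈ N, ⋃ d ∈ N, {ω | T ≤ bilin (symmFill fun i j => ξ (i, j) ω)
        (WithLp.ofLp c) (WithLp.ofLp d)}) :=
        measureReal_mono hsub (measure_ne_top _ _)
    _ ≤ ∑ c ∈ N, ∑ d ∈ N, Real.exp (-(9 * n)) := by
        refine (measureReal_biUnion_finset_le _ _).trans (Finset.sum_le_sum fun c hc => ?_)
        exact (measureReal_biUnion_finset_le _ _).trans (Finset.sum_le_sum fun d hd =>
          hpt c hc d hd)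
    _ = (N.card : ℝ) * N.card * Real.exp (-(9 * n)) := by
        simp [mul_assoc]
    _ ≤ Real.exp (2 * n) * Real.exp (2 * n) * Real.exp (-(9 * n)) := by
        have : (N.card : ℝ) ≤ Real.exp (2 * n) := by
          have h1 : (N.card : ℝ) ≤ 5 ^ n := by exact_mod_cast hNc
          refine h1.trans ?_
          rw [mul_comm, Real.exp_nat_mul]
          gcongr
          have := Real.exp_one_gt_d9
          rw [show (2 : ℝ) = 1 + 1 by norm_num, Real.exp_add]
          nlinarith
        gcongr
    _ = _ := by
        rw [← Real.exp_add, ← Real.exp_add]; ring_nf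

/-! ### The two sources of noise: the Gaussian array and the random tape -/

theorem isGaussianFamily_gaussianArray {n : ℕ} (v : ℝ) :
    IsGaussianFamily (gaussianArray n v) v.toNNReal
      fun (p : Fin n × Fin n) (g : Fin n → Fin n → ℝ) => g p.1 p.2 where
  measurable p := by fun_prop
  indep := by
    have := iIndepFun_uncurry_infinitePi' (X := fun (_ _ : Fin n) (x : ℝ) => x)
      (fun _ _ => gaussianReal 0 v.toNNReal) fun _ _ => measurable_id
    simpa [gaussianArray, Measure.infinitePi_eq_pi] using this
  law p := by
    have h1 := (measurePreserving_eval (fun _ : Fin n => Measure.pi fun _ : Fin n =>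
      gaussianReal 0 v.toNNReal) p.1).map_eq
    have h2 := (measurePreserving_eval (fun _ : Fin n => gaussianReal 0 v.toNNReal) p.2).map_eq
    rw [gaussianArray]
    conv_rhs => rw [← h2, ← h1]
    rw [Measure.map_map (by fun_prop) (by fun_prop)]
    rfl

instance {n : ℕ} (v : ℝ) : IsProbabilityMeasure (gaussianArray n v) := by
  unfold gaussianArray; infer_instance

instance : IsProbabilityMeasure tapeLaw := by
  unfold tapeLaw; infer_instance

/-- Injectivity of `f` means that distinct entries use distinct draws, hence independence. -/
theorem isGaussianFamily_tapeLaw {n : ℕ} {s v : ℝ} (hv : 0 ≤ v) (hs : s = Real.sqrt v)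
    {f : Fin n × Fin n → ℕ} (hf : Function.Injective f) :
    IsGaussianFamily tapeLaw v.toNNReal fun p w => s * w (f p) where
  measurable p := by fun_prop
  indep := by
    have h1 : iIndepFun (fun (k : ℕ) (w : ℕ → ℝ) => s * w k) tapeLaw :=
      iIndepFun_infinitePi (X := fun _ x => s * x) fun _ => measurable_const_mul _
    exact h1.precomp hf
  law p := by
    have h1 : tapeLaw.map (fun w => w (f p)) = gaussianReal 0 1 :=
      Measure.infinitePi_map_eval (fun _ : ℕ => gaussianReal 0 1) (f p)
    have h2 : (fun w : ℕ → ℝ => s * w (f p)) = (fun x => s * x) ∘ fun w => w (f p) := rfl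
    rw [h2, ← Measure.map_map (by fun_prop) (by fun_prop), h1, gaussianReal_map_const_mul]
    congr 1
    · simp
    · ext
      simp [hs, Real.sq_sqrt hv, hv]


/-! ## Rounding and utility -/

theorem quadForm_eq_bilin {n : ℕ} (M : Matrix (Fin n) (Fin n) ℝ) (u : Fin n → ℝ) :
    quadForm M u = bilin M u u := by
  simp only [quadForm, dotProduct, Matrix.mulVec, bilin, Finset.mul_sum, mul_assoc]

theorem quadForm_add {n : ℕ} (M N : Matrix (Fin n) (Fin n) ℝ) (u : Fin n → ℝ) :
    quadForm (M + N) u = quadForm M u + quadForm N u := by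
  simp only [quadForm, Matrix.add_mulVec, dotProduct_add]

theorem quadForm_eq_frobInner {n : ℕ} (M : Matrix (Fin n) (Fin n) ℝ) (u : Fin n → ℝ) :
    quadForm M u = frobInner M (Matrix.vecMulVec u u) := by
  rw [quadForm_eq_bilin]
  simp only [bilin, frobInner, Matrix.vecMulVec_apply]
  exact Finset.sum_congr rfl fun i _ => Finset.sum_congr rfl fun j _ => by ring

theorem frobInner_vecMulVec {n : ℕ} (u v : Fin n → ℝ) :
    frobInner (Matrix.vecMulVec u u) (Matrix.vecMulVec v v) = (u ⬝ᵥ v) ^ 2 := by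
  simp only [frobInner, Matrix.vecMulVec_apply, dotProduct, pow_two, Finset.sum_mul_sum]
  exact Finset.sum_congr rfl fun i _ => Finset.sum_congr rfl fun j _ => by ring

theorem frobSq_vecMulVec_sub {n : ℕ} {u v : Fin n → ℝ} (hu : u ⬝ᵥ u = 1) (hv : v ⬝ᵥ v = 1) :
    frobSq (Matrix.vecMulVec u u - Matrix.vecMulVec v v) = 2 * (1 - (u ⬝ᵥ v) ^ 2) := by
  rw [frobSq_sub, frobSq_eq_frobInner, frobSq_eq_frobInner, frobInner_vecMulVec,
    frobInner_vecMulVec, frobInner_vecMulVec, hu, hv]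
  ring

theorem dotProduct_sq_le_one {n : ℕ} {u v : Fin n → ℝ} (hu : u ⬝ᵥ u = 1) (hv : v ⬝ᵥ v = 1) :
    (u ⬝ᵥ v) ^ 2 ≤ 1 := by
  have h := frobSq_vecMulVec_sub hu hv
  have := frobSq_nonneg (Matrix.vecMulVec u u - Matrix.vecMulVec v v)
  linarith

/-- By symmetry the difference is `(u - v)ᵀ W (u + v)`, and `‖u - v‖ ‖u + v‖ = 2√(1 - ⟨u, v⟩²)` for
unit vectors. The factor that vanishes as `u → ±v` is why the noise enters the final error as `T²`
and not as `T`. -/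
theorem quadForm_sub_le_of_opBound {n : ℕ} {W : Matrix (Fin n) (Fin n) ℝ} {T : ℝ}
    (hW : OpBound W T) (hs : W.IsSymm) {u v : Fin n → ℝ} (hu : u ⬝ᵥ u = 1) (hv : v ⬝ᵥ v = 1) :
    quadForm W u - quadForm W v ≤ 2 * T * Real.sqrt (1 - (u ⬝ᵥ v) ^ 2) := by
  have h1 : quadForm W u - quadForm W v = bilin W (u - v) (u + v) := by
    rw [quadForm_eq_bilin, quadForm_eq_bilin]
    have hsw : bilin W u v = bilin W v u := by rw [bilin_comm, hs]
    have h2 : bilin W (u - v) (u + v) = bilin W u u + bilin W u v - bilin W v u - bilin W v v := by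
      simp only [bilin, Pi.sub_apply, Pi.add_apply, ← Finset.sum_add_distrib,
        ← Finset.sum_sub_distrib]
      exact Finset.sum_congr rfl fun i _ => Finset.sum_congr rfl fun j _ => by ring
    rw [h2, hsw]; ring
  rw [h1]
  refine (hW _ _).trans (le_of_eq ?_)
  have hc : v ⬝ᵥ u = u ⬝ᵥ v := dotProduct_comm _ _
  have e1 : (u - v) ⬝ᵥ (u - v) = 2 * (1 - u ⬝ᵥ v) := by
    simp only [sub_dotProduct, dotProduct_sub, hu, hv, hc]; ring
  have e2 : (u + v) ⬝ᵥ (u + v) = 2 * (1 + u ⬝ᵥ v) := by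
    simp only [add_dotProduct, dotProduct_add, hu, hv, hc]; ring
  have h0 : 0 ≤ (u - v) ⬝ᵥ (u - v) := Finset.sum_nonneg fun i _ => mul_self_nonneg _
  rw [← Real.sqrt_mul h0, e1, e2,
    show 2 * (1 - u ⬝ᵥ v) * (2 * (1 + u ⬝ᵥ v)) = 2 ^ 2 * (1 - (u ⬝ᵥ v) ^ 2) by ring,
    Real.sqrt_mul (by norm_num), Real.sqrt_sq (by norm_num)]
  ring

/-- The normalised label vector. -/
def unitVec {n : ℕ} (x : Labels n) : Fin n → ℝ := fun i => realVec x i / Real.sqrt n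

theorem unitVec_dotProduct_self {n : ℕ} (hn : 0 < n) (x : Labels n) :
    unitVec x ⬝ᵥ unitVec x = 1 := by
  have hn' : (0 : ℝ) < n := by exact_mod_cast hn
  simp only [unitVec, dotProduct, ← pow_two, div_pow, Real.sq_sqrt hn'.le, realVec_sq]
  simp [hn'.ne']

theorem truth_eq_vecMulVec {n : ℕ} (x : Labels n) :
    truth x = Matrix.vecMulVec (unitVec x) (unitVec x) := by
  ext i j
  simp only [truth, Matrix.of_apply, Matrix.vecMulVec_apply, unitVec, div_mul_div_comm]
  rw [Real.mul_self_sqrt (Nat.cast_nonneg n)]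

/-- At a coordinate with the wrong sign, `√n uᵢ` and `xᵢ` lie on opposite sides of `0`, so their
squared distance is at least `1`. A zero coordinate counts as positive and satisfies the same bound.
-/
theorem hammingDist_signVec_le {n : ℕ} (hn : 0 < n) (u : Fin n → ℝ) (x : Labels n) :
    (hammingDist (signVec u) x : ℝ) ≤ n * ((u - unitVec x) ⬝ᵥ (u - unitVec x)) := by
  have hn' : (0 : ℝ) < n := by exact_mod_cast hn
  have h1 : (hammingDist (signVec u) x : ℝ) = ∑ i, if signVec u i ≠ x i then (1 : ℝ) else 0 := by
    rw [hammingDist, Finset.card_filter]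
    push_cast
    rfl
  rw [h1, dotProduct, Finset.mul_sum]
  refine Finset.sum_le_sum fun i _ => ?_
  have hs : 0 < Real.sqrt n := Real.sqrt_pos.mpr hn'
  have hss : Real.sqrt n * Real.sqrt n = n := Real.mul_self_sqrt hn'.le
  split_ifs with h
  · have key : ∀ y : ℝ, (0 ≤ u i ∧ y = -1) ∨ (u i < 0 ∧ y = 1) → y = realVec x i →
        1 ≤ n * ((u - unitVec x) i * (u - unitVec x) i) := by
      intro y hy hyx
      have e : (n : ℝ) * ((u - unitVec x) i * (u - unitVec x) i) = (Real.sqrt n * u i - y) ^ 2 := by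
        have e2 : u i - y / Real.sqrt n = (Real.sqrt n * u i - y) / Real.sqrt n := by
          field_simp
        simp only [Pi.sub_apply, unitVec, ← hyx]
        rw [e2, div_mul_div_comm, hss, mul_div_cancel₀ _ hn'.ne', pow_two]
      rw [e]
      rcases hy with ⟨h0, rfl⟩ | ⟨h0, rfl⟩
      · have := mul_nonneg hs.le h0
        nlinarith
      · have := mul_pos hs (neg_pos.mpr h0)
        nlinarith
    refine key (realVec x i) ?_ rfl
    by_cases h0 : 0 ≤ u i
    · left
      refine ⟨h0, ?_⟩
      simp only [signVec, h0, if_true] at h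
      rcases Int.units_eq_one_or (x i) with hx | hx
      · exact absurd hx.symm h
      · simp [realVec, hx]
    · right
      refine ⟨not_le.mp h0, ?_⟩
      simp only [signVec, h0, if_false] at h
      rcases Int.units_eq_one_or (x i) with hx | hx
      · simp [realVec, hx]
      · exact absurd hx.symm h
  · exact mul_nonneg hn'.le (mul_self_nonneg _)

/-- Choose the sign of `x` for which `c = |⟨u, x/√n⟩|` is the correlation. The squared distance is
then `2(1 - c) ≤ 2(1 - c²)`, because `0 ≤ c ≤ 1`. -/
theorem err_signVec_le {n : ℕ} (hn : 0 < n) {u : Fin n → ℝ} (hu : u ⬝ᵥ u = 1) (x : Labels n) :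
    err (signVec u) x ≤ 2 * (1 - (u ⬝ᵥ unitVec x) ^ 2) := by
  have hn' : (0 : ℝ) < n := by exact_mod_cast hn
  have hneg : unitVec (-x) = -unitVec x := by
    funext i
    simp [unitVec, realVec, neg_div]
  set c := u ⬝ᵥ unitVec x with hc
  have hx := unitVec_dotProduct_self hn x
  have h1 : c ^ 2 ≤ 1 := dotProduct_sq_le_one hu hx
  have e : ∀ y : Labels n, unitVec y ⬝ᵥ unitVec y = 1 →
      (u - unitVec y) ⬝ᵥ (u - unitVec y) = 2 * (1 - u ⬝ᵥ unitVec y) := by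
    intro y hy
    simp only [sub_dotProduct, dotProduct_sub, hu, hy, dotProduct_comm (unitVec y) u]; ring
  unfold err
  rw [div_le_iff₀ hn']
  push_cast
  rcases le_total 0 c with h0 | h0
  · refine (min_le_left _ _).trans ((hammingDist_signVec_le hn u x).trans ?_)
    rw [e x hx]
    nlinarith [mul_nonneg hn'.le (show 0 ≤ c - c ^ 2 by nlinarith)]
  · refine (min_le_right _ _).trans ((hammingDist_signVec_le hn u (-x)).trans ?_)
    rw [e (-x) (unitVec_dotProduct_self hn _), hneg, dotProduct_neg, ← hc]
    nlinarith [mul_nonneg hn'.le (show 0 ≤ -c - c ^ 2 by nlinarith)]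

/-- Test the form on a column `z` and the corresponding basis vector: `‖z‖² ≤ T‖z‖`. -/
theorem frobSq_le_of_opBound {n : ℕ} {W : Matrix (Fin n) (Fin n) ℝ} {T : ℝ} (hT : 0 ≤ T)
    (hW : OpBound W T) : frobSq W ≤ n * T ^ 2 := by
  classical
  have h1 : ∀ j, ∑ i, W i j ^ 2 ≤ T ^ 2 := by
    intro j
    set z : Fin n → ℝ := fun i => W i j with hz
    have h2 := hW z (Pi.single j 1)
    have h3 : bilin W z (Pi.single j 1) = ∑ i, W i j ^ 2 := by
      simp only [bilin]
      refine Finset.sum_congr rfl fun i _ => ?_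
      rw [Finset.sum_eq_single j]
      · simp [hz, pow_two]
      · intro k _ hk; simp [hk]
      · simp
    have h4 : z ⬝ᵥ z = ∑ i, W i j ^ 2 := by simp [hz, dotProduct, pow_two]
    rw [h3, h4] at h2
    simp only [dotProduct_single, Pi.single_eq_same, mul_one, Real.sqrt_one] at h2
    set S := ∑ i, W i j ^ 2 with hS
    have hS0 : 0 ≤ S := Finset.sum_nonneg fun i _ => sq_nonneg _
    have h5 : Real.sqrt S * Real.sqrt S = S := Real.mul_self_sqrt hS0
    rcases eq_or_lt_of_le (Real.sqrt_nonneg S) with h6 | h6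
    · rw [← h6] at h5
      nlinarith
    · have h7 : Real.sqrt S ≤ T := by
        by_contra hcon
        push Not at hcon
        nlinarith
      nlinarith
  unfold frobSq
  rw [Finset.sum_comm]
  calc _ ≤ ∑ _j : Fin n, T ^ 2 := Finset.sum_le_sum fun j _ => h1 j
    _ = _ := by simp

theorem frobNorm_le_one_of_feasible {n : ℕ} {X : Matrix (Fin n) (Fin n) ℝ} (hX : X ∈ feasible n) :
    frobNorm X ≤ 1 := by
  refine Real.sqrt_le_one.mpr ?_
  rcases Nat.eq_zero_or_pos n with rfl | hn
  · simp [frobSq]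
  have hn' : (0 : ℝ) < n := by exact_mod_cast hn
  calc frobSq X ≤ ∑ _i : Fin n, ∑ _j : Fin n, (1 / n : ℝ) ^ 2 :=
        Finset.sum_le_sum fun i _ => Finset.sum_le_sum fun j _ =>
          sq_le_sq' (abs_le.mp (abs_apply_le_of_feasible hX i j)).1
            (abs_le.mp (abs_apply_le_of_feasible hX i j)).2
    _ = 1 := by
        simp only [Finset.sum_const, Finset.card_univ, Fintype.card_fin, nsmul_eq_mul]
        field_simp

/-- The approximate leading eigenvector of an approximate projection plus noise recovers the
labels. -/
theorem err_le_of_approx {n : ℕ} (hn : 0 < n) {x : Labels n} {a T : ℝ} (hT : 0 ≤ T)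
    {X₀ X₁ W : Matrix (Fin n) (Fin n) ℝ} (hX₀ : X₀ ∈ feasible n)
    (ha : frobSq (X₀ - truth x) ≤ a) (h1 : frobSq (X₁ - X₀) ≤ (1 / (n : ℝ)) ^ 2)
    (hWs : W.IsSymm) (hW : OpBound W T) {u : Fin n → ℝ} (hu : u ⬝ᵥ u = 1)
    (hmax : ∀ w : Fin n → ℝ, w ⬝ᵥ w = 1 →
      quadForm (X₁ + W) w ≤ quadForm (X₁ + W) u + (1 + Real.sqrt (frobSq (X₁ + W))) / n) :
    err (signVec u) x ≤ 50 * a + 80 * T ^ 2 + 100 / n := by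
  have hn' : (0 : ℝ) < n := by exact_mod_cast hn
  have hn1 : (1 : ℝ) ≤ n := by exact_mod_cast hn
  refine (err_signVec_le hn hu x).trans ?_
  set y := unitVec x with hy
  have hyy : y ⬝ᵥ y = 1 := unitVec_dotProduct_self hn x
  set r := 1 - (u ⬝ᵥ y) ^ 2 with hr
  have hr0 : 0 ≤ r := by linarith [dotProduct_sq_le_one hu hyy]
  set s := Real.sqrt r with hs
  have hs0 : 0 ≤ s := Real.sqrt_nonneg _
  have hs2 : s ^ 2 = r := Real.sq_sqrt hr0
  have ha0 : 0 ≤ a := (frobSq_nonneg _).trans ha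
  set α := Real.sqrt a with hα
  have hα0 : 0 ≤ α := Real.sqrt_nonneg _
  have hα2 : α ^ 2 = a := Real.sq_sqrt ha0
  set D := X₁ - truth x with hD
  have hinv : 1 / (n : ℝ) ≤ 1 := by rw [div_le_one hn']; exact hn1
  have hinv0 : 0 < 1 / (n : ℝ) := by positivity
  have hd1 : frobNorm (X₁ - X₀) ≤ 1 / n := Real.sqrt_le_iff.mpr ⟨hinv0.le, h1⟩
  have hDn : frobNorm D ≤ α + 1 / n := by
    have e : D = (X₁ - X₀) + (X₀ - truth x) := by rw [hD]; abel
    rw [e]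
    have := frobNorm_add_le (X₁ - X₀) (X₀ - truth x)
    have h3 : frobNorm (X₀ - truth x) ≤ α := Real.sqrt_le_sqrt ha
    linarith
  have hX1n : frobNorm X₁ ≤ 2 := by
    have e : X₁ = (X₁ - X₀) + X₀ := by abel
    rw [e]
    have := frobNorm_add_le (X₁ - X₀) X₀
    have := frobNorm_le_one_of_feasible hX₀
    linarith
  have hWn : frobNorm W ≤ Real.sqrt n * T := by
    rw [frobNorm, Real.sqrt_le_left (by positivity), mul_pow, Real.sq_sqrt hn'.le]
    exact frobSq_le_of_opBound hT hW
  have h2n : frobNorm (X₁ + W) ≤ 2 + Real.sqrt n * T := by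
    have := frobNorm_add_le X₁ W
    linarith
  -- The optimisation slack grows with `‖W‖_F ≤ √n T`, but division by `n` and `√n T ≤ 1 + nT²`
  -- reduce it to `O(1/n + T²)`.
  have hη : (1 + Real.sqrt (frobSq (X₁ + W))) / n ≤ 4 / n + T ^ 2 := by
    have h4 : Real.sqrt n * T ≤ 1 + n * T ^ 2 := by
      have : Real.sqrt n ^ 2 = n := Real.sq_sqrt hn'.le
      nlinarith [sq_nonneg (Real.sqrt n * T - 1)]
    rw [div_add' _ _ _ hn'.ne', div_le_div_iff_of_pos_right hn']
    have : Real.sqrt (frobSq (X₁ + W)) ≤ 2 + Real.sqrt n * T := h2n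
    linarith
  have hm := hmax y hyy
  rw [quadForm_add, quadForm_add] at hm
  have hWd := quadForm_sub_le_of_opBound hW hWs hu hyy
  have hXd : quadForm X₁ u - quadForm X₁ y =
      frobInner D (Matrix.vecMulVec u u - Matrix.vecMulVec y y) - r := by
    rw [quadForm_eq_frobInner, quadForm_eq_frobInner, hD, frobInner_sub_left, frobInner_sub_right,
      frobInner_sub_right, truth_eq_vecMulVec, frobInner_vecMulVec, frobInner_vecMulVec, ← hy, hyy,
      dotProduct_comm y u, hr]
    ring
  have hFD : frobInner D (Matrix.vecMulVec u u - Matrix.vecMulVec y y) ≤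
      (α + 1 / n) * (3 / 2 * s) := by
    refine (frobInner_le _ _).trans ?_
    have h5 : frobNorm (Matrix.vecMulVec u u - Matrix.vecMulVec y y) ≤ 3 / 2 * s := by
      rw [frobNorm, frobSq_vecMulVec_sub hu hyy, Real.sqrt_le_left (by positivity), mul_pow, hs2]
      linarith
    exact mul_le_mul hDn h5 (frobNorm_nonneg _) (by positivity)
  -- Near-optimality of `u` against the true direction `y`. The truth itself loses `s²` in passing
  -- from `y` to `u`; the projection error is paired with a matrix of norm `√2 s ≤ (3/2) s`.
  have hkey : s ^ 2 ≤ (α + 1 / n) * (3 / 2 * s) + 2 * T * s + (4 / n + T ^ 2) := by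
    rw [hs2]; linarith
  have hi2 : (1 / (n : ℝ)) ^ 2 ≤ 1 / n := by
    rw [pow_two]; exact mul_le_of_le_one_right hinv0.le hinv
  have e4 : 4 / (n : ℝ) = 4 * (1 / n) := by ring
  have e100 : 100 / (n : ℝ) = 100 * (1 / n) := by ring
  rw [e4] at hkey
  rw [e100, ← hs2, ← hα2]
  set w := 1 / (n : ℝ) with hw
  -- Young's inequality for `sα`, `s/n` and `sT`; the three products absorb `3/8` of `s²`.
  nlinarith [sq_nonneg (s - 6 * α), sq_nonneg (s - 6 * w), sq_nonneg (s - 8 * T), sq_nonneg s]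


/-! ### From a fixed graph to the success probability -/

theorem edgeProb_bounds {n : ℕ} {γ d : ℝ} (hn : 0 < n) (hγ : 0 < γ) (hd : 0 < d) (hγ1 : γ ≤ 1)
    (hdn : (1 + γ) * d ≤ n) (x : Labels n) (i j : Fin n) :
    (0 ≤ edgeProb γ d x i j ∧ edgeProb γ d x i j ≤ 1) ∧ edgeProb γ d x i j ≤ 2 * d / n := by
  have hn' : (0 : ℝ) < n := by exact_mod_cast hn
  have hγd := mul_pos hγ hd
  have h1 : 0 ≤ (1 - γ) * d := mul_nonneg (by linarith) hd.le
  unfold edgeProb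
  rw [div_le_div_iff_of_pos_right hn', div_le_one hn']
  rcases Int.units_eq_one_or (x i * x j) with h | h <;> rw [h] <;> push_cast
  · refine ⟨⟨div_nonneg (by nlinarith) hn'.le, by linarith⟩, by nlinarith⟩
  · refine ⟨⟨div_nonneg (by linarith) hn'.le, by linarith⟩, by linarith⟩

open Classical in
/-- An algorithm that adds Gaussian noise of variance `v` to an approximate projection and rounds
an approximate leading eigenvector recovers the labels. -/
theorem successProb_ge {n : ℕ} {γ d t : ℝ} (hn : 0 < n) (hγ : 0 < γ) (hd : 1 ≤ d) (hγ1 : γ ≤ 1)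
    (hdn : (1 + γ) * d ≤ n) (x : Labels n) {Ω : Type} [MeasurableSpace Ω] {μ : Measure Ω}
    [IsProbabilityMeasure μ] {v : NNReal} (hv : v ≠ 0) {ξ : Fin n × Fin n → Ω → ℝ}
    (h : IsGaussianFamily μ v ξ) {alg : SimpleGraph (Fin n) → Ω → Labels n}
    (halg : ∀ G ω, ∃ (X₁ : Matrix (Fin n) (Fin n) ℝ) (u : Fin n → ℝ),
      frobSq (X₁ - proj (rescaledAdj γ d G)) ≤ (1 / (n : ℝ)) ^ 2 ∧ u ⬝ᵥ u = 1 ∧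
      (∀ w : Fin n → ℝ, w ⬝ᵥ w = 1 →
        quadForm (X₁ + symmFill fun i j => ξ (i, j) ω) w ≤
          quadForm (X₁ + symmFill fun i j => ξ (i, j) ω) u +
            (1 + Real.sqrt (frobSq (X₁ + symmFill fun i j => ξ (i, j) ω))) / n) ∧
      alg G ω = signVec u)
    (ht : 50 * (3072 / (γ * Real.sqrt d)) + 80 * (576 * (v * n)) + 100 / n ≤ t) :
    1 - Real.exp (-n) ≤ successProb μ alg γ d x t := by
  have hn' : (0 : ℝ) < n := by exact_mod_cast hn
  have hd0 : 0 < d := by linarith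
  have hp := edgeProb_bounds hn hγ hd0 hγ1 hdn x
  set e5 := Real.exp (-(5 * n : ℝ)) with he5
  have hgood : ∀ G, CutBound γ d x G → 1 - e5 ≤ μ.real {ω | err (alg G ω) x ≤ t} := by
    intro G hG
    have hsub : {ω | err (alg G ω) x ≤ t}ᶜ ⊆
        {ω | ¬ OpBound (symmFill fun i j => ξ (i, j) ω) (24 * Real.sqrt (v * n))} := by
      intro ω hω
      simp only [Set.mem_compl_iff, Set.mem_ofPred_eq] at hω ⊢
      refine fun hW => hω ?_
      obtain ⟨X₁, u, h1, hu, hmax, hout⟩ := halg G ω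
      rw [hout]
      refine (err_le_of_approx hn (by positivity) (proj_mem _)
        (frobSq_proj_sub_truth_le hγ hd0 hG) h1 (symmFill_isSymm _) hW hu hmax).trans ?_
      rw [mul_pow, Real.sq_sqrt (by positivity)]
      refine le_trans (le_of_eq ?_) ht
      ring
    have h1 := (measureReal_mono hsub (measure_ne_top _ _)).trans (measureReal_not_opBound_le hv h)
    have h2 := measureReal_union_le (μ := μ) {ω | err (alg G ω) x ≤ t} {ω | err (alg G ω) x ≤ t}ᶜ
    rw [Set.union_compl_self, probReal_univ] at h2
    linarith
  have hbad := sum_sbmMass_not_cutBound_le hd (fun i j => (hp i j).1) fun i j => (hp i j).2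
  have hsum := sum_sbmMass (n := n) γ d x
  have hsplit : ∑ G : SimpleGraph (Fin n), (if CutBound γ d x G then sbmMass γ d x G else 0) =
      1 - ∑ G : SimpleGraph (Fin n), (if CutBound γ d x G then 0 else sbmMass γ d x G) := by
    rw [← hsum, ← Finset.sum_sub_distrib]
    refine Finset.sum_congr rfl fun G _ => ?_
    split_ifs <;> ring
  have he1 : e5 ≤ 1 := Real.exp_le_one_iff.mpr (by linarith)
  -- The graph fails with probability `e^(-2n)` and, independently, the noise with `e^(-5n)`; with
  -- `e^(-n) ≤ 1/2` both failures together fit into `e^(-n)`.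
  calc 1 - Real.exp (-n) ≤ (1 - Real.exp (-(2 * n))) * (1 - e5) := by
        set e1 := Real.exp (-(n : ℝ)) with hee
        have h2 : Real.exp (-(2 * n : ℝ)) = e1 ^ 2 := by
          rw [hee, ← Real.exp_nat_mul]; congr 1; push_cast; ring
        have h5 : e5 = e1 ^ 5 := by
          rw [hee, he5, ← Real.exp_nat_mul]; congr 1; push_cast; ring
        have h0 : 0 < e1 := Real.exp_pos _
        have hn1 : (1 : ℝ) ≤ n := by exact_mod_cast hn
        have hhalf : e1 ≤ 1 / 2 := by
          have h6 : e1 ≤ Real.exp (-1) := Real.exp_le_exp.mpr (by linarith)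
          have h7 : Real.exp (-1) ≤ 1 / 2 := by
            rw [Real.exp_neg, one_div]
            refine inv_anti₀ (by norm_num) ?_
            have := Real.add_one_le_exp (1 : ℝ)
            linarith
          linarith
        have h3 : e1 ^ 2 ≤ 1 / 2 * e1 := by nlinarith
        have h4 : e1 ^ 5 ≤ e1 ^ 2 := pow_le_pow_of_le_one h0.le (by linarith) (by norm_num)
        have h8 : 0 ≤ e1 ^ 2 * e1 ^ 5 := by positivity
        rw [h2, h5]
        nlinarith
    _ ≤ (∑ G : SimpleGraph (Fin n), (if CutBound γ d x G then sbmMass γ d x G else 0)) *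
          (1 - e5) := by
        gcongr
        linarith
    _ ≤ successProb μ alg γ d x t := by
        rw [successProb, Finset.sum_mul]
        refine Finset.sum_le_sum fun G _ => ?_
        have hm := sbmMass_nonneg (fun i j => (hp i j).1) G
        split_ifs with hG
        · exact mul_le_mul_of_nonneg_left (hgood G hG) hm
        · rw [zero_mul]
          exact mul_nonneg hm measureReal_nonneg


/-! ## Powers of positive definite matrices -/

/-- `Z + (1 + ‖Z‖_F) I`. -/
def shiftMat {n : ℕ} (Z : Matrix (Fin n) (Fin n) ℝ) : Matrix (Fin n) (Fin n) ℝ :=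
  Z + (1 + frobNorm Z) • (1 : Matrix (Fin n) (Fin n) ℝ)

theorem quadForm_shiftMat {n : ℕ} (Z : Matrix (Fin n) (Fin n) ℝ) (u : Fin n → ℝ) :
    quadForm (shiftMat Z) u = quadForm Z u + (1 + frobNorm Z) * (u ⬝ᵥ u) := by
  rw [shiftMat, quadForm_add]
  congr 1
  rw [quadForm, Matrix.smul_mulVec, Matrix.one_mulVec, dotProduct_smul, smul_eq_mul]

theorem frobNorm_vecMulVec {n : ℕ} (u : Fin n → ℝ) :
    frobNorm (Matrix.vecMulVec u u) = u ⬝ᵥ u := by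
  rw [frobNorm, frobSq_eq_frobInner, frobInner_vecMulVec, Real.sqrt_sq]
  exact Finset.sum_nonneg fun i _ => mul_self_nonneg _

theorem abs_quadForm_le {n : ℕ} (Z : Matrix (Fin n) (Fin n) ℝ) (u : Fin n → ℝ) :
    |quadForm Z u| ≤ frobNorm Z * (u ⬝ᵥ u) := by
  rw [quadForm_eq_frobInner, ← frobNorm_vecMulVec]
  exact abs_frobInner_le _ _

theorem shiftMat_isSymm {n : ℕ} {Z : Matrix (Fin n) (Fin n) ℝ} (hZ : Z.IsSymm) :
    (shiftMat Z).IsSymm := by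
  unfold shiftMat
  exact hZ.add (Matrix.isSymm_one.smul _)

/-- Spectral data of a symmetric matrix `B` with `B ⪰ I`. -/
structure SpectralData {n : ℕ} (B : Matrix (Fin n) (Fin n) ℝ) where
  U : Matrix (Fin n) (Fin n) ℝ
  ev : Fin n → ℝ
  top : Fin n
  mul_transpose : U * U.transpose = 1
  transpose_mul : U.transpose * U = 1
  eq : B = U * Matrix.diagonal ev * U.transpose
  one_le : ∀ i, 1 ≤ ev i
  le_top : ∀ i, ev i ≤ ev top

theorem exists_spectralData {n : ℕ} (hn : 0 < n) {B : Matrix (Fin n) (Fin n) ℝ} (hB : B.IsSymm)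
    (h1 : ∀ u, u ⬝ᵥ u ≤ quadForm B u) : Nonempty (SpectralData B) := by
  have hH : B.IsHermitian := by
    rw [Matrix.IsHermitian, Matrix.conjTranspose_eq_transpose_of_trivial]; exact hB
  set U : Matrix (Fin n) (Fin n) ℝ := ↑hH.eigenvectorUnitary with hU
  have hst : star U = U.transpose := by
    rw [Matrix.star_eq_conjTranspose, Matrix.conjTranspose_eq_transpose_of_trivial]
  have e1 : U * U.transpose = 1 := by
    rw [← hst]; exact Unitary.coe_mul_star_self _
  have e2 : U.transpose * U = 1 := by
    rw [← hst]; exact Unitary.coe_star_mul_self _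
  have e3 : B = U * Matrix.diagonal hH.eigenvalues * U.transpose := by
    have := hH.spectral_theorem
    rw [Unitary.conjStarAlgAut_apply] at this
    rw [← hst]
    exact this
  have : Nonempty (Fin n) := ⟨⟨0, hn⟩⟩
  obtain ⟨i₀, hi₀⟩ := Finite.exists_max hH.eigenvalues
  refine ⟨⟨U, hH.eigenvalues, i₀, e1, e2, e3, fun i => ?_, hi₀⟩⟩
  have hv := h1 (fun k => U k i)
  have hn1 : (fun k => U k i) ⬝ᵥ (fun k => U k i) = 1 := by
    have := congrFun (congrFun e2 i) i
    rw [Matrix.mul_apply] at this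
    simpa [dotProduct] using this
  have hBU : B * U = U * Matrix.diagonal hH.eigenvalues := by
    conv_lhs => rw [e3]
    rw [Matrix.mul_assoc, e2, Matrix.mul_one]
  have hmv : B.mulVec (fun k => U k i) = hH.eigenvalues i • fun k => U k i := by
    funext k
    have := congrFun (congrFun hBU k) i
    rw [Matrix.mul_apply, Matrix.mul_diagonal] at this
    simp only [Matrix.mulVec, dotProduct, Pi.smul_apply, smul_eq_mul]
    rw [this, mul_comm]
  rw [quadForm, hmv, dotProduct_smul, hn1] at hv
  simpa using hv

theorem one_le_shiftMat {n : ℕ} (Z : Matrix (Fin n) (Fin n) ℝ) (u : Fin n → ℝ) :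
    u ⬝ᵥ u ≤ quadForm (shiftMat Z) u := by
  rw [quadForm_shiftMat]
  linarith [(abs_le.mp (abs_quadForm_le Z u)).1]

namespace SpectralData

variable {n : ℕ} {B : Matrix (Fin n) (Fin n) ℝ} (S : SpectralData B)

theorem mul_U : B * S.U = S.U * Matrix.diagonal S.ev := by
  refine (congrArg (· * S.U) S.eq).trans ?_
  simp only [Matrix.mul_assoc]
  rw [S.transpose_mul, Matrix.mul_one]

theorem pow_eq (k : ℕ) : B ^ k = S.U * Matrix.diagonal (fun i => S.ev i ^ k) * S.U.transpose := by
  induction k with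
  | zero => simp [S.mul_transpose]
  | succ k ih =>
    rw [pow_succ, ih]
    refine (congrArg (_ * ·) S.eq).trans ?_
    have : S.U * Matrix.diagonal (fun i => S.ev i ^ k) * S.U.transpose *
        (S.U * Matrix.diagonal S.ev * S.U.transpose) =
        S.U * (Matrix.diagonal (fun i => S.ev i ^ k) * (S.U.transpose * S.U) *
          Matrix.diagonal S.ev) * S.U.transpose := by
      simp only [Matrix.mul_assoc]
    refine this.trans ?_
    rw [S.transpose_mul, Matrix.mul_one, Matrix.diagonal_mul_diagonal]
    simp only [pow_succ]

theorem pow_apply (k : ℕ) (i j : Fin n) :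
    (B ^ k) i j = ∑ l, S.U i l * S.ev l ^ k * S.U j l := by
  rw [S.pow_eq, Matrix.mul_apply]
  simp [Matrix.mul_diagonal]

theorem sum_U_sq (l : Fin n) : ∑ i, S.U i l * S.U i l = 1 := by
  have := congrFun (congrFun S.transpose_mul l) l
  rw [Matrix.mul_apply] at this
  simpa using this

theorem trace_weighted (p : Fin n → ℝ) : ∑ i, ∑ l, S.U i l * p l * S.U i l = ∑ l, p l := by
  rw [Finset.sum_comm]
  refine Finset.sum_congr rfl fun l _ => ?_
  have : ∀ i, S.U i l * p l * S.U i l = p l * (S.U i l * S.U i l) := fun i => by ring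
  simp only [this, ← Finset.mul_sum, S.sum_U_sq, mul_one]

theorem trace_pow (k : ℕ) : (B ^ k).trace = ∑ l, S.ev l ^ k := by
  simp only [Matrix.trace, Matrix.diag_apply, S.pow_apply]
  exact S.trace_weighted _

theorem quadForm_le (w : Fin n → ℝ) : quadForm B w ≤ S.ev S.top * (w ⬝ᵥ w) := by
  let z : Fin n → ℝ := S.U.transpose.mulVec w
  have h1 : quadForm B w = z ⬝ᵥ (Matrix.diagonal S.ev).mulVec z := by
    rw [quadForm]
    conv_lhs => rw [S.eq]
    simp only [z, ← Matrix.mulVec_mulVec, Matrix.dotProduct_mulVec, Matrix.mulVec_transpose]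
  have h2 : w ⬝ᵥ w = z ⬝ᵥ z := by
    have : z ⬝ᵥ z = w ⬝ᵥ (S.U * S.U.transpose).mulVec w := by
      simp only [z, ← Matrix.mulVec_mulVec, Matrix.dotProduct_mulVec, Matrix.mulVec_transpose]
    rw [this, S.mul_transpose, Matrix.one_mulVec]
  rw [h1, h2]
  simp only [dotProduct, Matrix.mulVec_diagonal, Finset.mul_sum]
  refine Finset.sum_le_sum fun i _ => ?_
  nlinarith [S.le_top i, mul_self_nonneg (z i)]

theorem trace_pow_pos (S : SpectralData B) (k : ℕ) : 0 < (B ^ k).trace := by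
  rw [S.trace_pow]
  exact Finset.sum_pos (fun l _ => pow_pos (by linarith [S.one_le l]) k) ⟨S.top, Finset.mem_univ _⟩

/-- A power method estimate without a spectral gap. The identity `Λ^(m+1) - λ^(m+1) = (Λ - λ) ∑ Λ^i
λ^(m-i)`, whose summands are at least `λ^m`, yields `(m+1) λ^m (Λ - λ) ≤ Λ^(m+1)`. Summing over the
`n` eigenvalues and using `Λ^m ≤ tr B^m` gives a relative error `n/(m+1)`. -/
theorem trace_pow_succ_ge (m : ℕ) :
    S.ev S.top * (B ^ m).trace ≤
      (B ^ (m + 1)).trace + n * S.ev S.top / (m + 1) * (B ^ m).trace := by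
  set Λ := S.ev S.top with hΛ
  have hΛ1 : 1 ≤ Λ := S.one_le _
  have hm : (0 : ℝ) < (m : ℝ) + 1 := by positivity
  have hterm : ∀ l, (m + 1) * (S.ev l ^ m * (Λ - S.ev l)) ≤ Λ ^ (m + 1) := by
    intro l
    have h0 : 0 ≤ S.ev l := by linarith [S.one_le l]
    have hle := S.le_top l
    have h1 : (Λ - S.ev l) * ((m + 1) * S.ev l ^ m) ≤
        (Λ - S.ev l) * ∑ i ∈ Finset.range (m + 1), Λ ^ i * S.ev l ^ (m + 1 - 1 - i) := by
      refine mul_le_mul_of_nonneg_left ?_ (by linarith)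
      have : ∑ _i ∈ Finset.range (m + 1), S.ev l ^ m = (m + 1) * S.ev l ^ m := by simp
      rw [← this]
      refine Finset.sum_le_sum fun i hi => ?_
      have hi' : i ≤ m := Nat.lt_succ_iff.mp (Finset.mem_range.mp hi)
      have e : m = i + (m + 1 - 1 - i) := by omega
      conv_lhs => rw [e, pow_add]
      gcongr
    have h2 := (Commute.all Λ (S.ev l)).mul_geom_sum₂ (m + 1)
    rw [h2] at h1
    have h3 : 0 ≤ S.ev l ^ (m + 1) := by positivity
    linarith
  have hsum : (m + 1) * (Λ * (B ^ m).trace - (B ^ (m + 1)).trace) ≤ n * Λ ^ (m + 1) := by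
    rw [S.trace_pow, S.trace_pow, Finset.mul_sum, ← Finset.sum_sub_distrib, Finset.mul_sum]
    calc _ ≤ ∑ _l : Fin n, Λ ^ (m + 1) := by
          refine Finset.sum_le_sum fun l _ => ?_
          refine le_trans (le_of_eq ?_) (hterm l)
          rw [pow_succ]; ring
      _ = _ := by simp
  have htr : Λ ^ m ≤ (B ^ m).trace := by
    rw [S.trace_pow]
    exact Finset.single_le_sum (f := fun l => S.ev l ^ m)
      (fun l _ => pow_nonneg (by linarith [S.one_le l]) m) (Finset.mem_univ S.top)
  have h4 : (n : ℝ) * Λ ^ (m + 1) ≤ n * Λ * (B ^ m).trace := by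
    rw [pow_succ]
    have : (n : ℝ) * (Λ ^ m * Λ) = n * Λ * Λ ^ m := by ring
    rw [this]
    gcongr
  rw [div_mul_eq_mul_div, ← sub_le_iff_le_add', le_div_iff₀ hm]
  linarith

theorem apply_self_pos (S : SpectralData B) (k : ℕ) (i : Fin n) : 0 < (B ^ k) i i := by
  rw [S.pow_apply]
  have hrow : ∑ l, S.U i l * S.U i l = 1 := by
    have := congrFun (congrFun S.mul_transpose i) i
    rw [Matrix.mul_apply] at this
    simpa using this
  have : ∑ l, S.U i l * S.U i l ≤ ∑ l, S.U i l * S.ev l ^ k * S.U i l := by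
    refine Finset.sum_le_sum fun l _ => ?_
    have h1 : 1 ≤ S.ev l ^ k := one_le_pow₀ (S.one_le l)
    nlinarith [mul_self_nonneg (S.U i l)]
  linarith

theorem pow_isSymm (S : SpectralData B) (k : ℕ) : (B ^ k).IsSymm := by
  refine Matrix.IsSymm.ext fun i j => ?_
  rw [S.pow_apply, S.pow_apply]
  exact Finset.sum_congr rfl fun l _ => by ring

theorem pow_posSemidef (S : SpectralData B) (k : ℕ) : (B ^ k).PosSemidef := by
  rw [S.pow_eq]
  have : (Matrix.diagonal fun i => S.ev i ^ k).PosSemidef :=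
    Matrix.PosSemidef.diagonal fun i => pow_nonneg (by linarith [S.one_le i]) k
  have h := this.mul_mul_conjTranspose_same S.U
  rwa [Matrix.conjTranspose_eq_transpose_of_trivial] at h

open Filter Topology in
/-- The normalised powers of `B` converge to a multiple of the projection onto the leading
eigenspace. -/
theorem exists_limit : ∃ L : Matrix (Fin n) (Fin n) ℝ,
    (∀ i j, Tendsto (fun k : ℕ => (B ^ k) i j / (B ^ k).trace) atTop (𝓝 (L i j))) ∧
    L.trace = 1 ∧ B * L = S.ev S.top • L := by
  set Λ := S.ev S.top with hΛ
  have hΛ1 : 1 ≤ Λ := S.one_le _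
  have hΛ0 : 0 < Λ := by linarith
  -- `χ` marks the eigenvalues equal to the largest one; after division by `Λ^k` exactly these
  -- survive in the limit, whatever their multiplicity.
  let χ : Fin n → ℝ := fun l => if S.ev l = Λ then 1 else 0
  have hχ0 : ∀ l, 0 ≤ χ l := fun l => by simp only [χ]; split_ifs <;> norm_num
  have hχs : 0 < ∑ l, χ l :=
    Finset.sum_pos' (fun l _ => hχ0 l) ⟨S.top, Finset.mem_univ _, by simp [χ, hΛ]⟩
  have hpow : ∀ l, Tendsto (fun k : ℕ => (S.ev l / Λ) ^ k) atTop (𝓝 (χ l)) := by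
    intro l
    simp only [χ]
    split_ifs with h
    · simp [h, hΛ0.ne']
    · refine tendsto_pow_atTop_nhds_zero_of_lt_one ?_ ?_
      · exact div_nonneg (by linarith [S.one_le l]) hΛ0.le
      · rw [div_lt_one hΛ0]
        exact lt_of_le_of_ne (S.le_top l) h
  have hsum : Tendsto (fun k : ℕ => ∑ l, (S.ev l / Λ) ^ k) atTop (𝓝 (∑ l, χ l)) :=
    tendsto_finsetSum _ fun l _ => hpow l
  refine ⟨Matrix.of fun i j => (∑ l, S.U i l * χ l * S.U j l) / ∑ l, χ l, ?_, ?_, ?_⟩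
  · intro i j
    have h1 : ∀ k : ℕ, (B ^ k) i j / (B ^ k).trace =
        (∑ l, S.U i l * (S.ev l / Λ) ^ k * S.U j l) / ∑ l, (S.ev l / Λ) ^ k := by
      intro k
      rw [S.pow_apply, S.trace_pow]
      have hk : (Λ ^ k)⁻¹ ≠ 0 := by positivity
      rw [← mul_div_mul_left _ _ hk, Finset.mul_sum, Finset.mul_sum]
      congr 1
      · refine Finset.sum_congr rfl fun l _ => ?_
        rw [div_pow]; ring
      · refine Finset.sum_congr rfl fun l _ => ?_
        rw [div_pow]; ring
    simp only [h1, Matrix.of_apply]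
    refine Tendsto.div ?_ hsum hχs.ne'
    exact tendsto_finsetSum _ fun l _ => ((hpow l).const_mul _).mul_const _
  · simp only [Matrix.trace, Matrix.diag_apply, Matrix.of_apply]
    rw [← Finset.sum_div, S.trace_weighted, div_self hχs.ne']
  · have hBU' : ∀ i l, ∑ m, B i m * S.U m l = S.U i l * S.ev l := by
      intro i l
      have := congrFun (congrFun S.mul_U i) l
      rwa [Matrix.mul_apply, Matrix.mul_diagonal] at this
    ext i j
    rw [Matrix.mul_apply]
    simp only [Matrix.of_apply, Matrix.smul_apply, smul_eq_mul]
    have h2 : ∀ m, B i m * ((∑ l, S.U m l * χ l * S.U j l) / ∑ l, χ l) =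
        (∑ l, B i m * S.U m l * (χ l * S.U j l)) / ∑ l, χ l := by
      intro m
      rw [mul_div_assoc', Finset.mul_sum]
      congr 1
      exact Finset.sum_congr rfl fun l _ => by ring
    simp only [h2]
    rw [← Finset.sum_div, Finset.sum_comm, mul_div_assoc', Finset.mul_sum]
    congr 1
    refine Finset.sum_congr rfl fun l _ => ?_
    rw [← Finset.sum_mul, hBU']
    simp only [χ]
    split_ifs with h
    · rw [h]; ring
    · ring

end SpectralData

/-! ### Approximate leading eigenvectors from matrix powers -/

/-- The largest eigenvalue of `shiftMat Z` is at most `1 + 2 ‖Z‖_F`. -/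
theorem SpectralData.ev_top_le {n : ℕ} {Z : Matrix (Fin n) (Fin n) ℝ}
    (S : SpectralData (shiftMat Z)) : S.ev S.top ≤ 1 + 2 * frobNorm Z := by
  set u : Fin n → ℝ := fun k => S.U k S.top with hu
  have hn1 : u ⬝ᵥ u = 1 := S.sum_U_sq S.top
  have hmv : (shiftMat Z).mulVec u = S.ev S.top • u := by
    funext k
    have := congrFun (congrFun S.mul_U k) S.top
    rw [Matrix.mul_apply, Matrix.mul_diagonal] at this
    simp only [Matrix.mulVec, dotProduct, Pi.smul_apply, smul_eq_mul, hu]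
    rw [this, mul_comm]
  have hq : quadForm (shiftMat Z) u = S.ev S.top := by
    rw [quadForm, hmv, dotProduct_smul, hn1, smul_eq_mul, mul_one]
  have h1 := quadForm_shiftMat Z u
  have h2 := (abs_le.mp (abs_quadForm_le Z u)).2
  rw [hn1] at h1 h2
  linarith

/-- Up to an explicit error the ratio of consecutive traces, minus the shift, dominates the top
eigenvalue of `Z`. The ratio is computable by additions and multiplications alone. -/
theorem quadForm_le_trace_ratio {n : ℕ} {Z : Matrix (Fin n) (Fin n) ℝ}
    (S : SpectralData (shiftMat Z)) (m : ℕ) (w : Fin n → ℝ) :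
    quadForm Z w ≤ ((shiftMat Z ^ (m + 1)).trace / (shiftMat Z ^ m).trace - (1 + frobNorm Z) +
      n * (1 + 2 * frobNorm Z) / (m + 1)) * (w ⬝ᵥ w) := by
  have h1 := S.quadForm_le w
  rw [quadForm_shiftMat] at h1
  have hw : 0 ≤ w ⬝ᵥ w := Finset.sum_nonneg fun i _ => mul_self_nonneg _
  have htr := S.trace_pow_pos m
  have h2 : S.ev S.top ≤ (shiftMat Z ^ (m + 1)).trace / (shiftMat Z ^ m).trace +
      n * (1 + 2 * frobNorm Z) / (m + 1) := by
    have h3 := S.trace_pow_succ_ge m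
    rw [← le_div_iff₀ htr, add_div, mul_div_cancel_right₀ _ htr.ne'] at h3
    refine h3.trans ?_
    gcongr
    exact S.ev_top_le
  nlinarith

theorem frobInner_eq_trace {n : ℕ} {A : Matrix (Fin n) (Fin n) ℝ} (hA : A.IsSymm)
    (B : Matrix (Fin n) (Fin n) ℝ) : frobInner A B = (A * B).trace := by
  simp only [frobInner, Matrix.trace, Matrix.diag_apply, Matrix.mul_apply]
  rw [Finset.sum_comm]
  exact Finset.sum_congr rfl fun i _ => Finset.sum_congr rfl fun j _ => by rw [hA.apply]

theorem frobInner_one {n : ℕ} (A : Matrix (Fin n) (Fin n) ℝ) :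
    frobInner (1 : Matrix (Fin n) (Fin n) ℝ) A = A.trace := by
  rw [frobInner_eq_trace Matrix.isSymm_one, Matrix.one_mul]

/-- A positive semidefinite `X` is a sum of matrices `c cᵀ`, and its trace is the sum of the `‖c‖²`.
-/
theorem frobInner_le_mul_trace {n : ℕ} {Z X : Matrix (Fin n) (Fin n) ℝ} {c : ℝ}
    (hZ : ∀ w, quadForm Z w ≤ c * (w ⬝ᵥ w)) (hX : X.PosSemidef) :
    frobInner Z X ≤ c * X.trace := by
  obtain ⟨C, hC⟩ := exists_conjTranspose_mul_self hX
  have hXC : ∀ i j, X i j = ∑ k, C k i * C k j := by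
    intro i j
    rw [hC]
    simp [Matrix.mul_apply]
  have h1 : frobInner Z X = ∑ k, quadForm Z (C k) := by
    simp only [frobInner, hXC, quadForm_eq_bilin, bilin, Finset.mul_sum]
    rw [Finset.sum_congr rfl fun i _ => Finset.sum_comm, Finset.sum_comm]
    exact Finset.sum_congr rfl fun k _ => Finset.sum_congr rfl fun i _ =>
      Finset.sum_congr rfl fun j _ => by ring
  have h2 : X.trace = ∑ k, C k ⬝ᵥ C k := by
    simp only [Matrix.trace, Matrix.diag_apply, hXC, dotProduct]
    rw [Finset.sum_comm]
  rw [h1, h2, Finset.mul_sum]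
  exact Finset.sum_le_sum fun k _ => hZ _

/-- The normalised power nearly maximises `⟨Z, ·⟩` over the spectrahedron, as its value is exactly
the trace ratio minus the shift. It is the linear oracle of the Frank-Wolfe method. -/
theorem frobInner_le_power {n : ℕ} {Z X : Matrix (Fin n) (Fin n) ℝ} (hZ : Z.IsSymm)
    (S : SpectralData (shiftMat Z)) (m : ℕ) (hX : X.PosSemidef) (hX1 : X.trace = 1) :
    frobInner Z X ≤ frobInner Z ((1 / (shiftMat Z ^ m).trace) • shiftMat Z ^ m) +
      n * (1 + 2 * frobNorm Z) / (m + 1) := by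
  have h1 := frobInner_le_mul_trace (quadForm_le_trace_ratio S m) hX
  rw [hX1, mul_one] at h1
  refine h1.trans (le_of_eq ?_)
  have htr := (S.trace_pow_pos m).ne'
  have h2 : frobInner Z (shiftMat Z ^ m) = (shiftMat Z ^ (m + 1)).trace -
      (1 + frobNorm Z) * (shiftMat Z ^ m).trace := by
    have e : Z = shiftMat Z - (1 + frobNorm Z) • 1 := by simp [shiftMat]
    conv_lhs => rw [e]
    rw [frobInner_sub_left, frobInner_smul_left, frobInner_one,
      frobInner_eq_trace (shiftMat_isSymm hZ), pow_succ', ← e]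
  rw [frobInner_smul_right, h2]
  field_simp

/-- The best normalised column of a power of `shiftMat Z` is an approximate leading eigenvector. -/
theorem quadForm_le_best_column {n : ℕ} {Z : Matrix (Fin n) (Fin n) ℝ}
    (S : SpectralData (shiftMat Z)) (k : ℕ) {b : Fin n}
    (hb : ∀ i, (shiftMat Z ^ (2 * k) * shiftMat Z) i i / (shiftMat Z ^ (2 * k)) i i ≤
      (shiftMat Z ^ (2 * k) * shiftMat Z) b b / (shiftMat Z ^ (2 * k)) b b) :
    ∃ u : Fin n → ℝ, u ⬝ᵥ u = 1 ∧ signVec u = signVec (fun i => (shiftMat Z ^ k) i b) ∧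
      ∀ w, w ⬝ᵥ w = 1 →
        quadForm Z w ≤ quadForm Z u + n * (1 + 2 * frobNorm Z) / (2 * k + 1) := by
  set B := shiftMat Z with hB
  set Q := B ^ (2 * k) with hQ
  have hQpos : ∀ i, 0 < Q i i := S.apply_self_pos (2 * k)
  have hRR : Q = B ^ k * B ^ k := by rw [hQ, two_mul, pow_add]
  have hsymm := S.pow_isSymm k
  let r : Fin n → ℝ := fun i => (B ^ k) i b
  have hrr : r ⬝ᵥ r = Q b b := by
    rw [hRR, Matrix.mul_apply]
    exact Finset.sum_congr rfl fun i _ => by simp only [r]; rw [hsymm.apply]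
  have hBr : quadForm B r = (Q * B) b b := by
    have : Q * B = B ^ k * (B * B ^ k) := by
      rw [hRR, Matrix.mul_assoc, ← pow_succ, ← pow_succ']
    rw [this, Matrix.mul_apply, quadForm, dotProduct]
    refine Finset.sum_congr rfl fun i _ => ?_
    simp only [r, Matrix.mulVec, dotProduct]
    rw [Matrix.mul_apply, hsymm.apply]
  set q := Real.sqrt (Q b b) with hq
  have hq0 : 0 < q := Real.sqrt_pos.mpr (hQpos b)
  have hqq : q * q = Q b b := Real.mul_self_sqrt (hQpos b).le
  have hqf : quadForm B (q⁻¹ • r) = (Q * B) b b / Q b b := by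
    rw [quadForm, Matrix.mulVec_smul, smul_dotProduct, dotProduct_smul, ← quadForm, hBr, ← hqq]
    simp only [smul_eq_mul]
    field_simp
  have hu1 : (q⁻¹ • r) ⬝ᵥ (q⁻¹ • r) = 1 := by
    rw [smul_dotProduct, dotProduct_smul, hrr, ← hqq]
    simp only [smul_eq_mul]
    field_simp
  refine ⟨q⁻¹ • r, hu1, ?_, fun w hw => ?_⟩
  · funext i
    simp only [signVec, Pi.smul_apply, smul_eq_mul, r]
    congr 1
    rw [eq_iff_iff, mul_nonneg_iff_of_pos_left (by positivity)]
  · have h1 := quadForm_le_trace_ratio S (2 * k) w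
    rw [hw, mul_one] at h1
    have h2 := quadForm_shiftMat Z (q⁻¹ • r)
    rw [← hB, hqf, hu1, mul_one] at h2
    have htr : 0 < Q.trace := S.trace_pow_pos (2 * k)
    -- The trace ratio is a weighted mean of the diagonal ratios, so the largest one is at least as
    -- big. The diagonal ratio at `b` is the Rayleigh quotient of column `b` of `B ^ k`.
    have h3 : (B ^ (2 * k + 1)).trace / Q.trace ≤ (Q * B) b b / Q b b := by
      rw [div_le_iff₀ htr, pow_succ, ← hQ]
      simp only [Matrix.trace, Matrix.diag_apply, Finset.mul_sum]
      refine Finset.sum_le_sum fun i _ => ?_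
      have := hb i
      rwa [div_le_iff₀ (hQpos i)] at this
    push_cast at h1
    linarith

theorem measurable_shiftMat_pow {n : ℕ} (k : ℕ) :
    ∀ i j, Measurable fun X : Fin n → Fin n → ℝ => (shiftMat (Matrix.of X) ^ k) i j := by
  induction k with
  | zero => intro i j; simp
  | succ k ih =>
    intro i j
    simp only [pow_succ, Matrix.mul_apply]
    refine Finset.measurable_fun_sum _ fun l _ => (ih i l).mul ?_
    simp only [shiftMat, Matrix.add_apply, Matrix.smul_apply, Matrix.of_apply, frobNorm, frobSq]
    fun_prop

/-- The limit `L` of the normalised powers is measurable in `X` as a pointwise limit. Its nonzero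
columns are leading eigenvectors, and trace `1` guarantees a nonzero diagonal entry; the rule takes
the first such column. Precomposing with `symmFill` defines the rule on all matrices without
affecting symmetric ones. -/
theorem exists_leadingEigenvectorRule {n : ℕ} (hn : 0 < n) :
    ∃ v, IsLeadingEigenvectorRule n v := by
  have hS : ∀ X : Fin n → Fin n → ℝ, Nonempty (SpectralData (shiftMat (symmFill X))) := fun X =>
    exists_spectralData hn (shiftMat_isSymm (symmFill_isSymm X)) (one_le_shiftMat _)
  choose L hlim htr hBL using fun X => (hS X).some.exists_limit
  have hLm : ∀ i j, Measurable fun X => L X i j := by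
    intro i j
    refine measurable_of_tendsto_metrizable (f := fun (k : ℕ) X =>
      (shiftMat (symmFill X) ^ k) i j / (shiftMat (symmFill X) ^ k).trace) (fun k => ?_) ?_
    · have h1 : ∀ i j, Measurable fun X : Fin n → Fin n → ℝ => (shiftMat (symmFill X) ^ k) i j :=
        fun i j => (measurable_shiftMat_pow k i j).comp measurable_symmFill
      refine (h1 i j).div ?_
      simp only [Matrix.trace, Matrix.diag_apply]
      exact Finset.measurable_fun_sum _ fun l _ => h1 l l
    · rw [tendsto_pi_nhds]
      exact fun X => hlim X i j
  let first : (Fin n → Fin n → ℝ) → Fin n → Prop := fun X j =>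
    L X j j ≠ 0 ∧ ∀ k, k < j → L X k k = 0
  have hfm : ∀ j, MeasurableSet {X | first X j} := by
    intro j
    simp only [first]
    measurability
  classical
  let v : (Fin n → Fin n → ℝ) → Fin n → ℝ := fun X i => ∑ j, if first X j then L X i j else 0
  refine ⟨v, ?_, ?_⟩
  · refine measurable_pi_lambda _ fun i => Finset.measurable_fun_sum _ fun j _ => ?_
    exact Measurable.ite (hfm j) (hLm i j) measurable_const
  · intro X hX
    have hex : ∃ j, L X j j ≠ 0 := by
      by_contra hcon
      push Not at hcon
      have := htr X
      simp [Matrix.trace, hcon] at this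
    obtain ⟨j, hj⟩ : ∃ j, first X j := by
      let p : Finset (Fin n) := Finset.univ.filter fun j => L X j j ≠ 0
      have hp : p.Nonempty := by
        obtain ⟨j, hj⟩ := hex
        exact ⟨j, by simp [p, hj]⟩
      refine ⟨p.min' hp, ?_, fun k hk => ?_⟩
      · have := p.min'_mem hp
        simpa [p] using this
      · by_contra hne
        have := p.min'_le k (by simp [p, hne])
        exact absurd hk (not_lt.mpr this)
    have huniq : ∀ k, first X k ↔ k = j := by
      intro k
      constructor
      · intro hk
        rcases lt_trichotomy k j with h | h | h
        · exact absurd (hj.2 k h) hk.1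
        · exact h
        · exact absurd (hk.2 j h) hj.1
      · rintro rfl; exact hj
    have hv : v X = fun i => L X i j := by
      funext i
      simp [v, huniq]
    rw [hv]
    have hXs : symmFill X = X := symmFill_of_isSymm hX
    obtain ⟨l, hl1, hl2⟩ : ∃ l : ℝ, (shiftMat (symmFill X)).mulVec (fun i => L X i j) =
        (l • fun i => L X i j) ∧ ∀ u, quadForm (shiftMat (symmFill X)) u ≤ l * (u ⬝ᵥ u) := by
      refine ⟨_, ?_, fun u => (hS X).some.quadForm_le u⟩
      funext i
      have := congrFun (congrFun (hBL X) i) j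
      rwa [Matrix.mul_apply] at this
    rw [hXs] at hl1 hl2
    refine ⟨fun h => hj.1 (congrFun h j), l - (1 + frobNorm X), ?_, fun u => ?_⟩
    · have h2 : (shiftMat X).mulVec (fun i => L X i j) = Matrix.mulVec X (fun i => L X i j) +
          (1 + frobNorm X) • fun i => L X i j := by
        rw [shiftMat, Matrix.add_mulVec, Matrix.smul_mulVec, Matrix.one_mulVec]
      rw [h2] at hl1
      rw [sub_smul, ← hl1]
      abel
    · have h1 := hl2 u
      rw [quadForm_shiftMat] at h1
      linarith


/-! ## The Frank-Wolfe method for the penalised projection problem -/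

/-- The deviation of the diagonal from `1 / n`, as a diagonal matrix. -/
def diagDev {n : ℕ} (X : Matrix (Fin n) (Fin n) ℝ) : Matrix (Fin n) (Fin n) ℝ :=
  Matrix.diagonal fun i => X i i - 1 / n

/-- Half the negative gradient of `fwObj`. -/
def negGrad {n : ℕ} (M : ℝ) (Y X : Matrix (Fin n) (Fin n) ℝ) : Matrix (Fin n) (Fin n) ℝ :=
  Y - X - M • diagDev X

/-- The penalised objective `‖Y - X‖_F² + M ∑ᵢ (Xᵢᵢ - 1/n)²`. -/
def fwObj {n : ℕ} (M : ℝ) (Y X : Matrix (Fin n) (Fin n) ℝ) : ℝ :=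
  frobSq (Y - X) + M * frobSq (diagDev X)

/-- An approximate maximiser of `⟨Z, ·⟩` over the spectrahedron: a normalised matrix power. -/
def lmo {n : ℕ} (k : ℕ) (Z : Matrix (Fin n) (Fin n) ℝ) : Matrix (Fin n) (Fin n) ℝ :=
  (1 / (shiftMat Z ^ (2 * k)).trace) • shiftMat Z ^ (2 * k)

/-- The Frank-Wolfe iterates, from `0`. -/
def fwIter {n : ℕ} (M : ℝ) (k : ℕ) (Y : Matrix (Fin n) (Fin n) ℝ) : ℕ → Matrix (Fin n) (Fin n) ℝ
  | 0 => 0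
  | t + 1 => fwIter M k Y t +
      (2 / ((t : ℝ) + 2)) • (lmo k (negGrad M Y (fwIter M k Y t)) - fwIter M k Y t)

theorem frobSq_diagonal_le {n : ℕ} (D : Matrix (Fin n) (Fin n) ℝ) :
    frobSq (Matrix.diagonal fun i => D i i) ≤ frobSq D := by
  refine Finset.sum_le_sum fun i _ => Finset.sum_le_sum fun j _ => ?_
  by_cases h : i = j
  · subst h; simp
  · simp [h, sq_nonneg]

theorem frobInner_diagonal {n : ℕ} (a : Fin n → ℝ) (D : Matrix (Fin n) (Fin n) ℝ) :
    frobInner (Matrix.diagonal a) D = ∑ i, a i * D i i := by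
  refine Finset.sum_congr rfl fun i _ => ?_
  rw [Finset.sum_eq_single i]
  · simp
  · intro j _ hj; simp [hj.symm]
  · simp

/-- The objective is quadratic, so its expansion along a line is exact. It yields the convexity
inequality as well as the curvature term of the Frank-Wolfe analysis. -/
theorem fwObj_add_smul {n : ℕ} (M : ℝ) (Y X D : Matrix (Fin n) (Fin n) ℝ) (η : ℝ) :
    fwObj M Y (X + η • D) = fwObj M Y X - 2 * η * frobInner (negGrad M Y X) D +
      η ^ 2 * (frobSq D + M * frobSq (Matrix.diagonal fun i => D i i)) := by
  have h1 : diagDev (X + η • D) = diagDev X + η • Matrix.diagonal fun i => D i i := by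
    ext i j
    by_cases h : i = j
    · subst h; simp [diagDev]; ring
    · simp [diagDev, h]
  have h2 : frobInner (diagDev X) (Matrix.diagonal fun i => D i i) = frobInner (diagDev X) D := by
    rw [diagDev, frobInner_diagonal, frobInner_diagonal]; simp
  unfold fwObj negGrad
  rw [h1, show Y - (X + η • D) = (Y - X) - η • D by abel, frobSq_sub (Y - X), frobSq_add,
    frobSq_smul, frobSq_smul, frobInner_smul_right, frobInner_smul_right, h2,
    frobInner_sub_left (Y - X), frobInner_smul_left]
  ring

theorem diagDev_eq_zero {n : ℕ} {X : Matrix (Fin n) (Fin n) ℝ} (hX : X ∈ feasible n) :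
    diagDev X = 0 := by
  ext i j
  by_cases h : i = j
  · subst h; simp [diagDev, hX.2]
  · simp [diagDev, h]

theorem trace_eq_one_of_feasible {n : ℕ} (hn : 0 < n) {X : Matrix (Fin n) (Fin n) ℝ}
    (hX : X ∈ feasible n) : X.trace = 1 := by
  have hn' : (n : ℝ) ≠ 0 := by exact_mod_cast hn.ne'
  simp [Matrix.trace, hX.2, hn']

theorem frobNorm_le_one_of_posSemidef {n : ℕ} {X : Matrix (Fin n) (Fin n) ℝ} (hX : X.PosSemidef)
    (h1 : X.trace = 1) : frobNorm X ≤ 1 := by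
  refine Real.sqrt_le_one.mpr ?_
  calc frobSq X ≤ ∑ i, ∑ j, X i i * X j j :=
        Finset.sum_le_sum fun i _ => Finset.sum_le_sum fun j _ => abs_apply_le_of_posSemidef hX i j
    _ = X.trace * X.trace := by
        simp only [Matrix.trace, Matrix.diag_apply, Finset.sum_mul_sum]
    _ = 1 := by rw [h1, one_mul]

theorem isSymm_of_posSemidef {n : ℕ} {X : Matrix (Fin n) (Fin n) ℝ} (hX : X.PosSemidef) :
    X.IsSymm := by
  have := hX.1
  rwa [Matrix.IsHermitian, Matrix.conjTranspose_eq_transpose_of_trivial] at this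

theorem spectralData_shiftMat {n : ℕ} (hn : 0 < n) {Z : Matrix (Fin n) (Fin n) ℝ} (hZ : Z.IsSymm) :
    Nonempty (SpectralData (shiftMat Z)) :=
  exists_spectralData hn (shiftMat_isSymm hZ) (one_le_shiftMat _)

theorem lmo_posSemidef {n : ℕ} (hn : 0 < n) (k : ℕ) {Z : Matrix (Fin n) (Fin n) ℝ}
    (hZ : Z.IsSymm) : (lmo k Z).PosSemidef ∧ (lmo k Z).trace = 1 := by
  obtain ⟨S⟩ := spectralData_shiftMat hn hZ
  have h0 := S.trace_pow_pos (2 * k)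
  refine ⟨(S.pow_posSemidef _).smul (by positivity), ?_⟩
  rw [lmo, Matrix.trace_smul, smul_eq_mul, one_div, inv_mul_cancel₀ h0.ne']

theorem diagDev_isSymm {n : ℕ} (X : Matrix (Fin n) (Fin n) ℝ) : (diagDev X).IsSymm :=
  Matrix.isSymm_diagonal _

theorem negGrad_isSymm {n : ℕ} (M : ℝ) {Y X : Matrix (Fin n) (Fin n) ℝ} (hY : Y.IsSymm)
    (hX : X.IsSymm) : (negGrad M Y X).IsSymm :=
  (hY.sub hX).sub ((diagDev_isSymm X).smul M)

theorem frobNorm_diagDev_le {n : ℕ} {X : Matrix (Fin n) (Fin n) ℝ} (hX : frobNorm X ≤ 1) :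
    frobNorm (diagDev X) ≤ 2 := by
  have h1 : diagDev X = (Matrix.diagonal fun i => X i i) -
      Matrix.diagonal fun _ : Fin n => (1 / n : ℝ) := by
    rw [Matrix.diagonal_sub]; rfl
  have h2 : frobNorm (Matrix.diagonal fun i => X i i) ≤ 1 :=
    (Real.sqrt_le_sqrt (frobSq_diagonal_le X)).trans hX
  have h3 : frobNorm (Matrix.diagonal fun _ : Fin n => (1 / n : ℝ)) ≤ 1 := by
    refine frobNorm_le_one_of_feasible ⟨Matrix.PosSemidef.diagonal fun i => ?_, fun i => by simp⟩
    show (0 : ℝ) ≤ 1 / n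
    positivity
  rw [h1]
  linarith [frobNorm_sub_le (Matrix.diagonal fun i => X i i)
    (Matrix.diagonal fun _ : Fin n => (1 / n : ℝ))]

theorem frobNorm_le_of_abs_le_one {n : ℕ} {Y : Matrix (Fin n) (Fin n) ℝ}
    (hY : ∀ i j, |Y i j| ≤ 1) : frobNorm Y ≤ n := by
  refine Real.sqrt_le_iff.mpr ⟨by positivity, ?_⟩
  calc frobSq Y ≤ ∑ _i : Fin n, ∑ _j : Fin n, (1 : ℝ) :=
        Finset.sum_le_sum fun i _ => Finset.sum_le_sum fun j _ =>
          (sq_le_one_iff_abs_le_one _).mpr (hY i j)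
    _ = _ := by simp [pow_two]

/-- Iterate `0` is the zero matrix and has trace `0`, so the spectrahedron is entered only at
iterate `1`: the first step has length `2/2 = 1` and lands on the oracle's answer. Later steps are
convex combinations. -/
theorem fwIter_invariant {n : ℕ} (hn : 0 < n) (M : ℝ) (k : ℕ) {Y : Matrix (Fin n) (Fin n) ℝ}
    (hY : Y.IsSymm) (t : ℕ) :
    (fwIter M k Y t).IsSymm ∧ frobNorm (fwIter M k Y t) ≤ 1 ∧
      (fwIter M k Y (t + 1)).PosSemidef ∧ (fwIter M k Y (t + 1)).trace = 1 := by
  induction t with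
  | zero =>
    have h0 : (0 : Matrix (Fin n) (Fin n) ℝ).IsSymm := Matrix.isSymm_zero
    have h1 := lmo_posSemidef hn k (negGrad_isSymm M hY h0)
    refine ⟨h0, by simp [fwIter, frobNorm, frobSq], ?_⟩
    have : fwIter M k Y (0 + 1) = lmo k (negGrad M Y 0) := by
      simp [fwIter]
    rw [this]
    exact h1
  | succ t ih =>
    have hs := isSymm_of_posSemidef ih.2.2.1
    refine ⟨hs, frobNorm_le_one_of_posSemidef ih.2.2.1 ih.2.2.2, ?_⟩
    obtain ⟨h1, h2⟩ := lmo_posSemidef hn k (negGrad_isSymm M hY hs)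
    set X := fwIter M k Y (t + 1) with hX
    set η : ℝ := 2 / (((t + 1 : ℕ) : ℝ) + 2) with hη
    have hη0 : 0 ≤ η := by positivity
    have hη1 : η ≤ 1 := by
      rw [hη, div_le_one (by positivity)]
      push_cast
      linarith [(Nat.cast_nonneg t : (0 : ℝ) ≤ t)]
    have e : fwIter M k Y (t + 1 + 1) = (1 - η) • X + η • lmo k (negGrad M Y X) := by
      show X + η • (lmo k (negGrad M Y X) - X) = _
      rw [smul_sub, sub_smul, one_smul]; abel
    rw [e]
    refine ⟨(ih.2.2.1.smul (by linarith)).add (h1.smul hη0), ?_⟩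
    rw [Matrix.trace_add, Matrix.trace_smul, Matrix.trace_smul, ih.2.2.2, h2]
    simp

/-- One step of the method. -/
theorem fwObj_step_le {n : ℕ} (hn : 0 < n) {M : ℝ} (hM : 0 ≤ M) (k : ℕ)
    {Y X Xs : Matrix (Fin n) (Fin n) ℝ} (hY : Y.IsSymm) (hY1 : ∀ i j, |Y i j| ≤ 1) (hX : X.IsSymm)
    (hX1 : frobNorm X ≤ 1) (hXs : Xs ∈ feasible n) {η : ℝ} (hη : 0 ≤ η) :
    fwObj M Y (X + η • (lmo k (negGrad M Y X) - X)) - fwObj M Y Xs ≤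
      (1 - η) * (fwObj M Y X - fwObj M Y Xs) +
        2 * η * (n * (1 + 2 * (n + 1 + 2 * M)) / (2 * k + 1)) + η ^ 2 * (4 * (1 + M)) := by
  set Z := negGrad M Y X with hZ
  have hZs : Z.IsSymm := negGrad_isSymm M hY hX
  obtain ⟨S⟩ := spectralData_shiftMat hn hZs
  obtain ⟨hl1, hl2⟩ := lmo_posSemidef hn k hZs
  have hlmo := frobInner_le_power hZs S (2 * k) hXs.1 (trace_eq_one_of_feasible hn hXs)
  rw [← lmo] at hlmo
  have hZn : frobNorm Z ≤ n + 1 + 2 * M := by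
    have h1 := frobNorm_sub_le (Y - X) (M • diagDev X)
    have h2 := frobNorm_sub_le Y X
    rw [frobNorm_smul, abs_of_nonneg hM] at h1
    have h3 := mul_le_mul_of_nonneg_left (frobNorm_diagDev_le hX1) hM
    have h4 := frobNorm_le_of_abs_le_one hY1
    rw [hZ, negGrad]
    linarith
  have herr : (n : ℝ) * (1 + 2 * frobNorm Z) / ((2 * k : ℕ) + 1) ≤
      n * (1 + 2 * (n + 1 + 2 * M)) / (2 * k + 1) := by
    push_cast
    gcongr
  set err := (n : ℝ) * (1 + 2 * (n + 1 + 2 * M)) / (2 * k + 1) with herr'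
  -- Convexity: the tangent at `X` lies below the objective at `Xs`.
  have hconv : fwObj M Y X - 2 * frobInner Z (Xs - X) ≤ fwObj M Y Xs := by
    have h1 := fwObj_add_smul M Y X (Xs - X) 1
    rw [one_smul, add_sub_cancel] at h1
    have h2 := frobSq_nonneg (Xs - X)
    have h3 := mul_nonneg hM (frobSq_nonneg (Matrix.diagonal fun i => (Xs - X) i i))
    linarith
  have hD : frobSq (lmo k Z - X) ≤ 4 := by
    have h1 := frobNorm_sub_le (lmo k Z) X
    have h2 := frobNorm_le_one_of_posSemidef hl1 hl2
    rw [← frobNorm_sq]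
    nlinarith [frobNorm_nonneg (lmo k Z - X)]
  have hD2 := frobSq_diagonal_le (lmo k Z - X)
  rw [fwObj_add_smul]
  have hquad : η ^ 2 * (frobSq (lmo k Z - X) +
      M * frobSq (Matrix.diagonal fun i => (lmo k Z - X) i i)) ≤ η ^ 2 * (4 * (1 + M)) := by
    gcongr
    nlinarith
  rw [frobInner_sub_right] at hconv ⊢
  nlinarith

/-- The usual `O(1/t)` rate with step `2/(t+2)` and curvature `4(1 + M)`. The constant oracle error
passes through with factor `2`, since it enters each step with weight `2η` and the gap contracts by
`1 - η`. -/
theorem fwObj_iter_le {n : ℕ} (hn : 0 < n) {M : ℝ} (hM : 0 ≤ M) (k : ℕ)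
    {Y Xs : Matrix (Fin n) (Fin n) ℝ} (hY : Y.IsSymm) (hY1 : ∀ i j, |Y i j| ≤ 1)
    (hXs : Xs ∈ feasible n) (t : ℕ) :
    fwObj M Y (fwIter M k Y (t + 1)) - fwObj M Y Xs ≤
      2 * (n * (1 + 2 * (n + 1 + 2 * M)) / (2 * k + 1)) + 16 * (1 + M) / (t + 3) := by
  set err := (n : ℝ) * (1 + 2 * (n + 1 + 2 * M)) / (2 * k + 1) with herr
  have step : ∀ t : ℕ, fwObj M Y (fwIter M k Y (t + 1)) - fwObj M Y Xs ≤
      (1 - 2 / ((t : ℝ) + 2)) * (fwObj M Y (fwIter M k Y t) - fwObj M Y Xs) +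
        2 * (2 / ((t : ℝ) + 2)) * err + (2 / ((t : ℝ) + 2)) ^ 2 * (4 * (1 + M)) := by
    intro t
    have hinv := fwIter_invariant hn M k hY t
    exact fwObj_step_le hn hM k hY hY1 hinv.1 hinv.2.1 hXs (by positivity)
  induction t with
  | zero =>
    have := step 0
    norm_num at this ⊢
    linarith
  | succ t ih =>
    have h := step (t + 1)
    push_cast at h ⊢
    have ht : (0 : ℝ) ≤ t := Nat.cast_nonneg t
    set s : ℝ := (t : ℝ) + 3 with hs
    have hs3 : 3 ≤ s := by linarith
    rw [show (t : ℝ) + 1 + 2 = s by ring] at h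
    rw [show (t : ℝ) + 1 + 3 = s + 1 by ring]
    have hη1 : 0 ≤ 1 - 2 / s := by
      rw [sub_nonneg, div_le_one (by linarith)]; linarith
    have h2 := mul_le_mul_of_nonneg_left ih hη1
    have h3 : (1 - 2 / s) * (2 * err + 16 * (1 + M) / s) + 2 * (2 / s) * err +
        (2 / s) ^ 2 * (4 * (1 + M)) = 2 * err + 16 * (1 + M) * ((s - 1) / s ^ 2) := by
      field_simp
      ring
    -- The induction closes by `(s - 1)(s + 1) ≤ s²`.
    have h4 : (s - 1) / s ^ 2 ≤ 1 / (s + 1) := by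
      rw [div_le_div_iff₀ (by positivity) (by positivity)]
      nlinarith
    have h5 := mul_le_mul_of_nonneg_left h4 (by linarith : (0 : ℝ) ≤ 16 * (1 + M))
    rw [mul_one_div] at h5
    linarith

/-! ### From near-optimality for the penalised problem to closeness to the projection -/

theorem frobNorm_one_le {n : ℕ} : frobNorm (1 : Matrix (Fin n) (Fin n) ℝ) ≤ n := by
  refine frobNorm_le_of_abs_le_one fun i j => ?_
  by_cases h : i = j
  · subst h; simp
  · simp [h]

/-- A matrix of the spectrahedron is close to a feasible matrix. -/
theorem exists_feasible_near {n : ℕ} (hn : 0 < n) {X : Matrix (Fin n) (Fin n) ℝ}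
    (hX : X.PosSemidef) (h1 : X.trace = 1) :
    ∃ X' ∈ feasible n, frobNorm (X - X') ≤ 3 * n * frobNorm (diagDev X) := by
  have hn' : (0 : ℝ) < n := by exact_mod_cast hn
  have hn1 : (1 : ℝ) ≤ n := by exact_mod_cast hn
  set τ := frobNorm (diagDev X) with hτ
  have hτ0 : 0 ≤ τ := frobNorm_nonneg _
  have hdev : ∀ i, |X i i - 1 / n| ≤ τ := by
    intro i
    refine Real.abs_le_sqrt ?_
    have h2 : (diagDev X) i i ^ 2 ≤ ∑ j, (diagDev X) i j ^ 2 :=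
      Finset.single_le_sum (f := fun j => (diagDev X) i j ^ 2) (fun j _ => sq_nonneg _)
        (Finset.mem_univ i)
    have h3 : ∑ j, (diagDev X) i j ^ 2 ≤ frobSq (diagDev X) :=
      Finset.single_le_sum (f := fun i => ∑ j, (diagDev X) i j ^ 2)
        (fun i _ => Finset.sum_nonneg fun j _ => sq_nonneg _) (Finset.mem_univ i)
    have h4 : (diagDev X) i i = X i i - 1 / n := by simp [diagDev]
    rw [h4] at h2
    exact h2.trans h3
  set s : ℝ := 1 + n * τ with hs
  have hs1 : 1 ≤ s := by have := mul_nonneg hn'.le hτ0; linarith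
  -- Adding this positive semidefinite diagonal matrix raises every diagonal entry to `1/n + τ`;
  -- division by `s = 1 + nτ` restores `1/n`.
  set E : Matrix (Fin n) (Fin n) ℝ := τ • (1 : Matrix (Fin n) (Fin n) ℝ) - diagDev X with hE
  have hEd : E = Matrix.diagonal fun i => τ - (X i i - 1 / n) := by
    ext i j
    by_cases h : i = j
    · subst h; simp [hE, diagDev]
    · simp [hE, diagDev, h]
  have hEpsd : E.PosSemidef := by
    rw [hEd]
    refine Matrix.PosSemidef.diagonal fun i => ?_
    have := (abs_le.mp (hdev i)).2
    show 0 ≤ τ - (X i i - 1 / n)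
    linarith
  have hEn : frobNorm E ≤ 2 * n * τ := by
    have h2 := frobNorm_sub_le (τ • (1 : Matrix (Fin n) (Fin n) ℝ)) (diagDev X)
    rw [frobNorm_smul, abs_of_nonneg hτ0] at h2
    have h3 := mul_le_mul_of_nonneg_left (frobNorm_one_le (n := n)) hτ0
    have h4 := mul_le_mul_of_nonneg_right hn1 hτ0
    rw [hE]
    linarith
  refine ⟨s⁻¹ • (X + E), ⟨(hX.add hEpsd).smul (by positivity), fun i => ?_⟩, ?_⟩
  · rw [hEd]
    simp only [Matrix.smul_apply, Matrix.add_apply, Matrix.diagonal_apply_eq, smul_eq_mul]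
    rw [hs]
    field_simp
    ring
  · have e : X - s⁻¹ • (X + E) = (n * τ / s) • X - s⁻¹ • E := by
      rw [smul_add, ← sub_sub]
      congr 1
      have : (n * τ / s) = 1 - s⁻¹ := by rw [hs]; field_simp; ring
      rw [this, sub_smul, one_smul]
    rw [e]
    have h2 := frobNorm_sub_le ((n * τ / s) • X) (s⁻¹ • E)
    rw [frobNorm_smul, frobNorm_smul, abs_of_nonneg (by positivity), abs_of_nonneg (by positivity)]
      at h2
    have h3 : n * τ / s * frobNorm X ≤ n * τ := by
      have h5 : n * τ / s ≤ n * τ := div_le_self (by positivity) hs1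
      calc _ ≤ n * τ * 1 := mul_le_mul h5 (frobNorm_le_one_of_posSemidef hX h1)
            (frobNorm_nonneg _) (by positivity)
        _ = _ := mul_one _
    have h4 : s⁻¹ * frobNorm E ≤ frobNorm E :=
      mul_le_of_le_one_left (frobNorm_nonneg _) (inv_le_one_of_one_le₀ hs1)
    linarith

/-- Expanding `‖Y - X‖²` around the projection leaves the term `2⟨Y - proj Y, X - proj Y⟩`, possibly
positive because `X` violates the diagonal constraints. A nearby feasible matrix and the variational
inequality bound it by `12 n² τ`, which the penalty `Mτ²` absorbs at the price `36 n⁴/M`. -/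
theorem frobSq_sub_proj_le_of_fwObj {n : ℕ} (hn : 0 < n) {M g : ℝ} (hM : 0 < M)
    {Y X : Matrix (Fin n) (Fin n) ℝ} (hY1 : ∀ i j, |Y i j| ≤ 1) (hX : X.PosSemidef)
    (h1 : X.trace = 1) (hg : fwObj M Y X - fwObj M Y (proj Y) ≤ g) :
    frobSq (X - proj Y) ≤ g + 36 * n ^ 4 / M := by
  have hn1 : (1 : ℝ) ≤ n := by exact_mod_cast hn
  obtain ⟨X', hX', hnear⟩ := exists_feasible_near hn hX h1
  set τ := frobNorm (diagDev X) with hτ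
  have hτ0 : 0 ≤ τ := frobNorm_nonneg _
  have hvar := frobInner_sub_proj_nonpos Y hX'
  have hYn : frobNorm (Y - proj Y) ≤ 2 * n := by
    have h2 := frobNorm_sub_le Y (proj Y)
    have h3 := frobNorm_le_of_abs_le_one hY1
    have h4 := frobNorm_le_one_of_feasible (proj_mem Y)
    linarith
  have hin : frobInner (Y - proj Y) (X - X') ≤ 2 * n * (3 * n * τ) :=
    (frobInner_le _ _).trans (mul_le_mul hYn hnear (frobNorm_nonneg _) (by positivity))
  have hexp : frobSq (Y - X) = frobSq (Y - proj Y) - 2 * frobInner (Y - proj Y) (X - proj Y) +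
      frobSq (X - proj Y) := by
    rw [← frobSq_sub]; congr 1; abel
  have hsplit : frobInner (Y - proj Y) (X - proj Y) =
      frobInner (Y - proj Y) (X - X') + frobInner (Y - proj Y) (X' - proj Y) := by
    rw [← frobInner_add_right]; congr 1; abel
  unfold fwObj at hg
  rw [diagDev_eq_zero (proj_mem Y)] at hg
  have h0 : frobSq (0 : Matrix (Fin n) (Fin n) ℝ) = 0 := by simp [frobSq]
  rw [h0, ← frobNorm_sq (diagDev X), ← hτ] at hg
  have hsq : 12 * n ^ 2 * τ ≤ M * τ ^ 2 + 36 * n ^ 4 / M := by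
    have h5 : 0 ≤ (M * τ - 6 * n ^ 2) ^ 2 / M := by positivity
    have h6 : (M * τ - 6 * n ^ 2) ^ 2 / M = M * τ ^ 2 - 12 * n ^ 2 * τ + 36 * n ^ 4 / M := by
      field_simp
      ring
    linarith
  nlinarith

/-- The matrix that the program computes in place of the projection. -/
def approxProj {n : ℕ} (q : ℕ) (Y : Matrix (Fin n) (Fin n) ℝ) : Matrix (Fin n) (Fin n) ℝ :=
  fwIter ((q : ℝ) ^ 9) (q ^ 15) Y (q ^ 14)

/-- The powers in `approxProj` make each of three errors `O(q⁻⁵)`: the oracle with constant `2 · 5`,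
the iteration with `32`, the penalty with `36`. The sum `78/q⁵` is below `q⁻⁴` for `q ≥ 80`.
Accuracy `q⁻²` exceeds what the definition of execution asks for; privacy needs it to be small
against the sensitivity. -/
theorem frobSq_approxProj_sub_le {n q : ℕ} (hn : 0 < n) (hq : 80 ≤ q) (hnq : n ≤ q)
    {Y : Matrix (Fin n) (Fin n) ℝ} (hY : Y.IsSymm) (hY1 : ∀ i j, |Y i j| ≤ 1) :
    (approxProj q Y).IsSymm ∧ frobSq (approxProj q Y - proj Y) ≤ (1 / (q : ℝ) ^ 2) ^ 2 := by
  obtain ⟨t, ht⟩ : ∃ t, q ^ 14 = t + 1 :=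
    ⟨q ^ 14 - 1, (Nat.succ_pred_eq_of_pos (pow_pos (by omega) _)).symm⟩
  have hinv := fwIter_invariant hn ((q : ℝ) ^ 9) (q ^ 15) hY t
  have hq' : (80 : ℝ) ≤ q := by exact_mod_cast hq
  have hnq' : (n : ℝ) ≤ q := by exact_mod_cast hnq
  have hn1 : (1 : ℝ) ≤ n := by exact_mod_cast hn
  have hq0 : (0 : ℝ) < q := by linarith
  unfold approxProj
  rw [ht]
  refine ⟨isSymm_of_posSemidef hinv.2.2.1, ?_⟩
  have hobj := fwObj_iter_le hn (by positivity : (0 : ℝ) ≤ (q : ℝ) ^ 9) (q ^ 15) hY hY1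
    (proj_mem Y) t
  refine (frobSq_sub_proj_le_of_fwObj hn (by positivity) hY1 hinv.2.2.1 hinv.2.2.2 hobj).trans ?_
  have ht' : (t : ℝ) + 3 ≥ (q : ℝ) ^ 14 := by
    have : (q : ℝ) ^ 14 = t + 1 := by exact_mod_cast ht
    linarith
  have hq9 : (q : ℝ) ≤ (q : ℝ) ^ 9 := le_self_pow₀ (by linarith) (by norm_num)
  have hq91 : (1 : ℝ) ≤ (q : ℝ) ^ 9 := by linarith
  have e1 : (n : ℝ) * (1 + 2 * (n + 1 + 2 * (q : ℝ) ^ 9)) / (2 * ((q ^ 15 : ℕ) : ℝ) + 1) ≤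
      5 / q ^ 5 := by
    push_cast
    rw [div_le_div_iff₀ (by positivity) (by positivity)]
    have h2 : (n : ℝ) * (1 + 2 * (n + 1 + 2 * (q : ℝ) ^ 9)) ≤ q * (9 * (q : ℝ) ^ 9) := by
      refine mul_le_mul hnq' ?_ (by positivity) hq0.le
      linarith
    calc _ ≤ q * (9 * (q : ℝ) ^ 9) * q ^ 5 := by gcongr
      _ = 9 * q ^ 15 := by ring
      _ ≤ _ := by nlinarith [pow_pos hq0 15]
  have e2 : 16 * (1 + (q : ℝ) ^ 9) / (t + 3) ≤ 32 / q ^ 5 := by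
    rw [div_le_div_iff₀ (by positivity) (by positivity)]
    calc _ ≤ 16 * ((q : ℝ) ^ 9 + (q : ℝ) ^ 9) * q ^ 5 := by gcongr
      _ = 32 * q ^ 14 := by ring
      _ ≤ _ := by gcongr
  have e3 : 36 * (n : ℝ) ^ 4 / (q : ℝ) ^ 9 ≤ 36 / q ^ 5 := by
    rw [div_le_div_iff₀ (by positivity) (by positivity)]
    calc _ ≤ 36 * (q : ℝ) ^ 4 * q ^ 5 := by gcongr
      _ = _ := by ring
  have e4 : 78 / (q : ℝ) ^ 5 ≤ (1 / (q : ℝ) ^ 2) ^ 2 := by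
    rw [div_pow, one_pow, ← pow_mul, div_le_div_iff₀ (by positivity) (by positivity)]
    rw [show (q : ℝ) ^ 5 = q * q ^ (2 * 2) by ring, one_mul]
    gcongr
    linarith
  have e5 : 78 / (q : ℝ) ^ 5 = 2 * (5 / q ^ 5) + 32 / q ^ 5 + 36 / q ^ 5 := by ring
  linarith


/-! ## Running time of programs -/

theorem foldl_range_induction {α : Type*} (f : α → ℕ → α) (Inv : ℕ → α → Prop) {s : α}
    (h0 : Inv 0 s) (m : ℕ) (hs : ∀ k < m, ∀ s, Inv k s → Inv (k + 1) (f s k)) :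
    Inv m ((List.range m).foldl f s) := by
  induction m with
  | zero => simpa using h0
  | succ m ih =>
    rw [List.range_succ, List.foldl_append]
    exact hs m (Nat.lt_succ_self m) _ (ih fun k hk => hs k (Nat.lt_succ_of_lt hk))

/-- The expression reads only the variables `0` and `1`. -/
def IdxExpr.InputOnly : IdxExpr → Prop
  | .var x => x ≤ 1
  | .const _ => True
  | .add e f => e.InputOnly ∧ f.InputOnly
  | .mul e f => e.InputOnly ∧ f.InputOnly

/-- Loop bounds depend only on the variables `0` and `1`, which are never written. -/
def Cmd.Tame : Cmd → Prop
  | .skip => True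
  | .assign _ _ _ _ => True
  | .setIdx x _ => 2 ≤ x
  | .sample _ _ _ => True
  | .seq c₁ c₂ => c₁.Tame ∧ c₂.Tame
  | .ifLe _ _ c₁ c₂ => c₁.Tame ∧ c₂.Tame
  | .loop x b c => 2 ≤ x ∧ b.InputOnly ∧ c.Tame

/-- Bounds of the form `K m^K` with a single constant are closed under sums and products, so one
natural number describes the running time of every command. -/
theorem poly_add_le {K L m : ℕ} (hm : 1 ≤ m) :
    K * m ^ K + L * m ^ L ≤ (K + L) * m ^ (K + L) := by
  rw [Nat.add_mul]
  exact Nat.add_le_add (Nat.mul_le_mul le_rfl (Nat.pow_le_pow_right hm (by omega)))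
    (Nat.mul_le_mul le_rfl (Nat.pow_le_pow_right hm (by omega)))

theorem poly_mul_le {K L m : ℕ} (hm : 1 ≤ m) :
    K * m ^ K * (L * m ^ L) ≤ (K * L + K + L) * m ^ (K * L + K + L) := by
  calc _ = K * L * m ^ (K + L) := by rw [pow_add]; ring
    _ ≤ _ := Nat.mul_le_mul (by omega) (Nat.pow_le_pow_right hm (by
      have := Nat.zero_le (K * L); omega))

theorem const_le_poly {c m : ℕ} (hm : 1 ≤ m) : c ≤ c * m ^ c :=
  Nat.le_mul_of_pos_right _ (Nat.pow_pos hm)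

theorem IdxExpr.InputOnly.bound {e : IdxExpr} (he : e.InputOnly) :
    ∃ K, ∀ s : State, e.eval s ≤ K * (s.idx 0 + s.idx 1 + 1) ^ K := by
  induction e with
  | var x =>
    refine ⟨1, fun s => ?_⟩
    simp only [IdxExpr.eval, one_mul, pow_one]
    have hx : x ≤ 1 := he
    interval_cases x <;> omega
  | const c => exact ⟨c, fun s => const_le_poly (by omega)⟩
  | add e f ihe ihf =>
    obtain ⟨K, hK⟩ := ihe he.1
    obtain ⟨L, hL⟩ := ihf he.2
    exact ⟨K + L, fun s => (Nat.add_le_add (hK s) (hL s)).trans (poly_add_le (by omega))⟩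
  | mul e f ihe ihf =>
    obtain ⟨K, hK⟩ := ihe he.1
    obtain ⟨L, hL⟩ := ihf he.2
    exact ⟨_, fun s => (Nat.mul_le_mul (hK s) (hL s)).trans (poly_mul_le (by omega))⟩

/-- Induction on the command. Variables `0` and `1` stay unchanged, so each loop bound is polynomial
in the inputs alone, on every random tape; nested loops then multiply polynomials. -/
theorem Cmd.Tame.time_le {c : Cmd} (hc : c.Tame) : ∃ K, ∀ (ω : ℕ → ℝ) (s : State),
    (c.run ω s).idx 0 = s.idx 0 ∧ (c.run ω s).idx 1 = s.idx 1 ∧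
    (c.run ω s).time ≤ s.time + K * (s.idx 0 + s.idx 1 + 1) ^ K := by
  have hconst : ∀ (k : ℕ) (s : State), k ≤ k * (s.idx 0 + s.idx 1 + 1) ^ k := fun k s =>
    const_le_poly (by omega)
  induction c with
  | skip =>
    exact ⟨1, fun ω s => ⟨rfl, rfl, Nat.add_le_add_left (hconst 1 s) _⟩⟩
  | assign a i j e =>
    exact ⟨_, fun ω s => ⟨rfl, rfl, Nat.add_le_add_left (hconst (i.cost + j.cost + e.cost + 1) s) _⟩⟩
  | setIdx x e =>
    have hx : 2 ≤ x := hc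
    refine ⟨e.cost + 1, fun ω s => ⟨?_, ?_, Nat.add_le_add_left (hconst _ s) _⟩⟩
    · simp [Cmd.run, State.tick, State.setVar, Function.update, show ¬ 0 = x by omega]
    · simp [Cmd.run, State.tick, State.setVar, Function.update, show ¬ 1 = x by omega]
  | sample a i j =>
    exact ⟨_, fun ω s => ⟨rfl, rfl, Nat.add_le_add_left (hconst (i.cost + j.cost + 1) s) _⟩⟩
  | seq c₁ c₂ ih₁ ih₂ =>
    obtain ⟨K, hK⟩ := ih₁ hc.1
    obtain ⟨L, hL⟩ := ih₂ hc.2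
    refine ⟨K + L, fun ω s => ?_⟩
    obtain ⟨h1, h2, h3⟩ := hK ω s
    obtain ⟨h4, h5, h6⟩ := hL ω (c₁.run ω s)
    simp only [Cmd.run]
    rw [h1, h2] at h6
    refine ⟨h4.trans h1, h5.trans h2, ?_⟩
    have := poly_add_le (K := K) (L := L) (m := s.idx 0 + s.idx 1 + 1) (by omega)
    omega
  | ifLe e f c₁ c₂ ih₁ ih₂ =>
    obtain ⟨K, hK⟩ := ih₁ hc.1
    obtain ⟨L, hL⟩ := ih₂ hc.2
    refine ⟨(e.cost + f.cost + 1) + (K + L), fun ω s => ?_⟩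
    have h0 := hconst (e.cost + f.cost + 1) s
    have h1 := poly_add_le (K := e.cost + f.cost + 1) (L := K + L)
      (m := s.idx 0 + s.idx 1 + 1) (by omega)
    have h2 := poly_add_le (K := K) (L := L) (m := s.idx 0 + s.idx 1 + 1) (by omega)
    simp only [Cmd.run]
    split_ifs
    · obtain ⟨h3, h4, h5⟩ := hK ω (s.tick (e.cost + f.cost + 1))
      simp only [State.tick] at h3 h4 h5 ⊢
      exact ⟨h3, h4, by omega⟩
    · obtain ⟨h3, h4, h5⟩ := hL ω (s.tick (e.cost + f.cost + 1))
      simp only [State.tick] at h3 h4 h5 ⊢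
      exact ⟨h3, h4, by omega⟩
  | loop x b c ih =>
    obtain ⟨hx, hb, hc⟩ := hc
    obtain ⟨K, hK⟩ := ih hc
    obtain ⟨L, hL⟩ := hb.bound
    refine ⟨(b.cost + 1) + (L * (1 + K) + L + (1 + K)), fun ω s => ?_⟩
    set m := s.idx 0 + s.idx 1 + 1 with hm
    have hm1 : 1 ≤ m := by omega
    have key := foldl_range_induction (fun s' k => c.run ω ((s'.setVar x k).tick 1))
      (fun k s' => s'.idx 0 = s.idx 0 ∧ s'.idx 1 = s.idx 1 ∧
        s'.time ≤ s.time + (b.cost + 1) + k * (1 + K * m ^ K))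
      (s := s.tick (b.cost + 1)) ⟨rfl, rfl, by simp [State.tick]⟩ (b.eval s) (by
        rintro k - s' ⟨h0, h1, h2⟩
        obtain ⟨h3, h4, h5⟩ := hK ω ((s'.setVar x k).tick 1)
        have e0 : ((s'.setVar x k).tick 1).idx 0 = s'.idx 0 := by
          simp [State.tick, State.setVar, Function.update, show ¬ 0 = x by omega]
        have e1 : ((s'.setVar x k).tick 1).idx 1 = s'.idx 1 := by
          simp [State.tick, State.setVar, Function.update, show ¬ 1 = x by omega]
        have e2 : ((s'.setVar x k).tick 1).time = s'.time + 1 := rfl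
        rw [e0, e1, h0, h1, ← hm, e2] at h5
        refine ⟨h3.trans (e0.trans h0), h4.trans (e1.trans h1), ?_⟩
        rw [Nat.add_mul, one_mul]
        omega)
    simp only [Cmd.run]
    refine ⟨key.1, key.2.1, key.2.2.trans ?_⟩
    have h6 : b.eval s * (1 + K * m ^ K) ≤ L * m ^ L * ((1 + K) * m ^ (1 + K)) := by
      refine Nat.mul_le_mul (hL s) ?_
      have := poly_add_le (K := 1) (L := K) hm1
      rw [one_mul, pow_one] at this
      omega
    have h7 := h6.trans (poly_mul_le (K := L) (L := 1 + K) hm1)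
    have h8 := hconst (b.cost + 1) s
    rw [← hm] at h8
    have h9 := poly_add_le (K := b.cost + 1) (L := L * (1 + K) + L + (1 + K)) hm1
    omega

/-! ## Semantics of the building blocks -/

/-- `s'` differs from `s` at most in the index variables `V`, the arrays `A` and the time. -/
def Frame (V A : List ℕ) (s s' : State) : Prop :=
  s'.draws = s.draws ∧ (∀ x, x ∉ V → s'.idx x = s.idx x) ∧ ∀ b, b ∉ A → s'.mem b = s.mem b

theorem Frame.refl (V A : List ℕ) (s : State) : Frame V A s s := ⟨rfl, fun _ _ => rfl, fun _ _ => rfl⟩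

theorem Frame.trans {V A V' A' V'' A'' : List ℕ} {s s' s'' : State} (h : Frame V A s s')
    (h' : Frame V' A' s' s'') (hV : V ⊆ V'') (hV' : V' ⊆ V'') (hA : A ⊆ A'') (hA' : A' ⊆ A'') :
    Frame V'' A'' s s'' :=
  ⟨h'.1.trans h.1, fun x hx => (h'.2.1 x fun hh => hx (hV' hh)).trans
    (h.2.1 x fun hh => hx (hV hh)), fun b hb => (h'.2.2 b fun hh => hb (hA' hh)).trans
    (h.2.2 b fun hh => hb (hA hh))⟩

theorem Frame.mono {V A V' A' : List ℕ} {s s' : State} (h : Frame V A s s') (hV : V ⊆ V')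
    (hA : A ⊆ A') : Frame V' A' s s' := h.trans (Frame.refl V' A' s') hV (List.Subset.refl _) hA
      (List.Subset.refl _)

/-- The expression does not read the array `a`. -/
def RealExpr.Avoids (a : ℕ) : RealExpr → Prop
  | .const _ => True
  | .ofIdx _ => True
  | .cell b _ _ => b ≠ a
  | .add e f => e.Avoids a ∧ f.Avoids a
  | .sub e f => e.Avoids a ∧ f.Avoids a
  | .mul e f => e.Avoids a ∧ f.Avoids a
  | .div e f => e.Avoids a ∧ f.Avoids a
  | .sqrt e => e.Avoids a
  | .log e => e.Avoids a

theorem IdxExpr.eval_congr (e : IdxExpr) {s s' : State} (h : s'.idx = s.idx) :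
    e.eval s' = e.eval s := by
  induction e <;> simp_all [IdxExpr.eval]

theorem IdxExpr.InputOnly.eval_congr {e : IdxExpr} (he : e.InputOnly) {s s' : State}
    (h0 : s'.idx 0 = s.idx 0) (h1 : s'.idx 1 = s.idx 1) : e.eval s' = e.eval s := by
  induction e with
  | var x =>
    have hx : x ≤ 1 := he
    interval_cases x <;> assumption
  | const c => rfl
  | add e f ihe ihf => simp [IdxExpr.eval, ihe he.1, ihf he.2]
  | mul e f ihe ihf => simp [IdxExpr.eval, ihe he.1, ihf he.2]

theorem RealExpr.Avoids.eval_congr {a : ℕ} {e : RealExpr} (he : e.Avoids a) {s s' : State}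
    (hi : s'.idx = s.idx) (hm : ∀ b, b ≠ a → s'.mem b = s.mem b) : e.eval s' = e.eval s := by
  induction e with
  | const c => rfl
  | ofIdx e => simp [RealExpr.eval, e.eval_congr hi]
  | cell b i j => simp [RealExpr.eval, i.eval_congr hi, j.eval_congr hi, hm b he]
  | add e f ihe ihf => simp [RealExpr.eval, ihe he.1, ihf he.2]
  | sub e f ihe ihf => simp [RealExpr.eval, ihe he.1, ihf he.2]
  | mul e f ihe ihf => simp [RealExpr.eval, ihe he.1, ihf he.2]
  | div e f ihe ihf => simp [RealExpr.eval, ihe he.1, ihf he.2]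
  | sqrt e ih => simp [RealExpr.eval, ih he]
  | log e ih => simp [RealExpr.eval, ih he]

/-- For all `i, j < n`, set `a[i, j] := ∑_{k < b} e`, where `e` may use `i, j, k` as the
variables `2, 3, 4`. -/
def fillSum (a : ℕ) (b : IdxExpr) (e : RealExpr) : Cmd :=
  .loop 2 (.var 0) (.loop 3 (.var 0) (.seq (.assign a (.var 2) (.var 3) (.const 0))
    (.loop 4 b (.assign a (.var 2) (.var 3) (.add (.cell a (.var 2) (.var 3)) e)))))

theorem fillSum_tame {a : ℕ} {b : IdxExpr} (hb : b.InputOnly) (e : RealExpr) :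
    (fillSum a b e).Tame := by
  simp [fillSum, Cmd.Tame, IdxExpr.InputOnly, hb]

/-- The state `s` with `i, j, k` in the variables `2, 3, 4`. -/
def State.at3 (s : State) (i j k : ℕ) : State := ((s.setVar 2 i).setVar 3 j).setVar 4 k

theorem State.ext_idx_at3 {s s' : State} {i j k : ℕ}
    (h : ∀ x, x ∉ [2, 3, 4] → s'.idx x = s.idx x) (h2 : s'.idx 2 = i) (h3 : s'.idx 3 = j)
    (h4 : s'.idx 4 = k) : s'.idx = (s.at3 i j k).idx := by
  funext x
  simp only [State.at3, State.setVar, Function.update]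
  by_cases e4 : x = 4
  · subst e4; simpa using h4
  by_cases e3 : x = 3
  · subst e3; simpa using h3
  by_cases e2 : x = 2
  · subst e2; simpa using h2
  simp only [e2, e3, e4, dite_false]
  exact h x (by simp [e2, e3, e4])

/-- `e` may be evaluated in the original state `s`: up to this point only the array `a`, which `e`
does not read, and the three loop variables have changed. -/
theorem fillSum_inner {a : ℕ} {b : IdxExpr} {e : RealExpr} (hb : b.InputOnly) (he : e.Avoids a)
    (ω : ℕ → ℝ) (s s₁ : State) {i j : ℕ} (hs : Frame [2, 3, 4] [a] s s₁) (h2 : s₁.idx 2 = i)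
    (h3 : s₁.idx 3 = j) :
    let s' := (Cmd.seq (.assign a (.var 2) (.var 3) (.const 0))
      (.loop 4 b (.assign a (.var 2) (.var 3) (.add (.cell a (.var 2) (.var 3)) e)))).run ω s₁
    Frame [2, 3, 4] [a] s s' ∧ s'.idx 2 = i ∧ s'.idx 3 = j ∧ ∀ i' j', s'.mem a i' j' =
      if i' = i ∧ j' = j then ∑ k ∈ Finset.range (b.eval s), e.eval (s.at3 i j k)
      else s₁.mem a i' j' := by
  intro s'
  set s₂ := (Cmd.assign a (.var 2) (.var 3) (.const 0)).run ω s₁ with hs₂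
  have hbe : b.eval s₂ = b.eval s :=
    hb.eval_congr (hs.2.1 0 (by simp)) (hs.2.1 1 (by simp))
  have key := foldl_range_induction
    (fun s' k => (Cmd.assign a (.var 2) (.var 3) (.add (.cell a (.var 2) (.var 3)) e)).run ω
      ((s'.setVar 4 k).tick 1))
    (fun m s' => Frame [2, 3, 4] [a] s s' ∧ s'.idx 2 = i ∧ s'.idx 3 = j ∧
      ∀ i' j', s'.mem a i' j' =
        if i' = i ∧ j' = j then ∑ k ∈ Finset.range m, e.eval (s.at3 i j k)
        else s₁.mem a i' j')
    (s := s₂.tick (b.cost + 1)) ?_ (b.eval s₂) ?_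
  · rw [hbe] at key
    have : s' = (List.range (b.eval s)).foldl (fun s' k => (Cmd.assign a (.var 2) (.var 3)
        (.add (.cell a (.var 2) (.var 3)) e)).run ω ((s'.setVar 4 k).tick 1))
        (s₂.tick (b.cost + 1)) := by
      rw [← hbe]; rfl
    rw [this]
    exact key
  · refine ⟨⟨hs.1, hs.2.1, fun c hc => ?_⟩, h2, h3, fun i' j' => ?_⟩
    · have hca : c ≠ a := by simpa using hc
      rw [← hs.2.2 c hc]
      funext x y
      simp [hs₂, Cmd.run, State.tick, State.setCell, hca]
    · simp [hs₂, Cmd.run, State.tick, State.setCell, IdxExpr.eval, RealExpr.eval, h2, h3]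
  · rintro k - t ⟨hF, ht2, ht3, hm⟩
    have hidx : ((t.setVar 4 k).tick 1).idx = (s.at3 i j k).idx := by
      refine State.ext_idx_at3 (fun x hx => ?_) ?_ ?_ ?_
      · rw [← hF.2.1 x hx]
        have : x ≠ 4 := fun h => hx (by simp [h])
        simp [State.tick, State.setVar, Function.update, this]
      · simpa [State.tick, State.setVar, Function.update] using ht2
      · simpa [State.tick, State.setVar, Function.update] using ht3
      · simp [State.tick, State.setVar, Function.update]
    have hev : e.eval ((t.setVar 4 k).tick 1) = e.eval (s.at3 i j k) :=
      he.eval_congr hidx fun c hc => hF.2.2 c (by simpa using hc)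
    refine ⟨⟨hF.1, fun x hx => ?_, fun c hc => ?_⟩, ?_, ?_, fun i' j' => ?_⟩
    · rw [← hF.2.1 x hx]
      have : x ≠ 4 := fun h => hx (by simp [h])
      simp [Cmd.run, State.tick, State.setVar, State.setCell, Function.update, this]
    · have hca : c ≠ a := by simpa using hc
      rw [← hF.2.2 c hc]
      funext x y
      simp [Cmd.run, State.tick, State.setVar, State.setCell, hca]
    · simpa [Cmd.run, State.tick, State.setVar, State.setCell, Function.update] using ht2
    · simpa [Cmd.run, State.tick, State.setVar, State.setCell, Function.update] using ht3
    · have hc2 : (IdxExpr.var 2).eval ((t.setVar 4 k).tick 1) = i := by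
        simpa [IdxExpr.eval, State.tick, State.setVar, Function.update] using ht2
      have hc3 : (IdxExpr.var 3).eval ((t.setVar 4 k).tick 1) = j := by
        simpa [IdxExpr.eval, State.tick, State.setVar, Function.update] using ht3
      have hmem : ((t.setVar 4 k).tick 1).mem = t.mem := rfl
      simp only [Cmd.run, State.tick, State.setCell, true_and] at hc2 hc3 hmem ⊢
      simp only [hc2, hc3]
      split_ifs with h
      · simp only [RealExpr.eval]
        have hev' := hev
        simp only [State.tick] at hev'
        rw [hev', hc2, hc3, Finset.sum_range_succ]
        congr 1
        have h5 := hm i j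
        rw [if_pos ⟨rfl, rfl⟩] at h5
        exact h5
      · have := hm i' j'
        rw [if_neg h] at this
        exact this

theorem fillSum_spec {a : ℕ} {b : IdxExpr} {e : RealExpr} (hb : b.InputOnly) (he : e.Avoids a)
    (ω : ℕ → ℝ) (s : State) :
    Frame [2, 3, 4] [a] s ((fillSum a b e).run ω s) ∧ ∀ i < s.idx 0, ∀ j < s.idx 0,
      ((fillSum a b e).run ω s).mem a i j =
        ∑ k ∈ Finset.range (b.eval s), e.eval (s.at3 i j k) := by
  set n := s.idx 0 with hn
  let G : ℕ → ℕ → ℝ := fun i j => ∑ k ∈ Finset.range (b.eval s), e.eval (s.at3 i j k)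
  have key := foldl_range_induction
    (fun s' i => (Cmd.loop 3 (.var 0) (.seq (.assign a (.var 2) (.var 3) (.const 0))
      (.loop 4 b (.assign a (.var 2) (.var 3) (.add (.cell a (.var 2) (.var 3)) e))))).run ω
      ((s'.setVar 2 i).tick 1))
    (fun m s' => Frame [2, 3, 4] [a] s s' ∧ ∀ i < m, ∀ j < n, s'.mem a i j = G i j)
    (s := s.tick ((IdxExpr.var 0).cost + 1)) ⟨Frame.refl _ _ _, by simp⟩ n ?_
  · exact key
  · rintro m - t ⟨hF, hm⟩
    set t₁ := (t.setVar 2 m).tick 1 with ht₁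
    have hF₁ : Frame [2, 3, 4] [a] s t₁ := by
      refine ⟨hF.1, fun x hx => ?_, hF.2.2⟩
      rw [← hF.2.1 x hx]
      have : x ≠ 2 := fun h => hx (by simp [h])
      simp [ht₁, State.tick, State.setVar, Function.update, this]
    have ht₁2 : t₁.idx 2 = m := by simp [ht₁, State.tick, State.setVar, Function.update]
    have key2 := foldl_range_induction
      (fun s' j => (Cmd.seq (.assign a (.var 2) (.var 3) (.const 0))
        (.loop 4 b (.assign a (.var 2) (.var 3) (.add (.cell a (.var 2) (.var 3)) e)))).run ω
        ((s'.setVar 3 j).tick 1))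
      (fun l s' => Frame [2, 3, 4] [a] s s' ∧ s'.idx 2 = m ∧
        (∀ j < l, s'.mem a m j = G m j) ∧ ∀ i < m, ∀ j, s'.mem a i j = t₁.mem a i j)
      (s := t₁.tick ((IdxExpr.var 0).cost + 1)) ⟨hF₁, ht₁2, by simp, fun _ _ _ => rfl⟩ n ?_
    · have h0 : (IdxExpr.var 0).eval t₁ = n := hF₁.2.1 0 (by simp)
      simp only [Cmd.run, h0]
      simp only [Cmd.run] at key2
      refine ⟨key2.1, fun i hi j hj => ?_⟩
      rcases Nat.lt_succ_iff_lt_or_eq.mp hi with h | rfl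
      · exact (key2.2.2.2 i h j).trans (hm i h j hj)
      · exact key2.2.2.1 j hj
    · rintro l - r ⟨hFr, hr2, hrl, hri⟩
      set r₁ := (r.setVar 3 l).tick 1 with hr₁
      have hFr₁ : Frame [2, 3, 4] [a] s r₁ := by
        refine ⟨hFr.1, fun x hx => ?_, hFr.2.2⟩
        rw [← hFr.2.1 x hx]
        have : x ≠ 3 := fun h => hx (by simp [h])
        simp [hr₁, State.tick, State.setVar, Function.update, this]
      have h1 := fillSum_inner hb he ω s r₁ (i := m) (j := l) hFr₁
        (by simpa [hr₁, State.tick, State.setVar, Function.update] using hr2)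
        (by simp [hr₁, State.tick, State.setVar, Function.update])
      obtain ⟨h1a, h1b, -, h1d⟩ := h1
      refine ⟨h1a, h1b, fun j hj => ?_, fun i hi j => ?_⟩
      · rw [h1d]
        rcases Nat.lt_succ_iff_lt_or_eq.mp hj with h | rfl
        · rw [if_neg (by omega)]
          exact hrl j h
        · simp [G]
      · rw [h1d, if_neg (by omega)]
        exact hri i hi j


/-! ## The program -/

section Program

open IdxExpr RealExpr Cmd

/-- The `k`-th power of the accuracy parameter. -/
def qPow : ℕ → IdxExpr
  | 0 => .const 1
  | k + 1 => .mul (qPow k) (.var 1)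

/-- For all `i, j < n`, set `a[i, j] := e`. -/
def fill (a : ℕ) (e : RealExpr) : Cmd := fillSum a (.const 1) e

/-- The entry `(i, j)` of an array, where `i` and `j` are the variables `2` and `3`. -/
def here (a : ℕ) : RealExpr := .cell a (.var 2) (.var 3)

/-- The array product `a[i, k] b[k, j]`. -/
def prodExpr (a b : ℕ) : RealExpr := .mul (.cell a (.var 2) (.var 4)) (.cell b (.var 4) (.var 3))

/-- `i - j`. -/
def idxDiff : RealExpr := .sub (.ofIdx (.var 2)) (.ofIdx (.var 3))

/-- The positive part of `1 - |i - j|`, which is `1` on the diagonal and `0` elsewhere. -/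
def diagInd : RealExpr :=
  .div (.add (.sub (.const 1) (.sqrt (.mul idxDiff idxDiff)))
    (.sqrt (.mul (.sub (.const 1) (.sqrt (.mul idxDiff idxDiff)))
      (.sub (.const 1) (.sqrt (.mul idxDiff idxDiff)))))) (.const 2)

/-- `j - i + 1 / 2`. -/
def halfDiff : RealExpr := .sub (.const (1 / 2)) idxDiff

/-- `1` if `i ≤ j` and `0` otherwise. -/
def upperInd : RealExpr :=
  .div (.add (.const 1) (.div halfDiff (.sqrt (.mul halfDiff halfDiff)))) (.const 2)

/-- Draw the array `12`. -/
def sampleAll : Cmd := .loop 2 (.var 0) (.loop 3 (.var 0) (.sample 12 (.var 2) (.var 3)))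

/-- Array `5` holds `Z`; put `B = shiftMat Z` into `6`, `B ^ q ^ 15` into `7` and its square
into `9`. -/
def powerBlock : Cmd :=
  .seq (fillSum 8 (.var 0) (.mul (.cell 5 (.var 2) (.var 4)) (.cell 5 (.var 2) (.var 4))))
  (.seq (fillSum 10 (.var 0) (.cell 8 (.var 4) (.var 3)))
  (.seq (fill 6 (.add (here 5) (.mul (.add (.const 1) (.sqrt (here 10))) (here 11))))
  (.seq (fill 7 (here 11))
  (.seq (.loop 5 (qPow 15) (.seq (fillSum 8 (.var 0) (prodExpr 7 6)) (fill 7 (here 8))))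
  (fillSum 9 (.var 0) (prodExpr 7 7))))))

/-- One step of the conditional gradient method for array `4`, with step counter `6`. -/
def fwBody : Cmd :=
  .seq (fill 5 (.sub (.sub (here 3) (here 4)) (.mul (.ofIdx (qPow 9))
    (.mul (here 11) (.sub (here 4) (.div (.const 1) (.ofIdx (.var 0))))))))
  (.seq powerBlock
  (.seq (fillSum 10 (.var 0) (.cell 9 (.var 4) (.var 4)))
  (.seq (fill 8 (.add (here 4) (.mul (.div (.const 2) (.add (.ofIdx (.var 6)) (.const 2)))
    (.sub (.mul (.div (.const 1) (here 10)) (here 9)) (here 4)))))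
  (fill 4 (here 8)))))

/-- The public parameters `γ, d, ε, δ`. -/
def param (j : ℕ) : RealExpr := .cell 1 (.const 0) (.const j)

/-- `log (2 / δ) / ε ^ 2`. -/
def privacyExpr : RealExpr :=
  .div (.log (.div (.const 2) (param 3))) (.mul (param 2) (param 2))

/-- `√(24 / (n γ d) · e)`. -/
def noiseExpr (e : RealExpr) : RealExpr :=
  .sqrt (.mul (.div (.const 24) (.mul (.mul (.ofIdx (.var 0)) (param 0)) (param 1))) e)

/-- Put the standard deviation of the noise into array `13`. -/
def sigmaBlock : Cmd :=
  .ifLe (param 2) (.const 1) (fill 13 (noiseExpr privacyExpr))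
    (fill 13 (noiseExpr (.add privacyExpr (.const 1))))

/-- Put the index of a largest entry of column `0` of array `10` into variable `7`. -/
def argmaxBlock : Cmd :=
  .seq (.setIdx 7 (.const 0)) (.loop 2 (.var 0)
    (.ifLe (.cell 10 (.var 7) (.const 0)) (.cell 10 (.var 2) (.const 0))
      (.setIdx 7 (.var 2)) .skip))

/-- Put a nearly leading eigenvector of array `5` into the columns of array `2`. -/
def roundBlock : Cmd :=
  .seq powerBlock
  (.seq (fillSum 8 (.var 0) (prodExpr 9 6))
  (.seq (fill 10 (.div (.cell 8 (.var 2) (.var 2)) (.cell 9 (.var 2) (.var 2))))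
  (.seq argmaxBlock
  (fill 2 (.cell 7 (.var 2) (.var 7))))))

/-- Add the noise to array `4`, with result in array `5`. -/
def noiseBlock : Cmd :=
  fill 5 (.add (here 4) (.mul (here 13) (.add (.mul upperInd (here 12))
    (.mul (.sub (.const 1) upperInd) (.cell 12 (.var 3) (.var 2))))))

/-- Put `Y(G)` into array `3`. -/
def inputBlock : Cmd :=
  fill 3 (.mul (.div (.const 1) (.mul (param 0) (param 1)))
    (.sub (here 0) (.div (param 1) (.ofIdx (.var 0)))))

/-- The program for parameters for which the model is defined. -/
def mainProgram : Cmd :=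
  .seq sampleAll
  (.seq (fill 11 diagInd)
  (.seq inputBlock
  (.seq (.loop 6 (qPow 14) fwBody)
  (.seq sigmaBlock
  (.seq noiseBlock roundBlock)))))

/-- The program; its output is constant if the model is not defined. -/
def weakRecoveryProgram : Cmd :=
  .ifLe (param 0) (.const 1)
    (.ifLe (.mul (.add (.const 1) (param 0)) (param 1)) (.ofIdx (.var 0)) mainProgram .skip) .skip

end Program

theorem qPow_inputOnly (k : ℕ) : (qPow k).InputOnly := by
  induction k with
  | zero => trivial
  | succ k ih => exact ⟨ih, le_refl 1⟩

theorem qPow_eval (k : ℕ) (s : State) : (qPow k).eval s = s.idx 1 ^ k := by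
  induction k with
  | zero => rfl
  | succ k ih => rw [pow_succ, ← ih]; rfl

theorem var_zero_inputOnly : (IdxExpr.var 0).InputOnly := Nat.zero_le 1

theorem fill_tame (a : ℕ) (e : RealExpr) : (fill a e).Tame := fillSum_tame (b := .const 1) trivial e

theorem powerBlock_tame : powerBlock.Tame :=
  ⟨fillSum_tame var_zero_inputOnly _, fillSum_tame var_zero_inputOnly _, fill_tame _ _,
    fill_tame _ _, ⟨by norm_num, qPow_inputOnly _, fillSum_tame var_zero_inputOnly _,
      fill_tame _ _⟩, fillSum_tame var_zero_inputOnly _⟩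

theorem fwBody_tame : fwBody.Tame :=
  ⟨fill_tame _ _, powerBlock_tame, fillSum_tame var_zero_inputOnly _, fill_tame _ _,
    fill_tame _ _⟩

theorem weakRecoveryProgram_tame : weakRecoveryProgram.Tame := by
  refine ⟨⟨⟨⟨le_refl 2, var_zero_inputOnly, by norm_num, var_zero_inputOnly, trivial⟩,
    fill_tame _ _, fill_tame _ _, ⟨by norm_num, qPow_inputOnly _, fwBody_tame⟩,
    ⟨fill_tame _ _, fill_tame _ _⟩, fill_tame _ _, powerBlock_tame,
    fillSum_tame var_zero_inputOnly _, fill_tame _ _, ⟨(by norm_num : 2 ≤ 7), le_refl 2,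
      var_zero_inputOnly, (by norm_num : 2 ≤ 7), trivial⟩, fill_tame _ _⟩, trivial⟩, trivial⟩

/-! ## Semantics of the program -/

/-- The array `a` as a matrix. -/
def State.mat (s : State) (n a : ℕ) : Matrix (Fin n) (Fin n) ℝ := Matrix.of fun i j => s.mem a i j

theorem State.mat_apply (s : State) (n a : ℕ) (i j : Fin n) : s.mat n a i j = s.mem a i j := rfl

theorem Frame.mat {V A : List ℕ} {s s' : State} (h : Frame V A s s') (n : ℕ) {b : ℕ}
    (hb : b ∉ A) : s'.mat n b = s.mat n b := by
  simp only [State.mat, h.2.2 b hb]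

theorem fillSum_mat {a : ℕ} {e : RealExpr} (he : e.Avoids a) (ω : ℕ → ℝ) (s : State) {n : ℕ}
    (hn : s.idx 0 = n) :
    Frame [2, 3, 4] [a] s ((fillSum a (.var 0) e).run ω s) ∧
      ((fillSum a (.var 0) e).run ω s).mat n a =
        Matrix.of fun i j : Fin n => ∑ k : Fin n, e.eval (s.at3 i j k) := by
  obtain ⟨h1, h2⟩ := fillSum_spec (a := a) var_zero_inputOnly he ω s
  refine ⟨h1, ?_⟩
  ext i j
  rw [State.mat_apply, h2 i (by omega) j (by omega), show (IdxExpr.var 0).eval s = n from hn,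
    Finset.sum_range]
  rfl

theorem fill_mat {a : ℕ} {e : RealExpr} (he : e.Avoids a) (ω : ℕ → ℝ) (s : State) {n : ℕ}
    (hn : s.idx 0 = n) :
    Frame [2, 3, 4] [a] s ((fill a e).run ω s) ∧
      ((fill a e).run ω s).mat n a = Matrix.of fun i j : Fin n => e.eval (s.at3 i j 0) := by
  obtain ⟨h1, h2⟩ := fillSum_spec (a := a) (b := .const 1) trivial he ω s
  refine ⟨h1, ?_⟩
  ext i j
  rw [State.mat_apply, fill, h2 i (by omega) j (by omega)]
  simp [IdxExpr.eval]

theorem State.at3_idx_two (s : State) (i j k : ℕ) : (s.at3 i j k).idx 2 = i := by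
  simp [State.at3, State.setVar, Function.update]

theorem State.at3_idx_three (s : State) (i j k : ℕ) : (s.at3 i j k).idx 3 = j := by
  simp [State.at3, State.setVar, Function.update]

theorem State.at3_idx_four (s : State) (i j k : ℕ) : (s.at3 i j k).idx 4 = k := by
  simp [State.at3, State.setVar, Function.update]

theorem State.at3_idx_of_notMem (s : State) (i j k : ℕ) {x : ℕ} (hx : x ∉ [2, 3, 4]) :
    (s.at3 i j k).idx x = s.idx x := by
  simp only [List.mem_cons, List.not_mem_nil, or_false, not_or] at hx
  simp [State.at3, State.setVar, Function.update, hx]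

theorem State.at3_mem (s : State) (i j k : ℕ) : (s.at3 i j k).mem = s.mem := rfl

theorem here_eval (s : State) {n : ℕ} (i j : Fin n) (k a : ℕ) :
    (here a).eval (s.at3 i j k) = s.mat n a i j := by
  simp [here, RealExpr.eval, IdxExpr.eval, State.at3_idx_two, State.at3_idx_three, State.at3_mem,
    State.mat_apply]

theorem cell_two_four_eval (s : State) {n : ℕ} (i j k : Fin n) (a : ℕ) :
    (RealExpr.cell a (.var 2) (.var 4)).eval (s.at3 i j k) = s.mat n a i k := by
  simp [RealExpr.eval, IdxExpr.eval, State.at3_idx_two, State.at3_idx_four, State.at3_mem,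
    State.mat_apply]

theorem cell_four_three_eval (s : State) {n : ℕ} (i j k : Fin n) (a : ℕ) :
    (RealExpr.cell a (.var 4) (.var 3)).eval (s.at3 i j k) = s.mat n a k j := by
  simp [RealExpr.eval, IdxExpr.eval, State.at3_idx_three, State.at3_idx_four, State.at3_mem,
    State.mat_apply]

theorem cell_four_four_eval (s : State) {n : ℕ} (i j k : Fin n) (a : ℕ) :
    (RealExpr.cell a (.var 4) (.var 4)).eval (s.at3 i j k) = s.mat n a k k := by
  simp [RealExpr.eval, IdxExpr.eval, State.at3_idx_four, State.at3_mem, State.mat_apply]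

theorem cell_two_two_eval (s : State) {n : ℕ} (i j : Fin n) (k a : ℕ) :
    (RealExpr.cell a (.var 2) (.var 2)).eval (s.at3 i j k) = s.mat n a i i := by
  simp [RealExpr.eval, IdxExpr.eval, State.at3_idx_two, State.at3_mem, State.mat_apply]

theorem cell_three_two_eval (s : State) {n : ℕ} (i j : Fin n) (k a : ℕ) :
    (RealExpr.cell a (.var 3) (.var 2)).eval (s.at3 i j k) = s.mat n a j i := by
  simp [RealExpr.eval, IdxExpr.eval, State.at3_idx_two, State.at3_idx_three, State.at3_mem,
    State.mat_apply]

theorem mul_mat {a b c : ℕ} (ha : b ≠ a ∧ c ≠ a) (ω : ℕ → ℝ) (s : State) {n : ℕ}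
    (hn : s.idx 0 = n) :
    Frame [2, 3, 4] [a] s ((fillSum a (.var 0) (prodExpr b c)).run ω s) ∧
      ((fillSum a (.var 0) (prodExpr b c)).run ω s).mat n a = s.mat n b * s.mat n c := by
  obtain ⟨h1, h2⟩ := fillSum_mat (a := a) (e := prodExpr b c) ha ω s hn
  refine ⟨h1, h2.trans ?_⟩
  ext i j
  simp only [Matrix.of_apply, prodExpr, Matrix.mul_apply]
  refine Finset.sum_congr rfl fun k _ => ?_
  rw [← cell_two_four_eval s i j k, ← cell_four_three_eval s i j k]
  rfl

theorem copy_mat {a b : ℕ} (ha : b ≠ a) (ω : ℕ → ℝ) (s : State) {n : ℕ} (hn : s.idx 0 = n) :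
    Frame [2, 3, 4] [a] s ((fill a (here b)).run ω s) ∧
      ((fill a (here b)).run ω s).mat n a = s.mat n b := by
  obtain ⟨h1, h2⟩ := fill_mat (a := a) (e := here b) ha ω s hn
  refine ⟨h1, h2.trans ?_⟩
  ext i j
  exact here_eval s i j 0 b

/-- Absolute values come from `√(x·x)`, and `(t + |t|)/2` is the positive part of `t = 1 - |i - j|`;
integrality of `i - j` makes it an indicator. -/
theorem diagInd_eval (s : State) {n : ℕ} (i j : Fin n) (k : ℕ) :
    diagInd.eval (s.at3 i j k) = (1 : Matrix (Fin n) (Fin n) ℝ) i j := by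
  simp only [diagInd, idxDiff, RealExpr.eval, IdxExpr.eval, State.at3_idx_two,
    State.at3_idx_three, Real.sqrt_mul_self_eq_abs]
  rcases eq_or_ne i j with rfl | h
  · norm_num
  · rw [Matrix.one_apply_ne h]
    have h1 : (1 : ℝ) ≤ |((i : ℕ) : ℝ) - ((j : ℕ) : ℝ)| := by
      have h2 : ((i : ℕ) : ℤ) - ((j : ℕ) : ℤ) ≠ 0 := by
        intro h3
        exact h (Fin.ext (by omega))
      have h3 := Int.one_le_abs h2
      exact_mod_cast h3
    generalize |((i : ℕ) : ℝ) - ((j : ℕ) : ℝ)| = r at h1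
    rw [abs_of_nonpos (by push_cast; linarith)]
    push_cast
    ring

/-- The offset `1/2` keeps `j - i + 1/2` away from `0`, so the quotient by its absolute value is a
genuine sign. -/
theorem upperInd_eval (s : State) {n : ℕ} (i j : Fin n) (k : ℕ) :
    upperInd.eval (s.at3 i j k) = if i ≤ j then 1 else 0 := by
  simp only [upperInd, halfDiff, idxDiff, RealExpr.eval, IdxExpr.eval, State.at3_idx_two,
    State.at3_idx_three, Real.sqrt_mul_self_eq_abs]
  push_cast
  split_ifs with h
  · have h1 : ((i : ℕ) : ℝ) ≤ ((j : ℕ) : ℝ) := by exact_mod_cast h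
    rw [abs_of_pos (by linarith), div_self (by linarith)]
    norm_num
  · have h1 : ((j : ℕ) : ℝ) + 1 ≤ ((i : ℕ) : ℝ) := by
      have : j < i := not_le.mp h
      exact_mod_cast this
    have h2 : (1 / 2 : ℝ) - (((i : ℕ) : ℝ) - ((j : ℕ) : ℝ)) < 0 := by linarith
    rw [abs_of_neg h2, div_neg, div_self h2.ne]
    norm_num

theorem loop_induction {x : ℕ} {b : IdxExpr} {c : Cmd} {ω : ℕ → ℝ} {s : State}
    (Inv : ℕ → State → Prop) (h0 : Inv 0 (s.tick (b.cost + 1)))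
    (hs : ∀ k < b.eval s, ∀ t, Inv k t → Inv (k + 1) (c.run ω ((t.setVar x k).tick 1))) :
    Inv (b.eval s) ((Cmd.loop x b c).run ω s) :=
  foldl_range_induction (fun s' k => c.run ω ((s'.setVar x k).tick 1)) Inv h0 (b.eval s) hs

theorem frame_setVar (t : State) (x k m : ℕ) : Frame [x] [] t ((t.setVar x k).tick m) := by
  refine ⟨rfl, fun y hy => ?_, fun _ _ => rfl⟩
  have : y ≠ x := by simpa using hy
  simp [State.tick, State.setVar, Function.update, this]

theorem setVar_idx_self (t : State) (x k m : ℕ) : ((t.setVar x k).tick m).idx x = k := by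
  simp [State.tick, State.setVar, Function.update]

theorem powerBlock_spec (ω : ℕ → ℝ) (s : State) {n : ℕ} (hn : s.idx 0 = n)
    (h11 : s.mat n 11 = 1) :
    Frame [2, 3, 4, 5] [6, 7, 8, 9, 10] s (powerBlock.run ω s) ∧
      (powerBlock.run ω s).mat n 6 = shiftMat (s.mat n 5) ∧
      (powerBlock.run ω s).mat n 7 = shiftMat (s.mat n 5) ^ (s.idx 1 ^ 15) ∧
      (powerBlock.run ω s).mat n 9 = shiftMat (s.mat n 5) ^ (2 * s.idx 1 ^ 15) := by
  set s₁ := (fillSum 8 (.var 0)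
    (.mul (.cell 5 (.var 2) (.var 4)) (.cell 5 (.var 2) (.var 4)))).run ω s with hs₁
  obtain ⟨f₁, m₁⟩ := fillSum_mat (a := 8) (e := .mul (.cell 5 (.var 2) (.var 4))
    (.cell 5 (.var 2) (.var 4))) (by simp [RealExpr.Avoids]) ω s hn
  rw [← hs₁] at f₁ m₁
  set s₂ := (fillSum 10 (.var 0) (.cell 8 (.var 4) (.var 3))).run ω s₁ with hs₂
  have n₁ : s₁.idx 0 = n := (f₁.2.1 0 (by simp)).trans hn
  obtain ⟨f₂, m₂⟩ := fillSum_mat (a := 10) (e := .cell 8 (.var 4) (.var 3))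
    (by simp [RealExpr.Avoids]) ω s₁ n₁
  rw [← hs₂] at f₂ m₂
  have g₂ : Frame [2, 3, 4, 5] [6, 7, 8, 9, 10] s s₂ :=
    f₁.trans f₂ (by simp) (by simp) (by simp) (by simp)
  have n₂ : s₂.idx 0 = n := (g₂.2.1 0 (by simp)).trans hn
  -- Two successive sums, over columns and then over rows, put `‖Z‖_F²` into every entry of array
  -- `10`.
  have hF : ∀ i j, s₂.mat n 10 i j = frobSq (s.mat n 5) := by
    intro i j
    rw [m₂, frobSq]
    simp only [Matrix.of_apply]
    refine Finset.sum_congr rfl fun k _ => ?_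
    rw [cell_four_three_eval, m₁]
    simp only [Matrix.of_apply]
    refine Finset.sum_congr rfl fun l _ => ?_
    rw [← cell_two_four_eval s k j l, sq]
    rfl
  set s₃ := (fill 6 (.add (here 5) (.mul (.add (.const 1) (.sqrt (here 10))) (here 11)))).run ω s₂
    with hs₃
  obtain ⟨f₃, m₃⟩ := fill_mat (a := 6)
    (e := .add (here 5) (.mul (.add (.const 1) (.sqrt (here 10))) (here 11)))
    (by simp [RealExpr.Avoids, here]) ω s₂ n₂
  rw [← hs₃] at f₃ m₃
  have g₃ : Frame [2, 3, 4, 5] [6, 7, 8, 9, 10] s s₃ :=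
    g₂.trans f₃ (by simp) (by simp) (by simp) (by simp)
  have n₃ : s₃.idx 0 = n := (g₃.2.1 0 (by simp)).trans hn
  have B₃ : s₃.mat n 6 = shiftMat (s.mat n 5) := by
    rw [m₃]
    ext i j
    simp only [Matrix.of_apply, RealExpr.eval, here_eval, hF, shiftMat, Matrix.add_apply,
      Matrix.smul_apply, smul_eq_mul, g₂.mat n (b := 5) (by simp), g₂.mat n (b := 11) (by simp),
      h11, frobNorm]
    push_cast
    ring
  set s₄ := (fill 7 (here 11)).run ω s₃ with hs₄
  obtain ⟨f₄, m₄⟩ := copy_mat (a := 7) (b := 11) (by simp) ω s₃ n₃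
  rw [← hs₄] at f₄ m₄
  have g₄ : Frame [2, 3, 4, 5] [6, 7, 8, 9, 10] s s₄ :=
    g₃.trans f₄ (by simp) (by simp) (by simp) (by simp)
  have B₄ : s₄.mat n 6 = shiftMat (s.mat n 5) := (f₄.mat n (by simp)).trans B₃
  have C₄ : s₄.mat n 7 = 1 := by rw [m₄, g₃.mat n (by simp), h11]
  set s₅ := (Cmd.loop 5 (qPow 15)
    (.seq (fillSum 8 (.var 0) (prodExpr 7 6)) (fill 7 (here 8)))).run ω s₄ with hs₅
  -- Each round multiplies into array `8` and copies back, because `fillSum` must not read the array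
  -- that it fills. The counter is variable `5`, as `2, 3, 4` are overwritten.
  have key : Frame [2, 3, 4, 5] [6, 7, 8, 9, 10] s s₅ ∧ s₅.mat n 6 = shiftMat (s.mat n 5) ∧
      s₅.mat n 7 = shiftMat (s.mat n 5) ^ ((qPow 15).eval s₄) := by
    refine loop_induction (fun k t => Frame [2, 3, 4, 5] [6, 7, 8, 9, 10] s t ∧
      t.mat n 6 = shiftMat (s.mat n 5) ∧ t.mat n 7 = shiftMat (s.mat n 5) ^ k)
      ⟨g₄, B₄, by rw [pow_zero]; exact C₄⟩ ?_
    rintro k - t ⟨ft, bt, ct⟩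
    set t₁ := (t.setVar 5 k).tick 1 with ht₁
    have ft₁ : Frame [2, 3, 4, 5] [6, 7, 8, 9, 10] s t₁ :=
      ft.trans (frame_setVar t 5 k 1) (by simp) (by simp) (by simp) (by simp)
    obtain ⟨f₆, m₆⟩ := mul_mat (a := 8) (b := 7) (c := 6) (by simp) ω t₁ (n := n)
      ((ft₁.2.1 0 (by simp)).trans hn)
    simp only [Cmd.run]
    set t₂ := (fillSum 8 (.var 0) (prodExpr 7 6)).run ω t₁ with ht₂
    have ft₂ : Frame [2, 3, 4, 5] [6, 7, 8, 9, 10] s t₂ :=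
      ft₁.trans f₆ (by simp) (by simp) (by simp) (by simp)
    obtain ⟨f₇, m₇⟩ := copy_mat (a := 7) (b := 8) (by simp) ω t₂ (n := n)
      ((ft₂.2.1 0 (by simp)).trans hn)
    refine ⟨ft₂.trans f₇ (by simp) (by simp) (by simp) (by simp), ?_, ?_⟩
    · rw [f₇.mat n (by simp), f₆.mat n (by simp)]
      exact bt
    · rw [m₇, m₆, pow_succ, ← ct, ← bt]
      rfl
  obtain ⟨g₅, B₅, C₅⟩ := key
  rw [qPow_eval, g₄.2.1 1 (by simp)] at C₅
  obtain ⟨f₆, m₆⟩ := mul_mat (a := 9) (b := 7) (c := 7) (by simp) ω s₅ (n := n)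
    ((g₅.2.1 0 (by simp)).trans hn)
  have hrun : powerBlock.run ω s = (fillSum 9 (.var 0) (prodExpr 7 7)).run ω s₅ := rfl
  rw [hrun]
  refine ⟨g₅.trans f₆ (by simp) (by simp) (by simp) (by simp), ?_, ?_, ?_⟩
  · rw [f₆.mat n (by simp), B₅]
  · rw [f₆.mat n (by simp), C₅]
  · rw [m₆, C₅, two_mul, pow_add]

theorem fwBody_spec (ω : ℕ → ℝ) (s : State) {n : ℕ} (hn : s.idx 0 = n) (h11 : s.mat n 11 = 1) :
    Frame [2, 3, 4, 5] [4, 5, 6, 7, 8, 9, 10] s (fwBody.run ω s) ∧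
      (fwBody.run ω s).mat n 4 = s.mat n 4 + (2 / ((s.idx 6 : ℝ) + 2)) •
        (lmo (s.idx 1 ^ 15) (negGrad ((s.idx 1 : ℝ) ^ 9) (s.mat n 3) (s.mat n 4)) - s.mat n 4) := by
  have hav : (RealExpr.sub (.sub (here 3) (here 4)) (.mul (.ofIdx (qPow 9))
    (.mul (here 11) (.sub (here 4) (.div (.const 1) (.ofIdx (.var 0))))))).Avoids 5 := by
    simp [RealExpr.Avoids, here]
  obtain ⟨f₁, m₁⟩ := fill_mat hav ω s hn
  set s₁ := (fill 5 (RealExpr.sub (.sub (here 3) (here 4)) (.mul (.ofIdx (qPow 9))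
    (.mul (here 11) (.sub (here 4) (.div (.const 1) (.ofIdx (.var 0)))))))).run ω s with hs₁
  have Z₁ : s₁.mat n 5 = negGrad ((s.idx 1 : ℝ) ^ 9) (s.mat n 3) (s.mat n 4) := by
    rw [m₁]
    ext i j
    have h0 : ∀ i j : ℕ, (IdxExpr.var 0).eval (s.at3 i j 0) = n := fun i j =>
      (s.at3_idx_of_notMem i j 0 (x := 0) (by simp)).trans hn
    have h9 : ∀ i j : ℕ, (qPow 9).eval (s.at3 i j 0) = s.idx 1 ^ 9 := fun i j => by
      rw [qPow_eval, s.at3_idx_of_notMem i j 0 (x := 1) (by simp)]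
    simp only [Matrix.of_apply, RealExpr.eval, here_eval, h0, h9, h11, negGrad, diagDev,
      Matrix.sub_apply, Matrix.smul_apply, smul_eq_mul, Matrix.diagonal_apply, Matrix.one_apply]
    split_ifs with h
    · subst h
      push_cast
      ring
    · push_cast
      ring
  have n₁ : s₁.idx 0 = n := (f₁.2.1 0 (by simp)).trans hn
  obtain ⟨f₂, -, -, m₂⟩ := powerBlock_spec ω s₁ n₁ ((f₁.mat n (by simp)).trans h11)
  set s₂ := powerBlock.run ω s₁ with hs₂
  have g₂ : Frame [2, 3, 4, 5] [4, 5, 6, 7, 8, 9, 10] s s₂ :=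
    f₁.trans f₂ (by simp) (by simp) (by simp) (by simp)
  have X₂ : s₂.mat n 4 = s.mat n 4 := by rw [f₂.mat n (by simp), f₁.mat n (by simp)]
  rw [Z₁, f₁.2.1 1 (by simp)] at m₂
  obtain ⟨f₃, m₃⟩ := fillSum_mat (a := 10) (e := .cell 9 (.var 4) (.var 4))
    (by simp [RealExpr.Avoids]) ω s₂ (n := n) ((g₂.2.1 0 (by simp)).trans hn)
  set s₃ := (fillSum 10 (.var 0) (.cell 9 (.var 4) (.var 4))).run ω s₂ with hs₃
  have g₃ : Frame [2, 3, 4, 5] [4, 5, 6, 7, 8, 9, 10] s s₃ :=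
    g₂.trans f₃ (by simp) (by simp) (by simp) (by simp)
  have T₃ : ∀ i j, s₃.mat n 10 i j = (s₂.mat n 9).trace := by
    intro i j
    rw [m₃]
    simp only [Matrix.of_apply, cell_four_four_eval, Matrix.trace, Matrix.diag_apply]
  have hav4 : (RealExpr.add (here 4) (.mul (.div (.const 2) (.add (.ofIdx (.var 6)) (.const 2)))
    (.sub (.mul (.div (.const 1) (here 10)) (here 9)) (here 4)))).Avoids 8 := by
    simp [RealExpr.Avoids, here]
  obtain ⟨f₄, m₄⟩ := fill_mat hav4 ω s₃ (n := n) ((g₃.2.1 0 (by simp)).trans hn)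
  set s₄ := (fill 8 (RealExpr.add (here 4) (.mul (.div (.const 2) (.add (.ofIdx (.var 6))
    (.const 2))) (.sub (.mul (.div (.const 1) (here 10)) (here 9)) (here 4))))).run ω s₃ with hs₄
  have g₄ : Frame [2, 3, 4, 5] [4, 5, 6, 7, 8, 9, 10] s s₄ :=
    g₃.trans f₄ (by simp) (by simp) (by simp) (by simp)
  obtain ⟨f₅, m₅⟩ := copy_mat (a := 4) (b := 8) (by simp) ω s₄ (n := n)
    ((g₄.2.1 0 (by simp)).trans hn)
  have hrun : fwBody.run ω s = (fill 4 (here 8)).run ω s₄ := rfl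
  rw [hrun]
  refine ⟨g₄.trans f₅ (by simp) (by simp) (by simp) (by simp), ?_⟩
  rw [m₅, m₄]
  ext i j
  have h6 : ∀ i j : ℕ, (IdxExpr.var 6).eval (s₃.at3 i j 0) = s.idx 6 := fun i j =>
    (s₃.at3_idx_of_notMem i j 0 (x := 6) (by simp)).trans (g₃.2.1 6 (by simp))
  simp only [Matrix.of_apply, RealExpr.eval, here_eval, h6, T₃, f₃.mat n (b := 4) (by simp),
    f₃.mat n (b := 9) (by simp), X₂, m₂, lmo, Matrix.add_apply, Matrix.sub_apply,
    Matrix.smul_apply, smul_eq_mul]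
  push_cast
  ring


/-! ### Argmax, rounding and measurability of the output -/

/-- Fold that finds a position `b < m` of a maximum of `r` on `[0, m)`. -/
def argmaxFold (r : ℕ → ℝ) (m : ℕ) : ℕ :=
  (List.range m).foldl (fun b k => if r b ≤ r k then k else b) 0

theorem argmaxFold_succ (r : ℕ → ℝ) (m : ℕ) :
    argmaxFold r (m + 1) = if r (argmaxFold r m) ≤ r m then m else argmaxFold r m := by
  rw [argmaxFold, List.range_succ, List.foldl_append]
  rfl

theorem argmaxFold_spec (r : ℕ → ℝ) (m : ℕ) :
    (0 < m → argmaxFold r m < m) ∧ ∀ i < m, r i ≤ r (argmaxFold r m) := by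
  induction m with
  | zero => simp
  | succ m ih =>
    rw [argmaxFold_succ]
    split_ifs with h
    · refine ⟨fun _ => Nat.lt_succ_self m, fun i hi => ?_⟩
      rcases Nat.lt_succ_iff_lt_or_eq.mp hi with h' | rfl
      · exact (ih.2 i h').trans h
      · exact le_rfl
    · refine ⟨fun _ => ?_, fun i hi => ?_⟩
      · rcases Nat.eq_zero_or_pos m with rfl | hm
        · simp [argmaxFold]
        · exact (ih.1 hm).trans (Nat.lt_succ_self m)
      · rcases Nat.lt_succ_iff_lt_or_eq.mp hi with h' | rfl
        · exact ih.2 i h'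
        · exact (not_le.mp h).le

theorem argmaxFold_congr {r r' : ℕ → ℝ} {m : ℕ} (h : ∀ i < m, r i = r' i) :
    argmaxFold r m = argmaxFold r' m := by
  induction m with
  | zero => rfl
  | succ m ih =>
    have ih' := ih fun i hi => h i (Nat.lt_succ_of_lt hi)
    rw [argmaxFold_succ, argmaxFold_succ, ih', h m (Nat.lt_succ_self m)]
    rcases Nat.eq_zero_or_pos m with rfl | hm
    · split_ifs <;> rfl
    · rw [h _ (((argmaxFold_spec r' m).1 hm).trans (Nat.lt_succ_self m))]

theorem measurable_argmaxFold {α : Type*} [MeasurableSpace α] {r : α → ℕ → ℝ}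
    (hr : ∀ i, Measurable fun x => r x i) (m : ℕ) : Measurable fun x => argmaxFold (r x) m := by
  induction m with
  | zero => exact measurable_const
  | succ m ih =>
    simp only [argmaxFold_succ]
    have h1 : Measurable fun x => r x (argmaxFold (r x) m) := by
      have h2 : Measurable fun p : ℕ × α => r p.2 p.1 := measurable_from_prod_countable_right hr
      exact h2.comp (ih.prodMk measurable_id)
    exact Measurable.ite (measurableSet_le h1 (hr m)) measurable_const ih

/-- The diagonal ratios `(B ^ (2 k + 1))ᵢᵢ / (B ^ (2 k))ᵢᵢ` for `B = shiftMat Z`. -/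
def diagRatio {n : ℕ} (k : ℕ) (Z : Matrix (Fin n) (Fin n) ℝ) (i : ℕ) : ℝ :=
  if h : i < n then (shiftMat Z ^ (2 * k) * shiftMat Z) ⟨i, h⟩ ⟨i, h⟩ /
    (shiftMat Z ^ (2 * k)) ⟨i, h⟩ ⟨i, h⟩ else 0

/-- The column of `shiftMat Z ^ k` with the largest diagonal ratio. -/
def topColumn {n : ℕ} (k : ℕ) (Z : Matrix (Fin n) (Fin n) ℝ) (i : Fin n) : ℝ :=
  (shiftMat Z ^ k) i ⟨argmaxFold (diagRatio k Z) n,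
    (argmaxFold_spec _ n).1 ((Nat.zero_le _).trans_lt i.2)⟩

theorem exists_unit_signVec_topColumn {n : ℕ} (hn : 0 < n) (k : ℕ)
    {Z : Matrix (Fin n) (Fin n) ℝ} (hZ : Z.IsSymm) :
    ∃ u : Fin n → ℝ, u ⬝ᵥ u = 1 ∧ signVec u = signVec (topColumn k Z) ∧
      ∀ w, w ⬝ᵥ w = 1 →
        quadForm Z w ≤ quadForm Z u + n * (1 + 2 * frobNorm Z) / (2 * k + 1) := by
  obtain ⟨S⟩ := spectralData_shiftMat hn hZ
  refine quadForm_le_best_column S k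
    (b := ⟨argmaxFold (diagRatio k Z) n, (argmaxFold_spec _ n).1 hn⟩) fun i => ?_
  have h := (argmaxFold_spec (diagRatio k Z) n).2 i i.2
  simpa only [diagRatio, i.2, (argmaxFold_spec (diagRatio k Z) n).1 hn, dif_pos] using h

/-- The argmax is a measurable integer-valued function, so measurability of an entry at that
position is checked on each of countably many values. -/
theorem measurable_topColumn {n : ℕ} (k : ℕ) (i : Fin n) :
    Measurable fun X : Fin n → Fin n → ℝ => topColumn k (Matrix.of X) i := by
  have hn : 0 < n := (Nat.zero_le _).trans_lt i.2
  have hr : ∀ l, Measurable fun X : Fin n → Fin n → ℝ => diagRatio k (Matrix.of X) l := by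
    intro l
    unfold diagRatio
    split_ifs with h
    · refine Measurable.div ?_ (measurable_shiftMat_pow _ _ _)
      simp_rw [← pow_succ]
      exact measurable_shiftMat_pow _ _ _
    · exact measurable_const
  have hb := measurable_argmaxFold hr n
  have h2 : Measurable fun p : ℕ × (Fin n → Fin n → ℝ) =>
      if h : p.1 < n then (shiftMat (Matrix.of p.2) ^ k) i ⟨p.1, h⟩ else 0 := by
    refine measurable_from_prod_countable_right fun l => ?_
    by_cases h : l < n
    · simp only [h, dif_pos]
      exact measurable_shiftMat_pow k i ⟨l, h⟩
    · simp only [h, dif_neg, not_false_eq_true]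
      exact measurable_const
  have h3 := h2.comp (hb.prodMk measurable_id)
  convert h3 using 1
  funext X
  have := (argmaxFold_spec (diagRatio k (Matrix.of X)) n).1 hn
  simp only [Function.comp, id, dif_pos this, topColumn]

theorem measurableSet_signVec {n : ℕ} {f : (Fin n → Fin n → ℝ) → Fin n → ℝ}
    (hf : ∀ i, Measurable fun X => f X i) (S : Set (Labels n)) :
    MeasurableSet {X | signVec (f X) ∈ S} := by
  have h : {X | signVec (f X) ∈ S} = ⋃ y ∈ S, ⋂ i, {X | signVec (f X) i = y i} := by
    ext X
    simp only [Set.mem_ofPred_eq, Set.mem_iUnion, Set.mem_iInter]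
    refine ⟨fun h => ⟨_, h, fun i => rfl⟩, fun ⟨y, hy, h⟩ => ?_⟩
    rwa [show signVec (f X) = y from funext h]
  rw [h]
  refine MeasurableSet.biUnion (Set.to_countable S) fun y _ => MeasurableSet.iInter fun i => ?_
  have h0 : MeasurableSet {X | 0 ≤ f X i} := measurableSet_le measurable_const (hf i)
  by_cases hy : y i = 1
  · convert h0 using 1
    ext X
    simp only [signVec, Set.mem_ofPred_eq, hy]
    split_ifs with h
    · simp [h]
    · simp only [h, iff_false]
      decide
  · have hy' : y i = -1 := (Int.units_eq_one_or (y i)).resolve_left hy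
    convert h0.compl using 1
    ext X
    simp only [signVec, Set.mem_ofPred_eq, hy', Set.mem_compl_iff]
    split_ifs with h
    · simp only [h, not_true_eq_false, iff_false]
      decide
    · simp [h]

/-! ## The blocks of the main program -/

/-- Entry `(i, j)` receives draw number `i n + j`. `Frame` is not used here, since it asserts that
no draws are made. -/
theorem sampleAll_spec (ω : ℕ → ℝ) (s : State) {n : ℕ} (hn : s.idx 0 = n) (hd : s.draws = 0) :
    (∀ x, x ∉ [2, 3] → (sampleAll.run ω s).idx x = s.idx x) ∧
      (∀ b, b ∉ [12] → (sampleAll.run ω s).mem b = s.mem b) ∧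
      ∀ i < n, ∀ j < n, (sampleAll.run ω s).mem 12 i j = ω (i * n + j) := by
  have key := loop_induction (x := 2) (b := .var 0)
    (c := .loop 3 (.var 0) (.sample 12 (.var 2) (.var 3))) (ω := ω) (s := s)
    (fun m t => (∀ x, x ∉ [2, 3] → t.idx x = s.idx x) ∧
      (∀ b, b ∉ [12] → t.mem b = s.mem b) ∧ t.draws = m * n ∧
      ∀ i < m, ∀ j < n, t.mem 12 i j = ω (i * n + j)) ?_ ?_
  · rw [show (IdxExpr.var 0).eval s = n from hn] at key
    exact ⟨key.1, key.2.1, key.2.2.2⟩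
  · exact ⟨fun _ _ => rfl, fun _ _ => rfl, by simpa [State.tick] using hd, by simp⟩
  · rintro m - t ⟨h1, h2, h3, h4⟩
    set t₁ := (t.setVar 2 m).tick 1 with ht₁
    have i₁ : ∀ x, x ∉ [2, 3] → t₁.idx x = s.idx x := fun x hx => by
      rw [← h1 x hx]
      refine (frame_setVar t 2 m 1).2.1 x ?_
      simp only [List.mem_cons, List.not_mem_nil, or_false, not_or] at hx ⊢
      exact hx.1
    have key2 := loop_induction (x := 3) (b := .var 0)
      (c := .sample 12 (.var 2) (.var 3)) (ω := ω) (s := t₁)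
      (fun l r => (∀ x, x ∉ [2, 3] → r.idx x = s.idx x) ∧ r.idx 2 = m ∧
        (∀ b, b ∉ [12] → r.mem b = s.mem b) ∧ r.draws = m * n + l ∧
        (∀ i < m, ∀ j < n, r.mem 12 i j = ω (i * n + j)) ∧
        ∀ j < l, r.mem 12 m j = ω (m * n + j)) ?_ ?_
    · have hb : (IdxExpr.var 0).eval t₁ = n := (i₁ 0 (by simp)).trans hn
      rw [hb] at key2
      obtain ⟨k1, -, k3, k4, k5, k6⟩ := key2
      refine ⟨k1, k3, by rw [k4]; ring, fun i hi j hj => ?_⟩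
      rcases Nat.lt_succ_iff_lt_or_eq.mp hi with h | rfl
      · exact k5 i h j hj
      · exact k6 j hj
    · exact ⟨i₁, setVar_idx_self t 2 m 1, h2, h3, h4, by simp⟩
    · rintro l - r ⟨k1, k2, k3, k4, k5, k6⟩
      have e2 : ((r.setVar 3 l).tick 1).idx 2 = m := by
        rw [(frame_setVar r 3 l 1).2.1 2 (by simp), k2]
      have e3 := setVar_idx_self r 3 l 1
      have e4 : ((r.setVar 3 l).tick 1).draws = m * n + l := k4
      have hm : ∀ b i j, ((Cmd.sample 12 (.var 2) (.var 3)).run ω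
          ((r.setVar 3 l).tick 1)).mem b i j =
          if b = 12 ∧ i = m ∧ j = l then ω (m * n + l) else r.mem b i j := by
        intro b i j
        have h5 : ∀ t : State, ((Cmd.sample 12 (.var 2) (.var 3)).run ω t).mem b i j =
            if b = 12 ∧ i = t.idx 2 ∧ j = t.idx 3 then ω t.draws else t.mem b i j :=
          fun _ => rfl
        rw [h5]
        simp only [e2, e3, e4]
        rfl
      refine ⟨fun x hx => ?_, e2, fun b hb => ?_, ?_, fun i hi j hj => ?_, fun j hj => ?_⟩
      · rw [← k1 x hx]
        refine (frame_setVar r 3 l 1).2.1 x ?_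
        simp only [List.mem_cons, List.not_mem_nil, or_false, not_or] at hx ⊢
        exact hx.2
      · rw [← k3 b hb]
        funext i j
        rw [hm, if_neg]
        intro h
        exact hb (by simp [h.1])
      · show ((r.setVar 3 l).tick 1).draws + 1 = _
        rw [e4, add_assoc]
      · rw [hm, if_neg (by omega)]
        exact k5 i hi j hj
      · rw [hm]
        rcases Nat.lt_succ_iff_lt_or_eq.mp hj with h | rfl
        · rw [if_neg (by omega)]
          exact k6 j h
        · simp

theorem argmaxBlock_spec (ω : ℕ → ℝ) (s : State) {n : ℕ} (hn : s.idx 0 = n) :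
    Frame [2, 7] [] s (argmaxBlock.run ω s) ∧
      (argmaxBlock.run ω s).idx 7 = argmaxFold (fun i => s.mem 10 i 0) n := by
  set s₁ := (Cmd.setIdx 7 (.const 0)).run ω s with hs₁
  have f₁ : Frame [2, 7] [] s s₁ :=
    (frame_setVar s 7 0 _).mono (by simp) (by simp)
  have h7 : s₁.idx 7 = 0 := setVar_idx_self s 7 0 _
  have key : Frame [2, 7] [] s (argmaxBlock.run ω s) ∧ (argmaxBlock.run ω s).idx 7 =
      argmaxFold (fun i => s.mem 10 i 0) ((IdxExpr.var 0).eval s₁) := by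
    refine loop_induction (s := s₁) (fun m t => Frame [2, 7] [] s t ∧
      t.idx 7 = argmaxFold (fun i => s.mem 10 i 0) m) ⟨f₁, h7⟩ ?_
    rintro m - t ⟨ft, h⟩
    set t₁ := (t.setVar 2 m).tick 1 with ht₁
    have ft₁ : Frame [2, 7] [] s t₁ :=
      ft.trans (frame_setVar t 2 m 1) (by simp) (by simp) (by simp) (by simp)
    have e2 : t₁.idx 2 = m := setVar_idx_self t 2 m 1
    have e7 : t₁.idx 7 = argmaxFold (fun i => s.mem 10 i 0) m := by
      rw [(frame_setVar t 2 m 1).2.1 7 (by simp), h]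
    simp only [Cmd.run, RealExpr.eval, IdxExpr.eval, e2, e7, ft₁.2.2 10 (by simp)]
    rw [argmaxFold_succ]
    split_ifs
    · refine ⟨ft₁.trans (V' := [7]) (A' := []) ⟨rfl, fun x hx => ?_, fun _ _ => rfl⟩ (by simp)
        (by simp) (by simp) (by simp), ?_⟩
      · have h7 : x ≠ 7 := by simpa using hx
        exact Function.update_of_ne h7 _ _
      · exact Function.update_self (β := fun _ => ℕ) 7 m t₁.idx
    · exact ⟨ft₁, e7⟩
  rw [show (IdxExpr.var 0).eval s₁ = n from (f₁.2.1 0 (by simp)).trans hn] at key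
  exact key

theorem roundBlock_spec (ω : ℕ → ℝ) (s : State) {n : ℕ} (hn : s.idx 0 = n)
    (h11 : s.mat n 11 = 1) (i : Fin n) :
    (roundBlock.run ω s).mem 2 i 0 = topColumn (s.idx 1 ^ 15) (s.mat n 5) i := by
  have hpos : 0 < n := (Nat.zero_le _).trans_lt i.2
  obtain ⟨f₁, b₁, p₁, q₁⟩ := powerBlock_spec ω s hn h11
  set s₁ := powerBlock.run ω s with hs₁
  have n₁ : s₁.idx 0 = n := (f₁.2.1 0 (by simp)).trans hn
  obtain ⟨f₂, m₂⟩ := mul_mat (a := 8) (b := 9) (c := 6) (by simp) ω s₁ n₁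
  set s₂ := (fillSum 8 (.var 0) (prodExpr 9 6)).run ω s₁ with hs₂
  have n₂ : s₂.idx 0 = n := (f₂.2.1 0 (by simp)).trans n₁
  obtain ⟨f₃, m₃⟩ := fill_mat (a := 10)
    (e := .div (.cell 8 (.var 2) (.var 2)) (.cell 9 (.var 2) (.var 2)))
    (by simp [RealExpr.Avoids]) ω s₂ n₂
  set s₃ := (fill 10 (.div (.cell 8 (.var 2) (.var 2)) (.cell 9 (.var 2) (.var 2)))).run ω s₂
    with hs₃
  have n₃ : s₃.idx 0 = n := (f₃.2.1 0 (by simp)).trans n₂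
  obtain ⟨f₄, m₄⟩ := argmaxBlock_spec ω s₃ n₃
  set s₄ := argmaxBlock.run ω s₃ with hs₄
  have n₄ : s₄.idx 0 = n := (f₄.2.1 0 (by simp)).trans n₃
  obtain ⟨-, m₅⟩ := fill_mat (a := 2) (e := .cell 7 (.var 2) (.var 7))
    (by simp [RealExpr.Avoids]) ω s₄ n₄
  have hrun : roundBlock.run ω s = (fill 2 (.cell 7 (.var 2) (.var 7))).run ω s₄ := rfl
  have hr : argmaxFold (fun i => s₃.mem 10 i 0) n =
      argmaxFold (diagRatio (s.idx 1 ^ 15) (s.mat n 5)) n := by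
    refine argmaxFold_congr fun l hl => ?_
    have h1 := congrFun (congrFun m₃ ⟨l, hl⟩) ⟨0, hpos⟩
    rw [State.mat_apply] at h1
    rw [h1, Matrix.of_apply, diagRatio, dif_pos hl]
    show (RealExpr.cell 8 (.var 2) (.var 2)).eval _ / (RealExpr.cell 9 (.var 2) (.var 2)).eval _ = _
    rw [cell_two_two_eval, cell_two_two_eval, m₂, f₂.mat n (b := 9) (by simp), q₁, b₁]
  have h7 : s₄.mat n 7 = shiftMat (s.mat n 5) ^ (s.idx 1 ^ 15) := by
    rw [f₄.mat n (by simp), f₃.mat n (by simp), f₂.mat n (by simp), p₁]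
  rw [hrun]
  have h1 := congrFun (congrFun m₅ i) ⟨0, hpos⟩
  rw [State.mat_apply] at h1
  rw [h1, topColumn, ← h7, State.mat_apply]
  simp only [Matrix.of_apply, RealExpr.eval, IdxExpr.eval, State.at3_idx_two, State.at3_mem,
    s₄.at3_idx_of_notMem _ _ _ (x := 7) (by simp), m₄, hr]

theorem noiseBlock_spec (ω : ℕ → ℝ) (s : State) {n : ℕ} (hn : s.idx 0 = n) {σ : ℝ}
    (hσ : ∀ i j, s.mat n 13 i j = σ) :
    Frame [2, 3, 4] [5] s (noiseBlock.run ω s) ∧ (noiseBlock.run ω s).mat n 5 =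
      s.mat n 4 + symmFill fun i j => σ * s.mat n 12 i j := by
  obtain ⟨f, m⟩ := fill_mat (a := 5) (e := .add (here 4) (.mul (here 13) (.add
    (.mul upperInd (here 12)) (.mul (.sub (.const 1) upperInd) (.cell 12 (.var 3) (.var 2))))))
    (by simp [RealExpr.Avoids, here, upperInd, halfDiff, idxDiff]) ω s hn
  refine ⟨f, m.trans ?_⟩
  ext i j
  have h1 := fun k => upperInd_eval s i j k
  have h2 := fun k => cell_three_two_eval s i j k 12
  have h3 : ∀ e f : RealExpr, ∀ t, (RealExpr.add e f).eval t = e.eval t + f.eval t :=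
    fun _ _ _ => rfl
  have h4 : ∀ e f : RealExpr, ∀ t, (RealExpr.mul e f).eval t = e.eval t * f.eval t :=
    fun _ _ _ => rfl
  have h5 : ∀ e f : RealExpr, ∀ t, (RealExpr.sub e f).eval t = e.eval t - f.eval t :=
    fun _ _ _ => rfl
  have h6 : ∀ c t, (RealExpr.const c).eval t = (c : ℝ) := fun _ _ => rfl
  simp only [Matrix.of_apply, Matrix.add_apply, h3, h4, h5, h6, h1, h2, here_eval, hσ, symmFill]
  split_ifs <;> (push_cast; ring)

/-- The variance of the noise that the program adds. -/
def progVar (n : ℕ) (γ d ε δ : ℝ) : ℝ :=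
  24 / ((n : ℝ) * γ * d) * (Real.log (2 / δ) / ε ^ 2 + if ε ≤ 1 then 0 else 1)

theorem sigmaBlock_spec (ω : ℕ → ℝ) (s : State) {n : ℕ} (hn : s.idx 0 = n) :
    Frame [2, 3, 4] [13] s (sigmaBlock.run ω s) ∧ ∀ i j, (sigmaBlock.run ω s).mat n 13 i j =
      √(progVar n (s.mem 1 0 0) (s.mem 1 0 1) (s.mem 1 0 2) (s.mem 1 0 3)) := by
  set s₁ := s.tick ((param 2).cost + (RealExpr.const 1).cost + 1) with hs₁
  have hc : (param 2).eval s ≤ (RealExpr.const 1).eval s ↔ s.mem 1 0 2 ≤ 1 := by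
    simp [param, RealExpr.eval, IdxExpr.eval]
  have h0 : ∀ i j : ℕ, (s₁.at3 i j 0).idx 0 = n := fun i j =>
    (s₁.at3_idx_of_notMem i j 0 (by simp)).trans hn
  have hmem : s₁.mem = s.mem := rfl
  simp only [sigmaBlock, Cmd.run]
  split_ifs with h
  · rw [hc] at h
    obtain ⟨f, m⟩ := fill_mat (a := 13) (e := noiseExpr privacyExpr)
      (by simp [RealExpr.Avoids, noiseExpr, privacyExpr, param]) ω s₁ hn
    refine ⟨f, fun i j => ?_⟩
    rw [m]
    simp only [Matrix.of_apply, noiseExpr, privacyExpr, param, RealExpr.eval, IdxExpr.eval, h0,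
      State.at3_mem, hmem, progVar, if_pos h]
    push_cast
    rw [add_zero, sq]
  · rw [hc] at h
    obtain ⟨f, m⟩ := fill_mat (a := 13) (e := noiseExpr (.add privacyExpr (.const 1)))
      (by simp [RealExpr.Avoids, noiseExpr, privacyExpr, param]) ω s₁ hn
    refine ⟨f, fun i j => ?_⟩
    rw [m]
    simp only [Matrix.of_apply, noiseExpr, privacyExpr, param, RealExpr.eval, IdxExpr.eval, h0,
      State.at3_mem, hmem, progVar, if_neg h]
    push_cast
    rw [sq]

theorem fwLoop_spec (ω : ℕ → ℝ) (s : State) {n : ℕ} (hn : s.idx 0 = n)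
    (h11 : s.mat n 11 = 1) (h4 : s.mat n 4 = 0) :
    Frame [2, 3, 4, 5, 6] [4, 5, 6, 7, 8, 9, 10] s
      ((Cmd.loop 6 (qPow 14) fwBody).run ω s) ∧
    ((Cmd.loop 6 (qPow 14) fwBody).run ω s).mat n 4 = approxProj (s.idx 1) (s.mat n 3) := by
  have key : Frame [2, 3, 4, 5, 6] [4, 5, 6, 7, 8, 9, 10] s
      ((Cmd.loop 6 (qPow 14) fwBody).run ω s) ∧
      ((Cmd.loop 6 (qPow 14) fwBody).run ω s).mat n 4 =
        fwIter ((s.idx 1 : ℝ) ^ 9) (s.idx 1 ^ 15) (s.mat n 3) ((qPow 14).eval s) := by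
    refine loop_induction (fun m t => Frame [2, 3, 4, 5, 6] [4, 5, 6, 7, 8, 9, 10] s t ∧
      t.mat n 4 = fwIter ((s.idx 1 : ℝ) ^ 9) (s.idx 1 ^ 15) (s.mat n 3) m) ⟨Frame.refl _ _ s, h4⟩ ?_
    rintro m - t ⟨ft, h⟩
    set t₁ := (t.setVar 6 m).tick 1 with ht₁
    have ft₁ : Frame [2, 3, 4, 5, 6] [4, 5, 6, 7, 8, 9, 10] s t₁ :=
      ft.trans (frame_setVar t 6 m 1) (by simp) (by simp) (by simp) (by simp)
    obtain ⟨f, e⟩ := fwBody_spec ω t₁ (n := n) ((ft₁.2.1 0 (by simp)).trans hn)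
      ((ft₁.mat n (by simp)).trans h11)
    refine ⟨ft₁.trans f (by simp) (by simp) (by simp) (by simp), ?_⟩
    rw [e, ft₁.2.1 1 (by simp), ft₁.mat n (b := 3) (by simp),
      show t₁.idx 6 = m from setVar_idx_self t 6 m 1, show t₁.mat n 4 = t.mat n 4 from rfl, h]
    rfl
  rw [qPow_eval] at key
  exact key

open Classical in
theorem inputBlock_spec (ω : ℕ → ℝ) (s : State) {n : ℕ} (hn : s.idx 0 = n)
    (G : SimpleGraph (Fin n)) {q : ℕ} {γ d ε δ : ℝ}
    (h0 : s.mem 0 = (initState q γ d ε δ G).mem 0) (h1 : s.mem 1 = (initState q γ d ε δ G).mem 1) :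
    Frame [2, 3, 4] [3] s (inputBlock.run ω s) ∧
      (inputBlock.run ω s).mat n 3 = rescaledAdj γ d G := by
  obtain ⟨f, m⟩ := fill_mat (a := 3) (e := .mul (.div (.const 1) (.mul (param 0) (param 1)))
    (.sub (here 0) (.div (param 1) (.ofIdx (.var 0)))))
    (by simp [RealExpr.Avoids, here, param]) ω s hn
  refine ⟨f, m.trans ?_⟩
  ext i j
  have hi : (s.at3 i j 0).idx 0 = n := (s.at3_idx_of_notMem i j 0 (by simp)).trans hn
  have hA : s.mat n 0 i j = if G.Adj i j then 1 else 0 := by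
    rw [State.mat_apply, h0]
    simp [initState, i.2, j.2]
  simp only [Matrix.of_apply, RealExpr.eval, here_eval, param, IdxExpr.eval, State.at3_mem, h1,
    hi, hA, rescaledAdj]
  simp [initState]

theorem mainProgram_spec {n : ℕ} {q : ℕ} {γ d ε δ : ℝ} {G : SimpleGraph (Fin n)} (ω : ℕ → ℝ)
    {s : State} (hs : s.idx = (initState q γ d ε δ G).idx)
    (hm : s.mem = (initState q γ d ε δ G).mem) (hd : s.draws = 0) (i : Fin n) :
    (mainProgram.run ω s).mem 2 i 0 =
      topColumn (q ^ 15) (approxProj q (rescaledAdj γ d G) + symmFill fun i j =>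
        √(progVar n γ d ε δ) * ω (i * n + j)) i := by
  have n₀ : s.idx 0 = n := by rw [hs]; rfl
  obtain ⟨i₁, a₁, w₁⟩ := sampleAll_spec ω s n₀ hd
  set s₁ := sampleAll.run ω s with hs₁
  have n₁ : s₁.idx 0 = n := (i₁ 0 (by simp)).trans n₀
  obtain ⟨f₂, m₂⟩ := fill_mat (a := 11) (e := diagInd)
    (by simp [RealExpr.Avoids, diagInd, idxDiff]) ω s₁ n₁
  set s₂ := (fill 11 diagInd).run ω s₁ with hs₂
  have n₂ : s₂.idx 0 = n := (f₂.2.1 0 (by simp)).trans n₁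
  have d₂ : s₂.mat n 11 = 1 := by
    rw [m₂]
    ext i j
    exact diagInd_eval s₁ i j 0
  obtain ⟨f₃, m₃⟩ := inputBlock_spec ω s₂ n₂ G (q := q) (γ := γ) (d := d) (ε := ε) (δ := δ)
    (by rw [f₂.2.2 0 (by simp), a₁ 0 (by simp), hm])
    (by rw [f₂.2.2 1 (by simp), a₁ 1 (by simp), hm])
  set s₃ := inputBlock.run ω s₂ with hs₃
  have n₃ : s₃.idx 0 = n := (f₃.2.1 0 (by simp)).trans n₂
  have x₃ : s₃.mat n 4 = 0 := by
    rw [f₃.mat n (by simp), f₂.mat n (by simp)]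
    ext i j
    rw [State.mat_apply, a₁ 4 (by simp)]
    simp [hm, initState]
  obtain ⟨f₄, m₄⟩ := fwLoop_spec ω s₃ n₃ ((f₃.mat n (by simp)).trans d₂) x₃
  set s₄ := (Cmd.loop 6 (qPow 14) fwBody).run ω s₃ with hs₄
  have n₄ : s₄.idx 0 = n := (f₄.2.1 0 (by simp)).trans n₃
  have q₃ : s₃.idx 1 = q := by
    rw [f₃.2.1 1 (by simp), f₂.2.1 1 (by simp), i₁ 1 (by simp), hs]
    rfl
  rw [q₃, m₃] at m₄
  have p₄ : s₄.mem 1 = s.mem 1 := by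
    rw [f₄.2.2 1 (by simp), f₃.2.2 1 (by simp), f₂.2.2 1 (by simp), a₁ 1 (by simp)]
  obtain ⟨f₅, m₅⟩ := sigmaBlock_spec ω s₄ n₄
  set s₅ := sigmaBlock.run ω s₄ with hs₅
  have n₅ : s₅.idx 0 = n := (f₅.2.1 0 (by simp)).trans n₄
  obtain ⟨f₆, m₆⟩ := noiseBlock_spec ω s₅ n₅ m₅
  set s₆ := noiseBlock.run ω s₅ with hs₆
  have n₆ : s₆.idx 0 = n := (f₆.2.1 0 (by simp)).trans n₅
  have d₆ : s₆.mat n 11 = 1 := by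
    rw [f₆.mat n (by simp), f₅.mat n (by simp), f₄.mat n (by simp), f₃.mat n (by simp), d₂]
  have q₆ : s₆.idx 1 = q := by
    rw [f₆.2.1 1 (by simp), f₅.2.1 1 (by simp), f₄.2.1 1 (by simp), q₃]
  have w₅ : ∀ i j : Fin n, s₅.mat n 12 i j = ω (i * n + j) := by
    intro i j
    rw [f₅.mat n (by simp), f₄.mat n (by simp), f₃.mat n (by simp), f₂.mat n (by simp),
      State.mat_apply, w₁ i i.2 j j.2]
  have hrun : mainProgram.run ω s = roundBlock.run ω s₆ := rfl
  have e₀ : s.mem 1 0 0 = γ := by simp [hm, initState]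
  have e₁ : s.mem 1 0 1 = d := by simp [hm, initState]
  have e₂ : s.mem 1 0 2 = ε := by simp [hm, initState]
  have e₃ : s.mem 1 0 3 = δ := by simp [hm, initState]
  rw [hrun, roundBlock_spec ω s₆ n₆ d₆ i, q₆, m₆, f₅.mat n (b := 4) (by simp), m₄, p₄, e₀, e₁,
    e₂, e₃]
  simp only [w₅]

theorem output_of_defined {n : ℕ} (q : ℕ) {γ d : ℝ} (ε δ : ℝ) (hγ : γ ≤ 1)
    (hd : (1 + γ) * d ≤ n) (G : SimpleGraph (Fin n)) (ω : ℕ → ℝ) :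
    output weakRecoveryProgram q γ d ε δ G ω =
      signVec (topColumn (q ^ 15) (approxProj q (rescaledAdj γ d G) + symmFill fun i j =>
        √(progVar n γ d ε δ) * ω (i * n + j))) := by
  unfold output finalState
  congr 1
  funext i
  set s := initState q γ d ε δ G with hs
  have h1 : ∀ c, (param 0).eval (s.tick c) ≤ (RealExpr.const 1).eval (s.tick c) := fun c => by
    simpa [RealExpr.eval, IdxExpr.eval, param, State.tick, hs, initState] using hγ
  have h2 : ∀ c, (RealExpr.mul (.add (.const 1) (param 0)) (param 1)).eval (s.tick c) ≤
      (RealExpr.ofIdx (.var 0)).eval (s.tick c) := fun c => by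
    simpa [RealExpr.eval, IdxExpr.eval, param, State.tick, hs, initState] using hd
  have h3 : ∃ c c', weakRecoveryProgram.run ω s = mainProgram.run ω ((s.tick c).tick c') :=
    ⟨_, _, (if_pos (h1 0)).trans (if_pos (h2 _))⟩
  obtain ⟨c, c', h3⟩ := h3
  rw [h3]
  exact mainProgram_spec (s := (s.tick c).tick c') ω rfl rfl rfl i

theorem output_of_not_defined {n : ℕ} (q : ℕ) {γ d : ℝ} (ε δ : ℝ)
    (h : ¬ (γ ≤ 1 ∧ (1 + γ) * d ≤ n)) (G : SimpleGraph (Fin n)) (ω : ℕ → ℝ) :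
    output weakRecoveryProgram q γ d ε δ G ω = signVec 0 := by
  unfold output finalState
  congr 1
  funext i
  unfold weakRecoveryProgram
  have h1 : ∀ c, (param 0).eval ((initState q γ d ε δ G).tick c) = γ := fun c => by
    simp [RealExpr.eval, IdxExpr.eval, param, State.tick, initState]
  rw [Cmd.run]
  split_ifs with h2
  · rw [Cmd.run, if_neg]
    · simp [Cmd.run, State.tick, initState]
    · intro h3
      refine h ⟨?_, ?_⟩
      · simpa [RealExpr.eval, IdxExpr.eval, param, State.tick, initState] using h2
      · simpa [RealExpr.eval, IdxExpr.eval, param, State.tick, initState] using h3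
  · simp [Cmd.run, State.tick, initState]


/-! ## Privacy and utility -/

theorem log_two_div {δ : ℝ} (hδ : 0 < δ) (hδ1 : δ ≤ 1) :
    Real.log (2 / δ) = Real.log 2 + Real.log (1 / δ) ∧ 0 ≤ Real.log (1 / δ) ∧
      1 / 2 < Real.log 2 := by
  refine ⟨?_, Real.log_nonneg ((one_le_div hδ).2 hδ1), by linarith [Real.log_two_gt_d9]⟩
  rw [Real.log_div two_ne_zero hδ.ne', Real.log_div one_ne_zero hδ.ne', Real.log_one]
  ring

theorem progVar_of_le_one {n : ℕ} {γ d ε δ : ℝ} (hε : ε ≤ 1) :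
    progVar n γ d ε δ = noiseVar n γ d ε δ := by
  rw [progVar, noiseVar, if_pos hε, add_zero]

theorem noiseVar_pos {n : ℕ} {γ d ε δ : ℝ} (hn : 0 < n) (hγ : 0 < γ) (hd : 0 < d) (hε : 0 < ε)
    (hδ : 0 < δ) (hδ1 : δ ≤ 1) : 0 < noiseVar n γ d ε δ := by
  obtain ⟨h1, h2, h3⟩ := log_two_div hδ hδ1
  have h4 : 0 < Real.log (2 / δ) := by linarith
  have h5 : (0 : ℝ) < n := Nat.cast_pos.2 hn
  unfold noiseVar
  positivity

theorem noiseVar_le_progVar {n : ℕ} {γ d ε δ : ℝ} (hγ : 0 < γ) (hd : 0 < d) :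
    noiseVar n γ d ε δ ≤ progVar n γ d ε δ := by
  unfold noiseVar progVar
  refine mul_le_mul_of_nonneg_left ?_ (by positivity)
  split_ifs <;> linarith

/-- The exact projection has squared sensitivity `4/(nγd)`; the allowance `6/(nγd)` leaves room for
the computational error of the program. -/
theorem private_of_frobSq_le {n : ℕ} {γ d ε δ : ℝ} (hn : 0 < n) (hγ : 0 < γ) (hd : 0 < d)
    (hε : 0 < ε) (hδ : 0 < δ) (hδ1 : δ ≤ 1) {Ω : Type} [MeasurableSpace Ω] {μ : Measure Ω}
    [IsProbabilityMeasure μ] {ξ : Fin n × Fin n → Ω → ℝ}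
    (h : IsGaussianFamily μ (progVar n γ d ε δ).toNNReal ξ) {M M' : Matrix (Fin n) (Fin n) ℝ}
    (hM : M.IsSymm) (hM' : M'.IsSymm) (ha : frobSq (M - M') ≤ 6 / (n * γ * d))
    {A : Set (Fin n → Fin n → ℝ)} (hA : MeasurableSet A) :
    μ {ω | (fun i j => (M + symmFill fun i j => ξ (i, j) ω) i j) ∈ A} ≤
      ENNReal.ofReal (Real.exp ε) *
        μ {ω | (fun i j => (M' + symmFill fun i j => ξ (i, j) ω) i j) ∈ A} +
          ENNReal.ofReal δ := by
  have hv : 0 < progVar n γ d ε δ :=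
    (noiseVar_pos hn hγ hd hε hδ hδ1).trans_le (noiseVar_le_progVar hγ hd)
  have hnp : (0 : ℝ) < n := Nat.cast_pos.2 hn
  obtain ⟨h1, h2, h3⟩ := log_two_div hδ hδ1
  have hL : 1 / 2 < Real.log (2 / δ) := by linarith
  set a := Real.log (2 / δ) / ε ^ 2 + if ε ≤ 1 then 0 else 1 with ha'
  have hb : 0 < Real.log (2 / δ) / ε ^ 2 := by positivity
  have hapos : 0 < a := by rw [ha']; split_ifs <;> linarith
  have he2 : ε ^ 2 * (Real.log (2 / δ) / ε ^ 2) = Real.log (2 / δ) := by field_simp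
  -- The variance is `24a/(nγd)`, so `ρ = 1/(4a)` makes `ρv` equal to `6/(nγd)`. Then `ε²/ρ = 4ε²a`,
  -- which is `4 log(2/δ)` for `ε ≤ 1`. For `ε > 1` the extra `1` in `a` adds `4ε²` and so dominates
  -- the subtracted `ε`.
  refine gaussianMechanism (ρ := 1 / (4 * a)) (Real.toNNReal_pos.2 hv).ne' h hM hM'
    (by positivity) ?_ hδ ?_ ?_ hA
  · rw [Real.coe_toNNReal _ hv.le]
    refine ha.trans (le_of_eq ?_)
    rw [progVar, ← ha']
    field_simp
    norm_num
  · rw [div_div, div_le_iff₀ (by positivity)]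
    rw [ha']
    split_ifs with h4
    · have h5 : ε * (Real.log (2 / δ) / ε ^ 2) * ε =
          Real.log (2 / δ) := Eq.trans (by ring) he2
      have h6 : ε * (Real.log (2 / δ) / ε ^ 2) * ε ≤ ε * (Real.log (2 / δ) / ε ^ 2) * 1 :=
        mul_le_mul_of_nonneg_left h4 (by positivity)
      rw [h5] at h6
      nlinarith
    · have h5 : 0 < ε * (Real.log (2 / δ) / ε ^ 2) := by positivity
      nlinarith
  · have h4 : ε ^ 2 / (1 / (4 * a)) = 4 * (ε ^ 2 * a) := by field_simp
    rw [h4, ha', mul_add, he2]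
    split_ifs with h5
    · linarith
    · nlinarith

theorem isSymm_proj {n : ℕ} (Y : Matrix (Fin n) (Fin n) ℝ) : (proj Y).IsSymm :=
  isSymm_of_posSemidef (proj_mem Y).1

theorem pos_of_adjacentGraphs {n : ℕ} {G G' : SimpleGraph (Fin n)} (h : AdjacentGraphs G G') :
    0 < n := by
  obtain ⟨a, -⟩ := exists_edge_of_adjacent h
  exact (Nat.zero_le _).trans_lt a.2

theorem isEdgeDP_weakRecovery {n : ℕ} {γ d ε δ : ℝ} (hγ : 0 < γ) (hd : 0 < d)
    (hε : 0 < ε) (hε1 : ε ≤ 1) (hδ : 0 < δ) (hδ1 : δ ≤ 1)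
    {v : (Fin n → Fin n → ℝ) → (Fin n → ℝ)} (hv : Measurable v) :
    IsEdgeDP (gaussianArray n (noiseVar n γ d ε δ)) (weakRecovery γ d v) ε δ := by
  intro G G' hG S
  have hn := pos_of_adjacentGraphs hG
  have hg := isGaussianFamily_gaussianArray (n := n) (progVar n γ d ε δ)
  have h6 : (4 : ℝ) / (n * γ * d) ≤ 6 / (n * γ * d) := by gcongr; norm_num
  have key := private_of_frobSq_le hn hγ hd hε hδ hδ1 hg (isSymm_proj (rescaledAdj γ d G))
    (isSymm_proj (rescaledAdj γ d G')) ((frobSq_proj_rescaledAdj_sub_le hγ hd hG).trans h6)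
    (measurableSet_signVec (f := v) (fun i => (measurable_pi_apply i).comp hv) S)
  rw [progVar_of_le_one hε1] at key
  exact key

theorem rescaledAdj_isSymm {n : ℕ} (γ d : ℝ) (G : SimpleGraph (Fin n)) :
    (rescaledAdj γ d G).IsSymm := by
  ext i j
  by_cases h : G.Adj i j <;> simp [rescaledAdj, G.adj_comm j i, h]

/-- The size constraints that hold when the model is defined. -/
theorem bounds_of_defined {n : ℕ} {γ d : ℝ} (hγ : 0 < γ) (hd : 0 < d)
    (h : 12800 ≤ γ * √d) (hγ1 : γ ≤ 1) (hdn : (1 + γ) * d ≤ n) :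
    80 ≤ n ∧ 1 ≤ d ∧ 1 ≤ γ * d ∧ d ≤ n ∧ γ * √d ≤ γ * d ∧ γ * √d ≤ n := by
  have hs : 0 ≤ √d := Real.sqrt_nonneg d
  have h1 : 12800 ≤ √d := h.trans (by nlinarith)
  have h2 : √d * √d = d := Real.mul_self_sqrt hd.le
  have h3 : √d ≤ d := by nlinarith
  have h4 : d ≤ n := by nlinarith
  have h5 : γ * √d ≤ γ * d := by gcongr
  refine ⟨?_, by linarith, by linarith, h4, h5, by nlinarith⟩
  have : (80 : ℝ) ≤ n := by linarith
  exact_mod_cast this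

theorem abs_rescaledAdj_le {n : ℕ} {γ d : ℝ} (hd : 0 < d) (hγd : 1 ≤ γ * d) (hdn : d ≤ n)
    (G : SimpleGraph (Fin n)) (i j : Fin n) : |rescaledAdj γ d G i j| ≤ 1 := by
  have hn : (0 : ℝ) < n := hd.trans_le hdn
  have h1 : d / n ≤ 1 := (div_le_one hn).2 hdn
  have h2 : 0 ≤ d / n := by positivity
  have h3 : 1 / (γ * d) ≤ 1 := (div_le_one (by linarith)).2 hγd
  have h4 : (0 : ℝ) ≤ 1 / (γ * d) := by positivity
  rw [rescaledAdj, Matrix.of_apply, abs_mul, abs_of_nonneg h4]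
  refine mul_le_one₀ h3 (abs_nonneg _) ?_
  rw [abs_le]
  split_ifs <;> constructor <;> linarith

theorem frobNorm_sub_comm {n : ℕ} (A B : Matrix (Fin n) (Fin n) ℝ) :
    frobNorm (A - B) = frobNorm (B - A) := by
  rw [← frobNorm_neg, neg_sub]

/-- With `N = nγd ≤ q²` each approximation error is at most `(1/80)/√N`, so the distance grows from
`2/√N` to at most `2.1/√N`. -/
theorem frobSq_sub_le_of_near {n q : ℕ} {P P' A A' : Matrix (Fin n) (Fin n) ℝ} {N : ℝ}
    (hN : 0 < N) (hq : 80 ≤ q) (hNq : N ≤ (q : ℝ) ^ 2)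
    (hA : frobSq (A - P) ≤ (1 / (q : ℝ) ^ 2) ^ 2) (hA' : frobSq (A' - P') ≤ (1 / (q : ℝ) ^ 2) ^ 2)
    (hP : frobSq (P - P') ≤ 4 / N) : frobSq (A - A') ≤ 6 / N := by
  have hq' : (80 : ℝ) ≤ q := by exact_mod_cast hq
  have hs : 0 < √N := Real.sqrt_pos.2 hN
  have h1 : frobNorm (A - P) ≤ 1 / (q : ℝ) ^ 2 := Real.sqrt_le_iff.2 ⟨by positivity, hA⟩
  have h2 : frobNorm (P' - A') ≤ 1 / (q : ℝ) ^ 2 := by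
    rw [frobNorm_sub_comm]
    exact Real.sqrt_le_iff.2 ⟨by positivity, hA'⟩
  have h3 : frobNorm (P - P') ≤ 2 / √N := by
    refine Real.sqrt_le_iff.2 ⟨by positivity, hP.trans (le_of_eq ?_)⟩
    rw [div_pow, Real.sq_sqrt hN.le]
    norm_num
  have h4 : 1 / (q : ℝ) ^ 2 ≤ 1 / 80 * (1 / √N) := by
    have h5 : √N ≤ q := Real.sqrt_le_iff.2 ⟨by linarith, hNq⟩
    have h6 : 1 / (q : ℝ) ^ 2 = 1 / q * (1 / q) := by ring
    rw [h6]
    gcongr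
  have h5 : A - A' = (A - P) + ((P - P') + (P' - A')) := by abel
  have h6 : frobNorm (A - A') ≤ 2.1 * (1 / √N) := by
    rw [h5]
    have := frobNorm_add_le (A - P) ((P - P') + (P' - A'))
    have := frobNorm_add_le (P - P') (P' - A')
    have h7 : 2 / √N = 2 * (1 / √N) := by ring
    have h8 : 0 < 1 / √N := by positivity
    linarith
  rw [← frobNorm_sq]
  calc frobNorm (A - A') ^ 2 ≤ (2.1 * (1 / √N)) ^ 2 := by
        have := frobNorm_nonneg (A - A')
        gcongr
    _ = 4.41 / N := by rw [mul_pow, div_pow, Real.sq_sqrt hN.le]; ring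
    _ ≤ 6 / N := by gcongr; norm_num

/-- The draw of the program that is used for the entry `(i, j)`. -/
def drawIdx {n : ℕ} (p : Fin n × Fin n) : ℕ := p.1 * n + p.2

theorem drawIdx_injective {n : ℕ} : Function.Injective (drawIdx (n := n)) := by
  intro p p' h
  have hn : 0 < n := (Nat.zero_le _).trans_lt p.1.2
  have h1 := congrArg (· % n) h
  have h2 := congrArg (· / n) h
  simp only [drawIdx, Nat.mul_comm _ n, Nat.mul_add_mod, Nat.mod_eq_of_lt (Fin.is_lt _)] at h1
  simp only [drawIdx, Nat.mul_comm _ n, Nat.mul_add_div hn, Nat.div_eq_of_lt (Fin.is_lt _),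
    add_zero] at h2
  exact Prod.ext (Fin.ext h2) (Fin.ext h1)

theorem symmFill_isSymm_add {n : ℕ} {X : Matrix (Fin n) (Fin n) ℝ} (hX : X.IsSymm)
    (g : Fin n → Fin n → ℝ) : (X + symmFill g).IsSymm := hX.add (symmFill_isSymm g)

/-- If the model is defined, this is the Gaussian mechanism on the approximate projections followed
by measurable post-processing. Otherwise the output is constant and privacy is trivial; whether the
model is defined depends on public parameters only. -/
theorem isEdgeDP_output {n q : ℕ} (hnq : n ≤ q) {γ d ε δ : ℝ} (hγ : 0 < γ) (hd : 0 < d)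
    (h : 12800 ≤ γ * √d) (hε : 0 < ε) (hδ : 0 < δ) (hδ1 : δ ≤ 1) :
    IsEdgeDP tapeLaw (output (n := n) weakRecoveryProgram q γ d ε δ) ε δ := by
  intro G G' hG S
  have hn := pos_of_adjacentGraphs hG
  by_cases hdef : γ ≤ 1 ∧ (1 + γ) * d ≤ n
  · obtain ⟨hγ1, hdn⟩ := hdef
    obtain ⟨h80, h1d, hγd, hdn', -, -⟩ := bounds_of_defined hγ hd h hγ1 hdn
    have hv : 0 < progVar n γ d ε δ :=
      (noiseVar_pos hn hγ hd hε hδ hδ1).trans_le (noiseVar_le_progVar hγ hd)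
    have hnp : (0 : ℝ) < n := Nat.cast_pos.2 hn
    have hnq' : (n : ℝ) ≤ q := by exact_mod_cast hnq
    obtain ⟨s1, a1⟩ := frobSq_approxProj_sub_le hn (h80.trans hnq) hnq (rescaledAdj_isSymm γ d G)
      (abs_rescaledAdj_le hd hγd hdn' G)
    obtain ⟨s2, a2⟩ := frobSq_approxProj_sub_le hn (h80.trans hnq) hnq (rescaledAdj_isSymm γ d G')
      (abs_rescaledAdj_le hd hγd hdn' G')
    have hN : (n : ℝ) * γ * d ≤ (q : ℝ) ^ 2 := by
      have h1 : γ * d ≤ q := by nlinarith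
      calc (n : ℝ) * γ * d = n * (γ * d) := by ring
        _ ≤ q * q := mul_le_mul hnq' h1 (by positivity) (by positivity)
        _ = (q : ℝ) ^ 2 := by ring
    have key := private_of_frobSq_le hn hγ hd hε hδ hδ1
      (isGaussianFamily_tapeLaw hv.le rfl (drawIdx_injective (n := n))) s1 s2
      (frobSq_sub_le_of_near (by positivity) (h80.trans hnq) hN a1 a2
        (frobSq_proj_rescaledAdj_sub_le hγ hd hG))
      (measurableSet_signVec (f := fun X => topColumn (q ^ 15) (Matrix.of X))
        (fun i => measurable_topColumn (q ^ 15) i) S)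
    simp only [output_of_defined q ε δ hγ1 hdn]
    exact key
  · simp only [output_of_not_defined q ε δ hdef]
    have h1 : (1 : ENNReal) ≤ ENNReal.ofReal (Real.exp ε) := by
      rw [← ENNReal.ofReal_one]
      exact ENNReal.ofReal_le_ofReal (Real.one_le_exp hε.le)
    calc tapeLaw {_ω | signVec (0 : Fin n → ℝ) ∈ S}
        ≤ ENNReal.ofReal (Real.exp ε) * tapeLaw {_ω | signVec (0 : Fin n → ℝ) ∈ S} :=
          le_mul_of_one_le_left' h1
      _ ≤ _ := le_self_add

/-- The power `q^15` reduces the rounding error `n(1 + 2‖Z‖_F)/(2q^15 + 1)` below `(1 + ‖Z‖_F)/q`.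
-/
theorem exists_unit_output {n q : ℕ} (hnq : n ≤ q) {γ d : ℝ} (ε δ : ℝ) (hγ : 0 < γ) (hd : 0 < d)
    (h : 12800 ≤ γ * √d) (hγ1 : γ ≤ 1) (hdn : (1 + γ) * d ≤ n) (G : SimpleGraph (Fin n))
    (ω : ℕ → ℝ) : ∃ u : Fin n → ℝ,
      frobSq (approxProj q (rescaledAdj γ d G) - proj (rescaledAdj γ d G)) ≤ (1 / (q : ℝ)) ^ 2 ∧
      u ⬝ᵥ u = 1 ∧
      (∀ w : Fin n → ℝ, w ⬝ᵥ w = 1 →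
        quadForm (approxProj q (rescaledAdj γ d G) +
            symmFill fun i j => √(progVar n γ d ε δ) * ω (drawIdx (i, j))) w ≤
          quadForm (approxProj q (rescaledAdj γ d G) +
            symmFill fun i j => √(progVar n γ d ε δ) * ω (drawIdx (i, j))) u +
          (1 + √(frobSq (approxProj q (rescaledAdj γ d G) +
            symmFill fun i j => √(progVar n γ d ε δ) * ω (drawIdx (i, j))))) / q) ∧
      output weakRecoveryProgram q γ d ε δ G ω = signVec u := by
  obtain ⟨h80, h1d, hγd, hdn', -, -⟩ := bounds_of_defined hγ hd h hγ1 hdn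
  have hn : 0 < n := by omega
  have hnq' : (n : ℝ) ≤ q := by exact_mod_cast hnq
  have hq : (1 : ℝ) ≤ q := by
    have : 1 ≤ q := by omega
    exact_mod_cast this
  obtain ⟨hs, ha⟩ := frobSq_approxProj_sub_le hn (h80.trans hnq) hnq (rescaledAdj_isSymm γ d G)
    (abs_rescaledAdj_le hd hγd hdn' G)
  set Z := approxProj q (rescaledAdj γ d G) +
    symmFill fun i j => √(progVar n γ d ε δ) * ω (drawIdx (i, j)) with hZ
  obtain ⟨u, hu, hsign, hopt⟩ :=
    exists_unit_signVec_topColumn hn (q ^ 15) (symmFill_isSymm_add hs _ : Z.IsSymm)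
  refine ⟨u, ha.trans ?_, hu, fun w hw => (hopt w hw).trans ?_, ?_⟩
  · gcongr
    nlinarith
  · refine add_le_add le_rfl ?_
    have hF : 0 ≤ frobNorm Z := frobNorm_nonneg Z
    change _ ≤ (1 + frobNorm Z) / q
    push_cast
    rw [div_le_div_iff₀ (by positivity) (by positivity)]
    have h2 : (q : ℝ) ^ 2 ≤ (q : ℝ) ^ 15 := pow_le_pow_right₀ hq (by norm_num)
    calc n * (1 + 2 * frobNorm Z) * q ≤ q * (2 * (1 + frobNorm Z)) * q := by
          gcongr
          linarith
      _ = (1 + frobNorm Z) * (2 * (q : ℝ) ^ 2) := by ring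
      _ ≤ (1 + frobNorm Z) * (2 * (q : ℝ) ^ 15 + 1) := by gcongr; linarith
  · rw [output_of_defined q ε δ hγ1 hdn, hsign]
    rfl

/-- The extra noise for `ε > 1` and the term `100/n` are both absorbed by `1/(γ√d)`, because `γ√d ≤
γd` and `γ√d ≤ n`. -/
theorem errBound_ge {n : ℕ} {γ d ε δ v : ℝ} (hγ : 0 < γ) (hd : 0 < d) (h : 12800 ≤ γ * √d)
    (hγ1 : γ ≤ 1) (hdn : (1 + γ) * d ≤ n) (hδ : 0 < δ) (hδ1 : δ ≤ 1)
    (hv : v ≤ progVar n γ d ε δ) :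
    50 * (3072 / (γ * √d)) + 80 * (576 * (v * n)) + 100 / n ≤ 2000000 * errBound γ d ε δ := by
  obtain ⟨h80, h1d, hγd, hdn', h5, h6⟩ := bounds_of_defined hγ hd h hγ1 hdn
  obtain ⟨h1, h2, h3⟩ := log_two_div hδ hδ1
  have hn : (0 : ℝ) < n := hd.trans_le hdn'
  have hs : 0 < γ * √d := by linarith
  have hb : 0 ≤ Real.log (2 / δ) / ε ^ 2 := div_nonneg (by linarith) (sq_nonneg ε)
  have e1 : v * n ≤ 24 * (1 / (γ * d) * (Real.log (2 / δ) / ε ^ 2)) + 24 * (1 / (γ * √d)) := by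
    calc v * n ≤ progVar n γ d ε δ * n := by gcongr
      _ = 24 * (1 / (γ * d) * (Real.log (2 / δ) / ε ^ 2)) +
          24 * (1 / (γ * d)) * (if ε ≤ 1 then 0 else 1) := by
        rw [progVar]
        generalize (if ε ≤ 1 then (0 : ℝ) else 1) = e
        generalize Real.log (2 / δ) / ε ^ 2 = b
        field_simp
      _ ≤ _ := by
        have h7 : 1 / (γ * d) ≤ 1 / (γ * √d) := one_div_le_one_div_of_le hs h5
        have h8 : 0 < 1 / (γ * d) := by positivity
        refine add_le_add le_rfl ?_
        split_ifs <;> linarith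
  have e2 : (100 : ℝ) / n ≤ 100 * (1 / (γ * √d)) := by
    rw [div_eq_mul_one_div]
    exact mul_le_mul_of_nonneg_left (one_div_le_one_div_of_le hs h6) (by norm_num)
  have e3 : (3072 : ℝ) / (γ * √d) = 3072 * (1 / (γ * √d)) := by ring
  have e4 : 0 ≤ 1 / (γ * d) * (Real.log (2 / δ) / ε ^ 2) := by positivity
  have e5 : 0 < 1 / (γ * √d) := by positivity
  rw [errBound, e3]
  linarith

theorem exists_unit_of_rule {n : ℕ} {v : (Fin n → Fin n → ℝ) → (Fin n → ℝ)}
    (hv : IsLeadingEigenvectorRule n v) {X : Matrix (Fin n) (Fin n) ℝ} (hX : X.IsSymm) :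
    ∃ u : Fin n → ℝ, u ⬝ᵥ u = 1 ∧ (∀ w, w ⬝ᵥ w = 1 → quadForm X w ≤ quadForm X u) ∧
      signVec (v X) = signVec u := by
  obtain ⟨h0, l, hl, hmax⟩ := hv.2 X hX
  have hp : 0 < v X ⬝ᵥ v X := by
    refine lt_of_le_of_ne (Finset.sum_nonneg fun i _ => mul_self_nonneg _) fun h => h0 ?_
    exact dotProduct_self_eq_zero.1 h.symm
  set r := 1 / √(v X ⬝ᵥ v X) with hr
  have hrp : 0 < r := by positivity
  have hr2 : r * r * (v X ⬝ᵥ v X) = 1 := by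
    rw [hr, div_mul_div_comm, Real.mul_self_sqrt hp.le, one_mul, one_div_mul_cancel hp.ne']
  have hu : (r • v X) ⬝ᵥ (r • v X) = 1 := by
    rw [smul_dotProduct, dotProduct_smul, smul_eq_mul, smul_eq_mul, ← mul_assoc, hr2]
  refine ⟨r • v X, hu, fun w hw => ?_, ?_⟩
  · have h1 := hmax w
    rw [hw, mul_one] at h1
    refine h1.trans (le_of_eq ?_)
    rw [quadForm, Matrix.mulVec_smul, hl, smul_comm r l, dotProduct_smul, hu, smul_eq_mul, mul_one]
  · funext i
    simp only [signVec, Pi.smul_apply, smul_eq_mul, mul_nonneg_iff_of_pos_left hrp]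

theorem successProb_weakRecovery_ge {n : ℕ} {γ d ε δ : ℝ} (hγ : 0 < γ) (hd : 0 < d)
    (h : 12800 ≤ γ * √d) (hγ1 : γ ≤ 1) (hdn : (1 + γ) * d ≤ n) (hε : 0 < ε) (hδ : 0 < δ)
    (hδ1 : δ ≤ 1) {v : (Fin n → Fin n → ℝ) → (Fin n → ℝ)} (hv : IsLeadingEigenvectorRule n v)
    (x : Labels n) :
    1 - Real.exp (-n) ≤ successProb (gaussianArray n (noiseVar n γ d ε δ)) (weakRecovery γ d v)
      γ d x (2000000 * errBound γ d ε δ) := by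
  obtain ⟨h80, h1d, -, -, -, -⟩ := bounds_of_defined hγ hd h hγ1 hdn
  have hn : 0 < n := by omega
  have hvar := noiseVar_pos hn hγ hd hε hδ hδ1
  refine successProb_ge hn hγ h1d hγ1 hdn x (Real.toNNReal_pos.2 hvar).ne'
    (isGaussianFamily_gaussianArray (noiseVar n γ d ε δ)) (fun G g => ?_) ?_
  · obtain ⟨u, hu, hopt, hs⟩ :=
      exists_unit_of_rule hv (symmFill_isSymm_add (isSymm_proj (rescaledAdj γ d G)) g)
    refine ⟨proj (rescaledAdj γ d G), u, ?_, hu, fun w hw => (hopt w hw).trans ?_, hs⟩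
    · rw [sub_self]
      simp only [frobSq, Matrix.zero_apply]
      norm_num
    · exact le_add_of_nonneg_right (by positivity)
  · rw [Real.coe_toNNReal _ hvar.le]
    exact errBound_ge hγ hd h hγ1 hdn hδ hδ1 (noiseVar_le_progVar hγ hd)

theorem successProb_output_ge {n q : ℕ} (hnq : n ≤ q) {γ d ε δ : ℝ} (hγ : 0 < γ) (hd : 0 < d)
    (h : 12800 ≤ γ * √d) (hγ1 : γ ≤ 1) (hdn : (1 + γ) * d ≤ n) (hε : 0 < ε) (hδ : 0 < δ)
    (hδ1 : δ ≤ 1) (x : Labels n) :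
    1 - Real.exp (-n) ≤ successProb tapeLaw (output weakRecoveryProgram q γ d ε δ)
      γ d x (2000000 * errBound γ d ε δ) := by
  obtain ⟨h80, h1d, -, -, -, -⟩ := bounds_of_defined hγ hd h hγ1 hdn
  have hn : 0 < n := by omega
  have hnp : (0 : ℝ) < n := Nat.cast_pos.2 hn
  have hnq' : (n : ℝ) ≤ q := by exact_mod_cast hnq
  have hvar : 0 < progVar n γ d ε δ :=
    (noiseVar_pos hn hγ hd hε hδ hδ1).trans_le (noiseVar_le_progVar hγ hd)
  refine successProb_ge hn hγ h1d hγ1 hdn x (Real.toNNReal_pos.2 hvar).ne'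
    (isGaussianFamily_tapeLaw hvar.le rfl (drawIdx_injective (n := n))) (fun G ω => ?_) ?_
  · obtain ⟨u, ha, hu, hopt, hs⟩ := exists_unit_output hnq ε δ hγ hd h hγ1 hdn G ω
    refine ⟨_, u, ha.trans ?_, hu, fun w hw => (hopt w hw).trans ?_, hs⟩
    · gcongr
    · refine add_le_add le_rfl ?_
      gcongr
  · rw [Real.coe_toNNReal _ hvar.le]
    exact errBound_ge hγ hd h hγ1 hdn hδ hδ1 le_rfl

theorem executesWeakRecovery {n q : ℕ} (hnq : n ≤ q) {γ d ε : ℝ} (δ : ℝ) (hγ : 0 < γ)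
    (hd : 0 < d) (h : 12800 ≤ γ * √d) (hγ1 : γ ≤ 1) (hdn : (1 + γ) * d ≤ n) (hε1 : ε ≤ 1) :
    ExecutesWeakRecovery (n := n) weakRecoveryProgram q γ d ε δ := by
  refine ⟨fun G => approxProj q (rescaledAdj γ d G), drawIdx, drawIdx_injective, fun G => ?_⟩
  have key := exists_unit_output hnq ε δ hγ hd h hγ1 hdn G
  rw [progVar_of_le_one hε1] at key
  -- The accuracy of the projection does not involve the tape, so any tape, here `0`, supplies it.
  refine ⟨(key 0).choose_spec.1, fun ω => ?_⟩
  obtain ⟨u, -, hu, hopt, hs⟩ := key ω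
  exact ⟨_, u, rfl, hu, hopt, hs⟩

end PrivateSBM

end

/-! ### The theorem -/

open PrivateSBM in
theorem theorem5p2 :
    ∃ (C c : ℝ) (K : ℕ) (P : Cmd), 0 < C ∧ 0 < c ∧
      ∀ (n : ℕ) (γ d ε δ : ℝ), 0 < γ → 0 < d → 12800 ≤ γ * Real.sqrt d →
        0 < ε → 0 < δ → δ ≤ 1 →
        -- the algorithm is well defined and private, on every pair of adjacent input graphs
        (0 < n → ∃ v, IsLeadingEigenvectorRule n v) ∧
        (∀ v, IsLeadingEigenvectorRule n v → ε ≤ 1 →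
          IsEdgeDP (gaussianArray n (noiseVar n γ d ε δ)) (weakRecovery γ d v) ε δ) ∧
        -- the program runs in polynomial time and is private
        (∀ q : ℕ, n ≤ q →
          (∀ (G : SimpleGraph (Fin n)) (ω : ℕ → ℝ),
            (finalState P q γ d ε δ G ω).time ≤ K * (n + q + 1) ^ K) ∧
          IsEdgeDP tapeLaw (output (n := n) P q γ d ε δ) ε δ) ∧
        -- utility, whenever the stochastic block model is defined
        (γ ≤ 1 → (1 + γ) * d ≤ n →
          (∀ v, IsLeadingEigenvectorRule n v → ∀ x : Labels n,
            1 - Real.exp (-c * n) ≤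
              successProb (gaussianArray n (noiseVar n γ d ε δ)) (weakRecovery γ d v)
                γ d x (C * errBound γ d ε δ)) ∧
          ∀ q : ℕ, n ≤ q →
            (∀ x : Labels n,
              1 - Real.exp (-c * n) ≤
                successProb tapeLaw (output P q γ d ε δ) γ d x (C * errBound γ d ε δ)) ∧
            (ε ≤ 1 → ExecutesWeakRecovery (n := n) P q γ d ε δ)) := by
  obtain ⟨K, hK⟩ := weakRecoveryProgram_tame.time_le
  refine ⟨2000000, 1, K, weakRecoveryProgram, by norm_num, one_pos, ?_⟩
  intro n γ d ε δ hγ hd h hε hδ hδ1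
  simp only [neg_mul, one_mul]
  refine ⟨exists_leadingEigenvectorRule,
    fun v hv hε1 => isEdgeDP_weakRecovery hγ hd hε hε1 hδ hδ1 hv.1,
    fun q hnq => ⟨fun G ω => ?_, isEdgeDP_output hnq hγ hd h hε hδ hδ1⟩,
    fun hγ1 hdn => ⟨fun v hv x => successProb_weakRecovery_ge hγ hd h hγ1 hdn hε hδ hδ1 hv x,
      fun q hnq => ⟨fun x => successProb_output_ge hnq hγ hd h hγ1 hdn hε hδ hδ1 x,
        fun hε1 => executesWeakRecovery hnq δ hγ hd h hγ1 hdn hε1⟩⟩⟩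
  simpa [finalState, initState] using (hK ω (initState q γ d ε δ G)).2.2
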